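/- Let $\Gamma_1=\mathrm{SL}_2(\mathbb Z)$, $S=\begin{pmatrix}0&-1\\1&0\end{pmatrix}$, $T=\begin{pmatrix}1&1\\0&1\end{pmatrix}$, $U=TS$. For an integer $n\ge 1$ let $\mathcal M_n$ be the set of integral $2\times 2$ matrices of determinant $n$; a bar denotes the image of a set of matrices modulo $\pm1$, and $\mathcal R_n=\mathbb Q[\overline{\mathcal M}_n]$ is the $\mathbb Q$-vector space with basis $\overline{\mathcal M}_n$, on which $\mathcal R_1=\mathbb Q[\overline\Gamma_1]$ acts on both sides. Let $T_n^\infty\in\mathcal R_n$ be the sum of a system of representatives with lower left entry $0$ for $\overline\Gamma_1\backslash\overline{\mathcal M}_n$. Let $V$ be a finite-dimensional complex vector space with a linear right action of $\Gamma_1$, denoted $P|g$, such that $-1$ acts as the identity and $$V=\operatorname{Ker}(1+S)+\operatorname{Ker}(1+U+U^2),$$ and put $W=\operatorname{Ker}(1+S)\cap\operatorname{Ker}(1+U+U^2)$. Let $\Sigma_1\subset\mathcal M_n$ be a double coset, that is $\Gamma_1\Sigma_1\Gamma_1=\Sigma_1$, whose elements act linearly on $V$ in such a way that $P|(gM)=(P|g)|M$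 and $P|(Mg)=(P|M)|g$ for $P\in V$, $g\in\Gamma_1$, $M\in\Sigma_1$. Let the elements of $\mathcal M_n\setminus\Sigma_1$ act on $V$ as $0$, and extend the action to $\mathcal R_n$ by linearity (it is well defined modulo $\pm1$). For $M\in\mathcal M_n$ let $\operatorname{Stab}_{\overline\Gamma_1}M$ be the stabilizer of $\pm M$ under conjugation by $\overline\Gamma_1$, and for the $\overline\Gamma_1$-conjugacy class $X$ of $\pm M$ put $$\varepsilon(X)=\frac{\operatorname{sgn}(\operatorname{tr}(M)^2-4\det M)}{|\operatorname{Stab}_{\overline\Gamma_1}M|}\ \text{ if } M \text{ is not scalar},\qquad \varepsilon(X)=\frac{|\Gamma_1\backslash\mathbb H|}{2\pi}\ \text{ if } M \text{ is scalar},$$ where $1/\infty=0$ and $|\Gamma_1\backslash\mathbb H|$ is the area of a fundamental domain for the measure $dx\,dy/y^2$ on the upper half-plane $\mathbb H$. Let $\widetilde T_n\in\mathcal R_n$ be any element satisfying $$(1-S)\widetilde T_n-T_n^\infty(1-S)\in(1-T)\mathcal R_n.\tag{A}$$ Then $\widetilde T_n$ maps $W$ into itself, $\varepsilon(X)\neq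 0$ for only finitely many $\overline\Gamma_1$-conjugacy classes $X\subset\overline\Sigma_1$, and $$\operatorname{tr}(W|\widetilde T_n)=\sum_{X\subset\overline\Sigma_1}\operatorname{tr}(V|M_X)\,\varepsilon(X),$$ where the sum is over the $\overline\Gamma_1$-conjugacy classes $X$ in $\overline\Sigma_1$, and $M_X\in\Sigma_1$ is any representative of $X$. -/

import Mathlib

open scoped MatrixGroups

noncomputable section

namespace PeriodTrace

/-- Integral `2 × 2` matrices. -/
abbrev Mat : Type := Matrix (Fin 2) (Fin 2) ℤ

/-- `M_n`: integral matrices of determinant `n`. -/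
def detSet (n : ℕ) : Set Mat := {M | M.det = (n : ℤ)}

/-- The congruence `A ∼ ±A` on the multiplicative monoid of integral matrices. -/
def signCon : Con Mat where
  r A B := A = B ∨ A = -B
  iseqv :=
    { refl := fun _ => Or.inl rfl
      symm := by
        rintro A B (h | h)
        · exact Or.inl h.symm
        · exact Or.inr (by rw [h, neg_neg])
      trans := by
        rintro A B C (rfl | rfl) (rfl | rfl)
        · exact Or.inl rfl
        · exact Or.inr rfl
        · exact Or.inr rfl
        · exact Or.inl (neg_neg _) }
  mul' := by
    rintro A B C D (rfl | rfl) (rfl | rfl)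
    · exact Or.inl rfl
    · exact Or.inr (mul_neg _ _)
    · exact Or.inr (neg_mul _ _)
    · exact Or.inl (neg_mul_neg _ _)

/-- Integral matrices modulo `±1`, a monoid. -/
abbrev BarMat : Type := signCon.Quotient

/-- The class `±M` of a matrix `M`. -/
def bar (M : Mat) : BarMat := signCon.mk' M

/-- The image of a set of matrices modulo `±1`. -/
def barSet (s : Set Mat) : Set BarMat := bar '' s

/-- The image of `g ∈ SL₂(ℤ)` modulo `±1`. -/
def barSL (g : SL(2, ℤ)) : BarMat := bar (g : Mat)

/-- The algebra `ℚ[BarMat]`, in which all the spaces `R_n` live. -/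
abbrev BarAlg : Type := MonoidAlgebra ℚ BarMat

/-- `R_n`: the rational linear combinations of classes `±M` with `det M = n`. -/
def R (n : ℕ) : Submodule ℚ BarAlg := MonoidAlgebra.supported ℚ ℚ (barSet (detSet n))

/-- The basis element of `ℚ[BarMat]` given by `±M`. -/
def basisElt (M : Mat) : BarAlg := MonoidAlgebra.single (bar M) 1

/-- `s` is a system of representatives, consisting of matrices fixing the cusp `∞`, for the
coset space `SL₂(ℤ) \ M_n`. -/
def IsCuspReps (n : ℕ) (s : Finset Mat) : Prop :=
  (∀ M ∈ s, M.det = (n : ℤ) ∧ M 1 0 = 0) ∧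
    ∀ N : Mat, N.det = (n : ℤ) → ∃! M : Mat, M ∈ s ∧ ∃ g : SL(2, ℤ), M = (g : Mat) * N

/-- `T_n^∞`, the sum of the chosen representatives. -/
def Tinf (s : Finset Mat) : BarAlg := ∑ M ∈ s, basisElt M

/-- Property (A): `(1 - S) x - T_n^∞ (1 - S) ∈ (1 - T) R_n`. -/
def PropertyA (n : ℕ) (s : Finset Mat) (x : BarAlg) : Prop :=
  ∃ y ∈ R n,
    (1 - basisElt (ModularGroup.S : Mat)) * x - Tinf s * (1 - basisElt (ModularGroup.S : Mat)) =
      (1 - basisElt (ModularGroup.T : Mat)) * y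

/-- `U = T S`. -/
def U : SL(2, ℤ) := ModularGroup.T * ModularGroup.S

/-- `Sig` is a double coset: `SL₂(ℤ) Sig SL₂(ℤ) = Sig`. -/
def IsDoubleCoset (Sig : Set Mat) : Prop :=
  ∀ (g h : SL(2, ℤ)), ∀ M ∈ Sig, (g : Mat) * M * (h : Mat) ∈ Sig

section Module

variable {V : Type*} [AddCommGroup V] [Module ℂ V]

/-- A right `SL₂(ℤ)`-module over `ℂ` is a representation of the opposite group, and
`P|g` is `slash ρ g P`. -/
def slash (ρ : Representation ℂ (SL(2, ℤ))ᵐᵒᵖ V) (g : SL(2, ℤ)) : V →ₗ[ℂ] V :=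
  ρ (MulOpposite.op g)

/-- `Ker(1 + S)` -/
def kerS (ρ : Representation ℂ (SL(2, ℤ))ᵐᵒᵖ V) : Submodule ℂ V :=
  LinearMap.ker (1 + slash ρ ModularGroup.S)

/-- `Ker(1 + U + U²)` -/
def kerU (ρ : Representation ℂ (SL(2, ℤ))ᵐᵒᵖ V) : Submodule ℂ V :=
  LinearMap.ker (1 + slash ρ U + slash ρ (U ^ 2))

/-- The period subspace `W`. -/
def periodSubspace (ρ : Representation ℂ (SL(2, ℤ))ᵐᵒᵖ V) : Submodule ℂ V :=
  kerS ρ ⊓ kerU ρ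

/-- The operators `act M`, for `M` in `Sig`, are compatible with the right action of `SL₂(ℤ)`:
`P|(gM) = (P|g)|M` and `P|(Mg) = (P|M)|g`. -/
def IsCompatible (ρ : Representation ℂ (SL(2, ℤ))ᵐᵒᵖ V) (Sig : Set Mat)
    (act : Mat → (V →ₗ[ℂ] V)) : Prop :=
  ∀ (g : SL(2, ℤ)), ∀ M ∈ Sig, ∀ P : V,
    act ((g : Mat) * M) P = act M (slash ρ g P) ∧ act (M * (g : Mat)) P = slash ρ g (act M P)

open Classical in
/-- The action of `Sig`, extended so that matrices outside `Sig` annihilate `V`. -/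
def extAct (Sig : Set Mat) (act : Mat → (V →ₗ[ℂ] V)) (M : Mat) : V →ₗ[ℂ] V :=
  if M ∈ Sig then act M else 0

/-- The extended action of a class `±M`, through a representative; see `barAct_bar` for the
independence of the representative. -/
def barAct (Sig : Set Mat) (act : Mat → (V →ₗ[ℂ] V)) (X : BarMat) : V →ₗ[ℂ] V :=
  extAct Sig act (Quotient.out X)

/-- The extended action of `ℚ[BarMat]` on `V`, by linearity: `P ↦ P|x`. -/
def algAct (Sig : Set Mat) (act : Mat → (V →ₗ[ℂ] V)) (x : BarAlg) : V →ₗ[ℂ] V :=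
  x.coeff.sum fun X c => (c : ℂ) • barAct Sig act X

theorem extAct_neg {ρ : Representation ℂ (SL(2, ℤ))ᵐᵒᵖ V} {Sig : Set Mat}
    {act : Mat → (V →ₗ[ℂ] V)} (hρ : slash ρ (-1) = 1) (hS : IsDoubleCoset Sig)
    (hc : IsCompatible ρ Sig act) (M : Mat) : extAct Sig act (-M) = extAct Sig act M := by
  have key : ∀ N ∈ Sig, -N ∈ Sig := fun N hN => by simpa using hS (-1) 1 N hN
  by_cases hM : M ∈ Sig
  · rw [extAct, extAct, if_pos hM, if_pos (key M hM)]
    ext P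
    have := (hc (-1) M hM P).1
    rw [hρ] at this
    simpa using this
  · have hM' : -M ∉ Sig := fun h => hM (by simpa using key _ h)
    rw [extAct, extAct, if_neg hM, if_neg hM']

/-- The extended action of `±M` does not depend on the representative. -/
theorem barAct_bar {ρ : Representation ℂ (SL(2, ℤ))ᵐᵒᵖ V} {Sig : Set Mat}
    {act : Mat → (V →ₗ[ℂ] V)} (hρ : slash ρ (-1) = 1) (hS : IsDoubleCoset Sig)
    (hc : IsCompatible ρ Sig act) (M : Mat) : barAct Sig act (bar M) = extAct Sig act M := by
  have h : signCon (Quotient.out (bar M)) M := Quotient.exact (Quotient.out_eq (bar M))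
  rcases h with h | h
  · rw [barAct, h]
  · rw [barAct, h, extAct_neg hρ hS hc]

end Module

/-- Conjugacy of classes `±M` under the image of `SL₂(ℤ)`: `g X g⁻¹ = Y`. -/
def conjSetoid : Setoid BarMat where
  r X Y := ∃ g : SL(2, ℤ), barSL g * X * barSL g⁻¹ = Y
  iseqv :=
    have hmul : ∀ g h : SL(2, ℤ), barSL (g * h) = barSL g * barSL h := fun g h => by
      simp [barSL, bar]
    have hone : barSL 1 = 1 := by simp [barSL, bar]
    { refl := fun X => ⟨1, by simp [hone]⟩
      symm := by
        rintro X Y ⟨g, rfl⟩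
        refine ⟨g⁻¹, ?_⟩
        have h1 : barSL g⁻¹ * barSL g = 1 := by rw [← hmul, inv_mul_cancel, hone]
        rw [inv_inv, mul_assoc, mul_assoc, h1, mul_one, ← mul_assoc, h1, one_mul]
      trans := by
        rintro X Y Z ⟨g, rfl⟩ ⟨h, rfl⟩
        refine ⟨h * g, ?_⟩
        rw [mul_inv_rev, hmul, hmul]
        simp only [mul_assoc] }

/-- Conjugacy classes of elements `±M` under the image of `SL₂(ℤ)`. -/
abbrev ConjClass : Type := Quotient conjSetoid

/-- The conjugacy class of `±M`. -/
def conjClass (M : Mat) : ConjClass := Quotient.mk conjSetoid (bar M)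

/-- The conjugacy classes contained in the image of `Sig` modulo `±1`. -/
def classesIn (Sig : Set Mat) : Set ConjClass := conjClass '' Sig

/-- The stabilizer of `±M` under conjugation by `PSL₂(ℤ)`, the latter being realized as the image
of `SL₂(ℤ)` among matrices modulo `±1`. -/
def stab (M : Mat) : Set BarMat :=
  {γ | ∃ g : SL(2, ℤ), γ = barSL g ∧ barSL g * bar M * barSL g⁻¹ = bar M}

/-- The area of `SL₂(ℤ) \ ℍ` for the hyperbolic measure `dx dy / y²`, computed on the standard
fundamental domain. -/
def modularArea : ℝ := (MeasureTheory.volume ModularGroup.fd).toReal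

open Classical in
/-- The invariant `ε` of the conjugacy class of `±M`: it is `|SL₂(ℤ) \ ℍ| / 2π` if `M` is scalar,
and otherwise `sgn (tr(M)² - 4 det(M))` divided by the order of the stabilizer, with `1/∞ = 0`
(`Nat.card` of an infinite set is `0`). -/
def eps (M : Mat) : ℝ :=
  if ∃ l : ℤ, M = Matrix.scalar (Fin 2) l then modularArea / (2 * Real.pi)
  else (SignType.sign (M.trace ^ 2 - 4 * M.det) : ℝ) / (Nat.card (stab M) : ℝ)

end PeriodTrace

end

open scoped MatrixGroups

noncomputable section

namespace PeriodTrace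

/-! ### Integral matrices -/

/-! The proof builds one explicit Hecke element `theta` whose trace can be read off from its
coefficients. Its coefficient at `±N` is `wt N = qv N - hv N`. Here `hv` tests whether `i` lies in
the `N`-image of the right half-plane, and `qv` tests whether the third-order elliptic point lies in
the `N`-image of the region to the right of the path from `0` to `∞` through that point; boundary
cases are shared. The two regions have the same ends, so only finitely many `N` of given determinant
have nonzero weight (`finite_wt_ne_zero`).

The tests are adapted to the two finite subgroups. The function `hv` is left `S`-invariant and its
values at `N` and `N * S` add up to 1. The function `qv` is left `U`-invariant and its values at
`N`, `N * U`, `N * U * U` add up to 2. Hence `theta * (1 + S)` is left invariant under `U`, and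
`theta * (1 + U + U²)` is left invariant under `S`. So `theta` exchanges `Ker(1+S)` and
`Ker(1+U+U²)`. An operator exchanging two subspaces that span `V` has the same trace on `V` as on
their intersection `W` (`trace_restrict_of_swap`).

Moreover `theta` has property (A) (`propertyA_theta`): the coefficients of `(1 - S) * theta` are `qv
N - qv (T * N)`, which telescope along `T`-orbits, and only the limits of `qv` at the cusp survive.
Any two elements with property (A) act equally on `W`: if `(1 - S) * x` lies in `(1 - T) R_n`, then
`x` is a sum of a multiple of `1 + S` and a multiple of `1 + U + U²` (`exists_decomposition`). This
rests on the tree of the modular group having no cycles (`eq_zero_of_S_of_U`). It remains to compute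
the trace of `theta` on `V`, where conjugate matrices have equal traces.

So everything comes down to the sum of `wt` over a conjugacy class, which must be `2 * eps` since
`N` and `-N` are both counted (`two_mul_eps`). The two tests are compared with `pv`, which records
the side of the imaginary axis on which the fixed points of `N` lie. The difference `hv - pv` is odd
under conjugation by `S`. For nonnegative discriminant `qv - pv` sums to zero over each orbit of
conjugation by `U`. Sums of such functions vanish when their supports are finite. The supports are
infinite only because of matrices fixing `0` or `∞`; subtracting the correction `kap` makes them
finite, at the cost of a `T`-difference of `kap` on upper triangular matrices. That difference
telescopes to 2 when the eigenvalues are distinct and rational, and vanishes for the other nonscalar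
classes of nonnegative discriminant.

For elliptic classes the sum is taken over the group instead of the class. The obstruction is then
the function `chi`, whose total is the same for every elliptic matrix with positive lower left entry
(`sum_chi_cj`) and is evaluated at `S`. Scalar matrices are computed directly and compared with the
area `π / 3`. -/

theorem coe_S : ((ModularGroup.S : SL(2, ℤ)) : Mat) = !![0, -1; 1, 0] := ModularGroup.coe_S

theorem coe_T : ((ModularGroup.T : SL(2, ℤ)) : Mat) = !![1, 1; 0, 1] := ModularGroup.coe_T

theorem coe_U : (U : Mat) = !![1, -1; 1, 0] := by
  simp [U]

theorem coe_S_inv : ((ModularGroup.S⁻¹ : SL(2, ℤ)) : Mat) = !![0, 1; -1, 0] := by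
  simp [Matrix.SpecialLinearGroup.coe_inv, Matrix.adjugate_fin_two]

theorem coe_T_inv : ((ModularGroup.T⁻¹ : SL(2, ℤ)) : Mat) = !![1, -1; 0, 1] := by
  simp [Matrix.SpecialLinearGroup.coe_inv, Matrix.adjugate_fin_two]

theorem coe_U_inv : ((U⁻¹ : SL(2, ℤ)) : Mat) = !![0, 1; -1, 1] := by
  simp [Matrix.SpecialLinearGroup.coe_inv, coe_U, Matrix.adjugate_fin_two]

theorem exists_entries (N : Mat) : ∃ a b c d : ℤ, N = !![a, b; c, d] :=
  ⟨_, _, _, _, Matrix.eta_fin_two N⟩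

theorem neg_fin_two (a b c d : ℤ) : -(!![a, b; c, d] : Mat) = !![-a, -b; -c, -d] := by
  ext i j; fin_cases i <;> fin_cases j <;> rfl

theorem finite_of_entries_le (B : ℤ) : {N : Mat | ∀ i j, |N i j| ≤ B}.Finite := by
  have h : (Set.pi Set.univ fun _ : Fin 2 => Set.pi Set.univ fun _ : Fin 2 =>
      Set.Icc (-B) B).Finite :=
    Set.Finite.pi fun _ => Set.Finite.pi fun _ => Set.finite_Icc _ _
  refine h.subset fun N hN => ?_
  simp only [Set.mem_pi, Set.mem_univ, true_imp_iff, Set.mem_Icc]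
  exact fun i j => abs_le.1 (hN i j)

theorem finite_of_bounded {p : Mat → Prop} (B : ℤ)
    (h : ∀ a b c d : ℤ, p !![a, b; c, d] → |a| ≤ B ∧ |b| ≤ B ∧ |c| ≤ B ∧ |d| ≤ B) :
    {N | p N}.Finite := by
  refine (finite_of_entries_le B).subset fun N hN => ?_
  obtain ⟨a, b, c, d, rfl⟩ := exists_entries N
  obtain ⟨h1, h2, h3, h4⟩ := h a b c d hN
  intro i j
  fin_cases i <;> fin_cases j <;> assumption

/-! ### Weights -/

/-- The norm form of the Eisenstein integers. -/
def hex (x y : ℤ) : ℤ := x ^ 2 - x * y + y ^ 2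

theorem hex_nonneg (x y : ℤ) : 0 ≤ hex x y := by
  unfold hex; nlinarith [sq_nonneg (x - y), sq_nonneg x, sq_nonneg y]

theorem sq_le_hex_left (x y : ℤ) : 3 * x ^ 2 ≤ 4 * hex x y := by
  unfold hex; nlinarith [sq_nonneg (x - 2 * y)]

theorem sq_le_hex_right (x y : ℤ) : 3 * y ^ 2 ≤ 4 * hex x y := by
  unfold hex; nlinarith [sq_nonneg (2 * x - y)]

theorem hex_neg (x y : ℤ) : hex (-x) (-y) = hex x y := by unfold hex; ring

/-- The indicator of `z` being the largest of three numbers, ties being shared. -/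
def lead (x y z : ℤ) : ℚ :=
  if z < x ∨ z < y then 0
  else if x < z then (if y < z then 1 else 1 / 2)
  else if y < z then 1 / 2 else 1 / 3

/-- The shares assigned in case of ties make the three cyclic rotations partition unity exactly,
with no exceptional boundary. -/
theorem lead_cyc (x y z : ℤ) : lead x y z + lead y z x + lead z x y = 1 := by
  unfold lead
  split_ifs <;> first | (exfalso; omega) | norm_num

theorem lead_comm (x y z : ℤ) : lead x y z = lead y x z := by
  unfold lead
  split_ifs <;> first | rfl | omega

theorem lead_eq_one {x y z : ℤ} (h1 : x < z) (h2 : y < z) : lead x y z = 1 := by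
  unfold lead
  rw [if_neg (by omega), if_pos h1, if_pos h2]

theorem lead_eq_zero {x y z : ℤ} (h : z < x ∨ z < y) : lead x y z = 0 := by
  unfold lead
  rw [if_pos h]

/-- The position of `i` relative to the image under `N` of the right half of the upper
half-plane. -/
def hv (N : Mat) : ℚ := (1 - ((N 0 0 * N 0 1 + N 1 0 * N 1 1).sign : ℚ)) / 2

/-- The position of `ρ = exp(π i / 3)` relative to the image under `N` of the region to the right
of the geodesic path from `0` to `∞` through `ρ`. -/
def qv (N : Mat) : ℚ :=
  1 - lead (hex (N 0 0) (N 1 0)) (hex (N 0 1) (N 1 1)) (hex (N 0 0 + N 0 1) (N 1 0 + N 1 1))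

/-- The weights of the Hecke element. -/
def wt (N : Mat) : ℚ := qv N - hv N

theorem hv_mk (a b c d : ℤ) : hv !![a, b; c, d] = (1 - ((a * b + c * d).sign : ℚ)) / 2 := rfl

theorem qv_mk (a b c d : ℤ) :
    qv !![a, b; c, d] = 1 - lead (hex a c) (hex b d) (hex (a + b) (c + d)) := rfl

theorem hv_neg (N : Mat) : hv (-N) = hv N := by
  simp [hv]

theorem qv_neg (N : Mat) : qv (-N) = qv N := by
  obtain ⟨a, b, c, d, rfl⟩ := exists_entries N
  rw [neg_fin_two, qv_mk, qv_mk, hex_neg, hex_neg, ← neg_add, ← neg_add, hex_neg]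

theorem wt_neg (N : Mat) : wt (-N) = wt N := by rw [wt, wt, hv_neg, qv_neg]

/-- The point `i` being tested is fixed by `S`. -/
theorem hv_S_mul (N : Mat) : hv ((ModularGroup.S : SL(2, ℤ)) * N) = hv N := by
  obtain ⟨a, b, c, d, rfl⟩ := exists_entries N
  rw [coe_S, Matrix.mul_fin_two, hv_mk, hv_mk]
  ring_nf

/-- On the right, `S` exchanges the two halves of the upper half-plane; on the boundary both sides
are `1 / 2`. -/
theorem hv_mul_S (N : Mat) : hv (N * (ModularGroup.S : SL(2, ℤ))) = 1 - hv N := by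
  obtain ⟨a, b, c, d, rfl⟩ := exists_entries N
  rw [coe_S, Matrix.mul_fin_two, hv_mk, hv_mk]
  have : (a * 0 + b * 1) * (a * -1 + b * 0) + (c * 0 + d * 1) * (c * -1 + d * 0) =
    -(a * b + c * d) := by ring
  rw [this, Int.sign_neg]
  push_cast
  ring

theorem qv_U_mul (N : Mat) : qv (U * N) = qv N := by
  obtain ⟨a, b, c, d, rfl⟩ := exists_entries N
  rw [coe_U, Matrix.mul_fin_two, qv_mk, qv_mk]
  congr 2 <;> unfold hex <;> ring

/-- Right multiplication by `U` permutes cyclically, up to sign, the columns of `N` and their sum.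
The three `lead` terms therefore add up to 1, leaving `3 - 1`. -/
theorem qv_mul_U (N : Mat) : qv N + qv (N * U) + qv (N * U * U) = 2 := by
  obtain ⟨a, b, c, d, rfl⟩ := exists_entries N
  rw [coe_U, Matrix.mul_fin_two, Matrix.mul_fin_two, qv_mk, qv_mk, qv_mk]
  have h1 : hex (a * 1 + b * 1) (c * 1 + d * 1) = hex (a + b) (c + d) := by ring_nf
  have h2 : hex (a * -1 + b * 0) (c * -1 + d * 0) = hex a c := by
    rw [← hex_neg]; ring_nf
  have h3 : hex (a * 1 + b * 1 + (a * -1 + b * 0)) (c * 1 + d * 1 + (c * -1 + d * 0)) =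
    hex b d := by ring_nf
  have h4 : hex ((a * 1 + b * 1) * 1 + (a * -1 + b * 0) * 1)
    ((c * 1 + d * 1) * 1 + (c * -1 + d * 0) * 1) = hex b d := by ring_nf
  have h5 : hex ((a * 1 + b * 1) * -1 + (a * -1 + b * 0) * 0)
    ((c * 1 + d * 1) * -1 + (c * -1 + d * 0) * 0) = hex (a + b) (c + d) := by
    rw [← hex_neg]; ring_nf
  have h6 : hex ((a * 1 + b * 1) * 1 + (a * -1 + b * 0) * 1 +
      ((a * 1 + b * 1) * -1 + (a * -1 + b * 0) * 0))
    ((c * 1 + d * 1) * 1 + (c * -1 + d * 0) * 1 +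
      ((c * 1 + d * 1) * -1 + (c * -1 + d * 0) * 0)) = hex a c := by
    rw [← hex_neg]; ring_nf
  rw [h1, h2, h3, h4, h5, h6]
  have := lead_cyc (hex a c) (hex b d) (hex (a + b) (c + d))
  linarith [lead_comm (hex b d) (hex (a + b) (c + d)) (hex a c)]

theorem U_mul_S : ((U : SL(2, ℤ)) : Mat) * (ModularGroup.S : SL(2, ℤ)) =
    -(ModularGroup.T : SL(2, ℤ)) := by
  rw [coe_U, coe_S, coe_T, Matrix.mul_fin_two, neg_fin_two]
  norm_num

theorem qv_S_mul (N : Mat) :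
    qv ((ModularGroup.S : SL(2, ℤ)) * N) = qv ((ModularGroup.T : SL(2, ℤ)) * N) := by
  rw [← qv_U_mul, ← mul_assoc, U_mul_S, neg_mul, qv_neg]

/-- This is the source of property (A): `hv` does not see a left `S`, and for `qv` a left `S`
amounts to a left `T` because `U * S = -T`. -/
theorem wt_sub_wt_S_mul (N : Mat) : wt N - wt ((ModularGroup.S : SL(2, ℤ)) * N) =
    qv N - qv ((ModularGroup.T : SL(2, ℤ)) * N) := by
  rw [wt, wt, hv_S_mul, qv_S_mul]
  ring

/-- Two definite Gram matrices whose off-diagonal entries have opposite signs have bounded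
diagonal entries. -/
theorem gram_bound {a b c d n : ℤ} (hn : a * d - b * c = n)
    (h : (a * b + c * d) * (hex (a + b) (c + d) - hex a c - hex b d) ≤ 0) :
    (a ^ 2 + c ^ 2) * hex b d + (b ^ 2 + d ^ 2) * hex a c ≤ 2 * n ^ 2 := by
  subst hn
  -- The polarized discriminant of `x ^ 2 + y ^ 2` and `hex`, which is multiplied by the square of
  -- the determinant when both forms are pulled back by the matrix.
  have : (a ^ 2 + c ^ 2) * hex b d + (b ^ 2 + d ^ 2) * hex a c -
      (a * b + c * d) * (hex (a + b) (c + d) - hex a c - hex b d) = 2 * (a * d - b * c) ^ 2 := by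
    unfold hex; ring
  linarith

theorem abs_le_of_sq_le {x B : ℤ} (h : x ^ 2 ≤ B) : |x| ≤ B := by
  have h0 : |x| ^ 2 ≤ B := by rwa [sq_abs]
  nlinarith [abs_nonneg x]

theorem hex_pos_left {a c : ℤ} (h : a ≠ 0 ∨ c ≠ 0) : 1 ≤ hex a c := by
  by_contra hlt
  have h0 : hex a c = 0 := by have := hex_nonneg a c; omega
  have h1 := sq_le_hex_left a c
  have h2 := sq_le_hex_right a c
  rw [h0] at h1 h2
  rcases h with h | h
  · have := pow_pos (abs_pos.2 h) 2; rw [sq_abs] at this; omega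
  · have := pow_pos (abs_pos.2 h) 2; rw [sq_abs] at this; omega

theorem entries_le_of_hex_le {a b c d n : ℤ} (h1 : hex a c ≤ 3 * n ^ 2) (h2 : hex b d ≤ 3 * n ^ 2) :
    |a| ≤ 4 * n ^ 2 ∧ |b| ≤ 4 * n ^ 2 ∧ |c| ≤ 4 * n ^ 2 ∧ |d| ≤ 4 * n ^ 2 :=
  ⟨abs_le_of_sq_le (by linarith [sq_le_hex_left a c]),
    abs_le_of_sq_le (by linarith [sq_le_hex_left b d]),
    abs_le_of_sq_le (by linarith [sq_le_hex_right a c]),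
    abs_le_of_sq_le (by linarith [sq_le_hex_right b d])⟩

/-- Pull back both `x ^ 2 + y ^ 2` and `hex`. If their cross terms have opposite signs, `gram_bound`
applies. If not, a nonzero weight is possible only when both cross terms are negative and the
pulled-back `hex` is reduced, and reduced forms of discriminant `-3 * n ^ 2` are bounded. -/
theorem hex_le_of_wt_ne_zero {a b c d n : ℤ} (hn : 0 < n) (hdet : a * d - b * c = n)
    (hw : wt !![a, b; c, d] ≠ 0) : hex a c ≤ 3 * n ^ 2 ∧ hex b d ≤ 3 * n ^ 2 := by
  have hA : 1 ≤ hex a c := hex_pos_left (by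
    by_contra h; push Not at h; rw [h.1, h.2] at hdet; simp at hdet; omega)
  have hC : 1 ≤ hex b d := hex_pos_left (by
    by_contra h; push Not at h; rw [h.1, h.2] at hdet; simp at hdet; omega)
  have key : (a * b + c * d) * (hex (a + b) (c + d) - hex a c - hex b d) ≤ 0 →
      hex a c ≤ 3 * n ^ 2 ∧ hex b d ≤ 3 * n ^ 2 := by
    intro h
    have hb := gram_bound hdet h
    have ha' : 1 ≤ a ^ 2 + c ^ 2 := by
      have h1 : 2 * (a ^ 2 + c ^ 2) ≥ hex a c := by
        unfold hex; nlinarith [sq_nonneg (a + c)]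
      omega
    have hb' : 1 ≤ b ^ 2 + d ^ 2 := by
      have h1 : 2 * (b ^ 2 + d ^ 2) ≥ hex b d := by
        unfold hex; nlinarith [sq_nonneg (b + d)]
      omega
    constructor <;> nlinarith
  rw [wt, qv_mk, hv_mk] at hw
  set A := hex a c with hAdef
  set C := hex b d with hCdef
  set D := hex (a + b) (c + d) with hDdef
  have hdisc : 4 * (A * C) - (D - A - C) ^ 2 = 3 * n ^ 2 := by
    rw [hAdef, hCdef, hDdef, ← hdet]; unfold hex; ring
  rcases lt_trichotomy (a * b + c * d) 0 with hu | hu | hu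
  · by_cases hB : 0 ≤ D - A - C
    · exact key (by nlinarith)
    · rw [Int.sign_eq_neg_one_of_neg hu] at hw
      by_cases hD : D < A ∨ D < C
      · rw [lead_eq_zero hD] at hw; norm_num at hw
      · push Not at hD
        -- `D` is at least `A` and `C`, so the negative cross term has absolute value at most `min A
        -- C`.
        have h1 : (D - A - C) ^ 2 ≤ A * C := by nlinarith
        constructor <;> nlinarith
  · exact key (by rw [hu]; simp)
  · rw [Int.sign_eq_one_of_pos hu] at hw
    by_cases hD : A < D ∧ C < D
    · rw [lead_eq_one hD.1 hD.2] at hw; norm_num at hw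
    · exact key (by
        have : D - A - C ≤ 0 := by omega
        nlinarith)

theorem finite_wt_ne_zero {n : ℕ} (hn : 0 < n) : {N : Mat | N ∈ detSet n ∧ wt N ≠ 0}.Finite := by
  refine finite_of_bounded (4 * (n : ℤ) ^ 2) fun a b c d h => ?_
  have hdet : a * d - b * c = n := by
    have : Matrix.det !![a, b; c, d] = (n : ℤ) := h.1
    rwa [Matrix.det_fin_two_of] at this
  obtain ⟨h1, h2⟩ := hex_le_of_wt_ne_zero (by exact_mod_cast hn) hdet h.2
  exact entries_le_of_hex_le h1 h2

open Filter

/-! ### Telescoping sums -/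

theorem telescope {f : ℤ → ℚ} {l₀ l₁ : ℚ} (h₀ : ∀ᶠ k in atBot, f k = l₀)
    (h₁ : ∀ᶠ k in atTop, f k = l₁) :
    (Function.support fun k => f k - f (k + 1)).Finite ∧
      ∑ᶠ k, (f k - f (k + 1)) = l₀ - l₁ := by
  obtain ⟨K₀, h₀⟩ := eventually_atBot.1 h₀
  obtain ⟨K₁, h₁⟩ := eventually_atTop.1 h₁
  obtain ⟨K, hK₀, hK₁⟩ : ∃ K : ℕ, -(K : ℤ) + 1 ≤ K₀ ∧ K₁ ≤ K :=
    ⟨K₀.natAbs + K₁.natAbs + 1, by omega, by omega⟩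
  have hsub : (Function.support fun k => f k - f (k + 1)) ⊆
      ((Finset.range (2 * K)).image fun i : ℕ => (i : ℤ) - K : Finset ℤ) := by
    intro k hk
    simp only [Finset.coe_image, Set.mem_image, Finset.coe_range, Set.mem_Iio]
    by_cases h1 : k < -K
    · exact absurd (by simp only; rw [h₀ k (by omega), h₀ (k + 1) (by omega), sub_self]) hk
    by_cases h2 : (K : ℤ) ≤ k
    · exact absurd (by simp only; rw [h₁ k (by omega), h₁ (k + 1) (by omega), sub_self]) hk
    exact ⟨(k + K).toNat, by omega, by omega⟩
  refine ⟨(Finset.finite_toSet _).subset hsub, ?_⟩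
  rw [finsum_eq_sum_of_support_subset _ hsub,
    Finset.sum_image (fun i _ j _ h => by simpa using h)]
  have := Finset.sum_range_sub' (fun i : ℕ => f ((i : ℤ) - K)) (2 * K)
  rw [← h₀ (-K) (by omega), ← h₁ K hK₁]
  convert this using 2
  · congr 2; push_cast; ring
  · congr 1; simp
  · congr 1; push_cast; ring

theorem quad_pos {p q r k : ℤ} (hp : 0 < p) (hk : |q| + |r| < |k|) :
    0 < p * k ^ 2 + q * k + r := by
  have h1 : -(|q| * |k|) ≤ q * k := by rw [← abs_mul]; exact neg_abs_le _
  have h2 := neg_abs_le r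
  have h3 : |k| ^ 2 = k ^ 2 := sq_abs k
  nlinarith [abs_nonneg q, abs_nonneg r, abs_nonneg k]

theorem linear_pos {q r k : ℤ} (hq : 0 < q) (hk : |r| < k) : 0 < q * k + r := by
  have h2 := neg_abs_le r
  nlinarith [abs_nonneg r]

theorem quad_pos_eventually {p : ℤ} (q r : ℤ) (hp : 0 < p) :
    (∀ᶠ k in atBot, 0 < p * k ^ 2 + q * k + r) ∧ ∀ᶠ k in atTop, 0 < p * k ^ 2 + q * k + r :=
  ⟨eventually_atBot.2 ⟨-(|q| + |r| + 1), fun k hk => quad_pos hp (by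
    have := neg_abs_le k; omega)⟩,
  eventually_atTop.2 ⟨|q| + |r| + 1, fun k hk => quad_pos hp (by have := le_abs_self k; omega)⟩⟩

theorem linear_pos_atTop {q : ℤ} (r : ℤ) (hq : 0 < q) : ∀ᶠ k in atTop, 0 < q * k + r :=
  eventually_atTop.2 ⟨|r| + 1, fun k hk => linear_pos hq (by omega)⟩

theorem linear_pos_atBot {q : ℤ} (r : ℤ) (hq : q < 0) : ∀ᶠ k in atBot, 0 < q * k + r :=
  eventually_atBot.2 ⟨-(|r| + 1), fun k hk => by
    have := linear_pos (q := -q) (r := r) (k := -k) (by omega) (by omega)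
    linarith⟩

/-- The limits of `qv` along an orbit of left multiplication by `T`. -/
theorem qv_limits {a b c d : ℤ} (hdet : 0 < a * d - b * c) :
    ∃ l₀ l₁ : ℚ, (∀ᶠ k in atBot, qv !![a + k * c, b + k * d; c, d] = l₀) ∧
      (∀ᶠ k in atTop, qv !![a + k * c, b + k * d; c, d] = l₁) ∧
      l₀ - l₁ = (if c = 0 then 1 else 0) - (if d = 0 then 1 else 0) := by
  -- The three values of `hex` grow like `c ^ 2`, `d ^ 2`, `(c + d) ^ 2` times `k ^ 2`. Two of these
  -- leading terms tie for the maximum exactly when `c = 0` or `d = 0`. Then the linear term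
  -- decides, with opposite outcomes at the two ends; otherwise the two limits agree.
  by_cases hc : c = 0
  · subst hc
    have had : 0 < a * d := by linarith
    have ha : a ≠ 0 := by rintro rfl; simp at had
    have hd : d ≠ 0 := by rintro rfl; simp at had
    have hd2 : 0 < d ^ 2 := by positivity
    refine ⟨1, 0, ?_, ?_, by simp [hd]⟩
    · filter_upwards [linear_pos_atBot (q := -(2 * a * d)) (-(a ^ 2 + 2 * a * b - a * d))
        (by linarith)] with k hk
      rw [qv_mk, lead_eq_zero, sub_zero]
      right
      unfold hex
      nlinarith
    · filter_upwards [linear_pos_atTop (q := 2 * a * d) (a ^ 2 + 2 * a * b - a * d) (by linarith),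
        (quad_pos_eventually (2 * (a + b) * d - d * d)
          ((a + b) ^ 2 - (a + b) * d + d ^ 2 - a ^ 2) hd2).2]
        with k hk hk'
      rw [qv_mk, lead_eq_one, sub_self]
      · unfold hex
        nlinarith
      · unfold hex
        nlinarith
  by_cases hd : d = 0
  · subst hd
    have hbc : 0 < -(b * c) := by linarith
    have hc2 : 0 < c ^ 2 := by positivity
    refine ⟨0, 1, ?_, ?_, by simp [hc]⟩
    · filter_upwards [linear_pos_atBot (q := 2 * b * c) (b ^ 2 + 2 * a * b - b * c) (by linarith),
        (quad_pos_eventually (2 * (a + b) * c - c * c)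
          ((a + b) ^ 2 - (a + b) * c + c ^ 2 - b ^ 2) hc2).1]
        with k hk hk'
      rw [qv_mk, lead_eq_one, sub_self]
      · unfold hex
        nlinarith
      · unfold hex
        nlinarith
    · filter_upwards [linear_pos_atTop (q := -(2 * b * c)) (-(b ^ 2 + 2 * a * b - b * c))
        (by linarith)] with k hk
      rw [qv_mk, lead_eq_zero, sub_zero]
      left
      unfold hex
      nlinarith
  rcases lt_or_gt_of_ne (mul_ne_zero hc hd) with hcd | hcd
  · by_cases h : 0 < c ^ 2 - (c + d) ^ 2
    · have key : ∀ k : ℤ, 0 < (c ^ 2 - (c + d) ^ 2) * k ^ 2 + (2 * a * c - c * c -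
          2 * (a + b) * (c + d) + (c + d) * (c + d)) * k + (hex a c - hex (a + b) (c + d)) →
          qv !![a + k * c, b + k * d; c, d] = 1 := by
        intro k hk
        rw [qv_mk, lead_eq_zero, sub_zero]
        left
        unfold hex at hk ⊢
        linarith
      exact ⟨1, 1, (quad_pos_eventually _ _ h).1.mono key, (quad_pos_eventually _ _ h).2.mono key,
        by simp [hc, hd]⟩
    · have h' : 0 < d ^ 2 - (c + d) ^ 2 := by
        by_contra h'
        have h1 : 2 * -(c * d) ≤ d ^ 2 := by linarith
        have h2 : 2 * -(c * d) ≤ c ^ 2 := by linarith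
        -- The product gives `4 * (c * d) ^ 2 ≤ (c * d) ^ 2`.
        have h3 := mul_le_mul h1 h2 (by linarith) (by positivity)
        nlinarith
      have key : ∀ k : ℤ, 0 < (d ^ 2 - (c + d) ^ 2) * k ^ 2 + (2 * b * d - d * d -
          2 * (a + b) * (c + d) + (c + d) * (c + d)) * k + (hex b d - hex (a + b) (c + d)) →
          qv !![a + k * c, b + k * d; c, d] = 1 := by
        intro k hk
        rw [qv_mk, lead_eq_zero, sub_zero]
        right
        unfold hex at hk ⊢
        linarith
      exact ⟨1, 1, (quad_pos_eventually _ _ h').1.mono key,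
        (quad_pos_eventually _ _ h').2.mono key, by simp [hc, hd]⟩
  · have h1 : 0 < (c + d) ^ 2 - c ^ 2 := by nlinarith [sq_nonneg d]
    have h2 : 0 < (c + d) ^ 2 - d ^ 2 := by nlinarith [sq_nonneg c]
    have key : ∀ k : ℤ, 0 < ((c + d) ^ 2 - c ^ 2) * k ^ 2 + (2 * (a + b) * (c + d) -
        (c + d) * (c + d) - (2 * a * c - c * c)) * k + (hex (a + b) (c + d) - hex a c) →
        0 < ((c + d) ^ 2 - d ^ 2) * k ^ 2 + (2 * (a + b) * (c + d) -
        (c + d) * (c + d) - (2 * b * d - d * d)) * k + (hex (a + b) (c + d) - hex b d) →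
        qv !![a + k * c, b + k * d; c, d] = 0 := by
      intro k hk hk'
      rw [qv_mk, lead_eq_one, sub_self]
      · unfold hex at hk ⊢
        linarith
      · unfold hex at hk' ⊢
        linarith
    refine ⟨0, 0, ?_, ?_, by simp [hc, hd]⟩
    · filter_upwards [(quad_pos_eventually _ _ h1).1, (quad_pos_eventually _ _ h2).1] with k
        using key k
    · filter_upwards [(quad_pos_eventually _ _ h1).2, (quad_pos_eventually _ _ h2).2] with k
        using key k

/-! ### Comparison of the weights with the positions of the fixed points -/

/-- `sv N = sgn α + sgn α'` up to normalization, for the fixed points `α`, `α'` of `N`. -/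
def sv (N : Mat) : ℚ :=
  ((N 0 0 - N 1 1).sign : ℚ) * (((N 1 0).sign : ℚ) - ((N 0 1).sign : ℚ)) / 2

/-- The position of the fixed points of `N` relative to the right half of the upper half-plane. -/
def pv (N : Mat) : ℚ := (1 + sv N) / 2

theorem sv_mk (a b c d : ℤ) :
    sv !![a, b; c, d] = ((a - d).sign : ℚ) * ((c.sign : ℚ) - (b.sign : ℚ)) / 2 := rfl

/-- Here `b * c < 0`, while `a` and `d` have weakly opposite signs, so the summands of `a * b + c *
d` do not cancel and its sign can be read off from those of `a - d` and `c`. -/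
theorem hv_eq_pv {a b c d : ℤ} (hdet : 0 < a * d - b * c) (had : a * d ≤ 0) :
    hv !![a, b; c, d] = pv !![a, b; c, d] := by
  have hbc : b * c < 0 := by linarith
  have key : ((a * b + c * d).sign : ℤ) = -(a - d).sign * c.sign ∧ b.sign = -c.sign := by
    rcases mul_neg_iff.1 hbc with ⟨hb, hc⟩ | ⟨hb, hc⟩
    · rw [Int.sign_eq_one_of_pos hb, Int.sign_eq_neg_one_of_neg hc]
      refine ⟨?_, by norm_num⟩
      rcases lt_trichotomy a d with h | h | h
      · have h1 : a ≤ 0 := by by_contra! h1; nlinarith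
        have h2 : 0 ≤ d := by by_contra! h1; nlinarith
        rw [Int.sign_eq_neg_one_of_neg (by omega : a - d < 0), Int.sign_eq_neg_one_of_neg]
        · norm_num
        · rcases h1.lt_or_eq with h3 | h3
          · nlinarith
          · subst h3; nlinarith
      · subst h
        have : a = 0 := by nlinarith
        subst this
        simp
      · have h1 : 0 ≤ a := by by_contra! h1; nlinarith
        have h2 : d ≤ 0 := by by_contra! h1; nlinarith
        rw [Int.sign_eq_one_of_pos (by omega : 0 < a - d), Int.sign_eq_one_of_pos]
        · norm_num
        · rcases h2.lt_or_eq with h3 | h3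
          · nlinarith
          · subst h3; nlinarith
    · rw [Int.sign_eq_one_of_pos hc, Int.sign_eq_neg_one_of_neg hb]
      refine ⟨?_, by norm_num⟩
      rcases lt_trichotomy a d with h | h | h
      · have h1 : a ≤ 0 := by by_contra! h1; nlinarith
        have h2 : 0 ≤ d := by by_contra! h1; nlinarith
        rw [Int.sign_eq_neg_one_of_neg (by omega : a - d < 0), Int.sign_eq_one_of_pos]
        · norm_num
        · rcases h1.lt_or_eq with h3 | h3
          · nlinarith
          · subst h3; nlinarith
      · subst h
        have : a = 0 := by nlinarith
        subst this
        simp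
      · have h1 : 0 ≤ a := by by_contra! h1; nlinarith
        have h2 : d ≤ 0 := by by_contra! h1; nlinarith
        rw [Int.sign_eq_one_of_pos (by omega : 0 < a - d), Int.sign_eq_neg_one_of_neg]
        · norm_num
        · rcases h2.lt_or_eq with h3 | h3
          · nlinarith
          · subst h3; nlinarith
  have key' : (((a * b + c * d).sign : ℤ) : ℚ) = -(a - d).sign * c.sign := by
    exact_mod_cast key.1
  have key'' : ((b.sign : ℤ) : ℚ) = -c.sign := by exact_mod_cast key.2
  rw [pv, hv_mk, sv_mk, key', key'']
  ring

theorem sq_le_of_mul_pos {a d m : ℤ} (ht : (a + d) ^ 2 = m) (h : 0 < a * d) :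
    |a| + |d| ≤ m := by
  have h1 : (|a| + |d|) ^ 2 = m := by
    have h2 : |a| * |d| = a * d := by rw [← abs_mul, abs_of_pos h]
    nlinarith [sq_abs a, sq_abs d]
  nlinarith [abs_nonneg a, abs_nonneg d]

/-- An exception has `a * d > 0` by `hv_eq_pv`, so the trace bounds `a` and `d`, and the determinant
bounds `b * c`. This bounds `b` and `c` unless exactly one of them vanishes; that case is excluded
here and handled by `kap`. -/
theorem finite_hv_ne_pv (n : ℤ) (hn : 0 < n) (m : ℤ) :
    {N : Mat | N.det = n ∧ N.trace ^ 2 = m ∧ hv N ≠ pv N ∧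
      (N 0 1 ≠ 0 ∧ N 1 0 ≠ 0 ∨ N 0 1 = 0 ∧ N 1 0 = 0)}.Finite := by
  refine finite_of_bounded (m ^ 2 + m + n) fun a b c d ⟨hdet, ht, hne, hbc⟩ => ?_
  rw [Matrix.det_fin_two_of] at hdet
  rw [Matrix.trace_fin_two_of] at ht
  have had : 0 < a * d := by
    by_contra! had
    exact hne (hv_eq_pv (by omega) had)
  have hm := sq_le_of_mul_pos ht had
  have ha := abs_nonneg a
  have hd := abs_nonneg d
  have hm0 : 0 ≤ m := by omega
  have h1 : |b * c| ≤ m ^ 2 + n := by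
    have : |a * d| ≤ m ^ 2 := by rw [abs_mul]; nlinarith
    rw [abs_le] at this ⊢
    constructor <;> linarith
  refine ⟨by nlinarith, ?_, ?_, by nlinarith⟩
  · rcases hbc with ⟨hb, hc⟩ | ⟨hb, hc⟩
    · have hc' : 1 ≤ |c| := Int.one_le_abs hc
      simp only [Matrix.of_apply, Matrix.cons_val', Matrix.cons_val_one, Matrix.cons_val_zero] at *
      rw [abs_mul] at h1
      nlinarith [abs_nonneg b]
    · have hb' : b = 0 := hb
      rw [hb']; simp; positivity
  · rcases hbc with ⟨hb, hc⟩ | ⟨hb, hc⟩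
    · have hb' : 1 ≤ |b| := Int.one_le_abs hb
      rw [abs_mul] at h1
      nlinarith [abs_nonneg c]
    · have hb' : c = 0 := hc
      rw [hb']; simp; positivity

/-- For `y * r > 0` one has `|r - 3 * y| < |r + 3 * y|`. As `|τ| ≤ |w|`, the second summand
dominates, and `r + 3 * y` has the sign of `y`. -/
theorem sign_comparison {X w τ y r : ℤ} (hX : 4 * X = τ * (r - 3 * y) + w * (r + 3 * y))
    (hyr : 0 < y * r) (hw : τ ^ 2 ≤ w ^ 2) : (0 < X ↔ 0 < w * y) ∧ (X < 0 ↔ w * y < 0) := by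
  have hτ := sq_le_sq.1 hw
  rcases lt_trichotomy w 0 with h | h | h
  · rw [abs_of_neg h, abs_le] at hτ
    rcases mul_pos_iff.1 hyr with ⟨hy, hr⟩ | ⟨hy, hr⟩
    · have h1 : X < 0 := by
        rcases le_total (3 * y) r with h2 | h2 <;> nlinarith
      have h2 : w * y < 0 := by nlinarith
      exact ⟨⟨fun h => by omega, fun h => by omega⟩, ⟨fun _ => h2, fun _ => h1⟩⟩
    · have h1 : 0 < X := by
        rcases le_total (3 * y) r with h2 | h2 <;> nlinarith
      have h2 : 0 < w * y := by nlinarith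
      exact ⟨⟨fun _ => h2, fun _ => h1⟩, ⟨fun h => by omega, fun h => by omega⟩⟩
  · subst h
    have : τ = 0 := by simpa using hτ
    subst this
    have : X = 0 := by linarith
    simp [this]
  · rw [abs_of_pos h, abs_le] at hτ
    rcases mul_pos_iff.1 hyr with ⟨hy, hr⟩ | ⟨hy, hr⟩
    · have h1 : 0 < X := by
        rcases le_total (3 * y) r with h2 | h2 <;> nlinarith
      have h2 : 0 < w * y := by nlinarith
      exact ⟨⟨fun _ => h2, fun _ => h1⟩, ⟨fun h => by omega, fun h => by omega⟩⟩
    · have h1 : X < 0 := by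
        rcases le_total (3 * y) r with h2 | h2 <;> nlinarith
      have h2 : w * y < 0 := by nlinarith
      exact ⟨⟨fun h => by omega, fun h => by omega⟩, ⟨fun _ => h2, fun _ => h1⟩⟩

/-- The integers `x, y, z` are the values on a superbase of the quadratic form whose roots are the
fixed points of `!![a, b; c, d]`. -/
structure FixedForm (a b c d n m x y z : ℤ) : Prop where
  det : a * d - b * c = n
  tr : (a + d) ^ 2 = m
  hx : x = c
  hy : y = -b
  hz : z = c + d - a - b

namespace FixedForm

variable {a b c d n m x y z : ℤ}

/-- By the parallelogram law, `y` and `2 * x + 2 * z - y` are the values of the form at the sum and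
the difference of two basis vectors with values `x` and `z`. Their product is `(z - x) ^ 2` minus
the discriminant `m - 4 * n`. -/
theorem disc_y (h : FixedForm a b c d n m x y z) :
    y * (2 * x + 2 * z - y) = (z - x) ^ 2 - m + 4 * n := by
  obtain ⟨rfl, rfl, rfl, rfl, rfl⟩ := h; ring

theorem disc_x (h : FixedForm a b c d n m x y z) :
    x * (2 * y + 2 * z - x) = (z - y) ^ 2 - m + 4 * n := by
  obtain ⟨rfl, rfl, rfl, rfl, rfl⟩ := h; ring

theorem disc_z (h : FixedForm a b c d n m x y z) :
    z * (2 * x + 2 * y - z) = (y - x) ^ 2 - m + 4 * n := by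
  obtain ⟨rfl, rfl, rfl, rfl, rfl⟩ := h; ring

theorem sq_sum (h : FixedForm a b c d n m x y z) : x ^ 2 + y ^ 2 + z ^ 2 =
    (z - x) ^ 2 + (z - y) ^ 2 + (y - x) ^ 2 - m + 4 * n := by
  obtain ⟨rfl, rfl, rfl, rfl, rfl⟩ := h; ring

theorem sv_eq (h : FixedForm a b c d n m x y z) : sv !![a, b; c, d] =
    ((x + y - z).sign : ℚ) * ((x.sign : ℚ) + (y.sign : ℚ)) / 2 := by
  have : x + y - z = a - d := by rw [h.hx, h.hy, h.hz]; ring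
  rw [sv_mk, this, h.hx, h.hy, Int.sign_neg]
  push_cast
  ring

theorem compare_zx (h : FixedForm a b c d n m x y z) (hn : 0 < n) (hw : m ≤ (z - x) ^ 2) :
    (hex a c < hex (a + b) (c + d) ↔ 0 < (z - x) * y) ∧
      (hex (a + b) (c + d) < hex a c ↔ (z - x) * y < 0) := by
  have h1 := h.disc_y
  have := sign_comparison (X := hex (a + b) (c + d) - hex a c) (w := z - x) (τ := a + d) (y := y)
    (r := 2 * x + 2 * z - y)
    (by obtain ⟨rfl, rfl, rfl, rfl, rfl⟩ := h; unfold hex; ring) (by linarith)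
    (by rw [h.tr]; exact hw)
  rwa [sub_pos, sub_neg] at this

theorem compare_zy (h : FixedForm a b c d n m x y z) (hn : 0 < n) (hw : m ≤ (z - y) ^ 2) :
    (hex b d < hex (a + b) (c + d) ↔ 0 < (z - y) * x) ∧
      (hex (a + b) (c + d) < hex b d ↔ (z - y) * x < 0) := by
  have h1 := h.disc_x
  have := sign_comparison (X := hex (a + b) (c + d) - hex b d) (w := z - y) (τ := -(a + d)) (y := x)
    (r := 2 * y + 2 * z - x)
    (by obtain ⟨rfl, rfl, rfl, rfl, rfl⟩ := h; unfold hex; ring) (by linarith)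
    (by rw [neg_sq, h.tr]; exact hw)
  rwa [sub_pos, sub_neg] at this

end FixedForm

theorem lead_congr {x y z x' y' z' : ℤ} (h1 : x < z ↔ x' < z') (h2 : z < x ↔ z' < x')
    (h3 : y < z ↔ y' < z') (h4 : z < y ↔ z' < y') : lead x y z = lead x' y' z' := by
  unfold lead
  simp only [h1, h2, h3, h4]

namespace FixedForm

variable {a b c d n m x y z : ℤ}

theorem same_sign (h : FixedForm a b c d n m x y z) (hn : 0 < n) (h1 : m ≤ (z - x) ^ 2)
    (h2 : m ≤ (z - y) ^ 2) (h3 : m ≤ (y - x) ^ 2) :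
    (0 < x ∧ 0 < y ∧ 0 < z) ∨ (x < 0 ∧ y < 0 ∧ z < 0) := by
  have e1 : 0 < y * (2 * x + 2 * z - y) := by rw [h.disc_y]; linarith
  have e2 : 0 < x * (2 * y + 2 * z - x) := by rw [h.disc_x]; linarith
  have e3 : 0 < z * (2 * x + 2 * y - z) := by rw [h.disc_z]; linarith
  rcases mul_pos_iff.1 e1 with ⟨_, _⟩ | ⟨_, _⟩ <;> rcases mul_pos_iff.1 e2 with ⟨_, _⟩ | ⟨_, _⟩ <;>
    rcases mul_pos_iff.1 e3 with ⟨_, _⟩ | ⟨_, _⟩ <;> omega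

/-- Once the three values have one common sign, `compare_zx` and `compare_zy` say that the `hex`
values are ordered as the absolute values of the fixed form, as far as `lead` can see. -/
theorem lead_eq (h : FixedForm a b c d n m x y z) (hn : 0 < n) (h1 : m ≤ (z - x) ^ 2)
    (h2 : m ≤ (z - y) ^ 2) (h3 : m ≤ (y - x) ^ 2) :
    lead (hex a c) (hex b d) (hex (a + b) (c + d)) = lead |x| |y| |z| := by
  obtain ⟨c1, c2⟩ := h.compare_zx hn h1
  obtain ⟨c3, c4⟩ := h.compare_zy hn h2
  rcases h.same_sign hn h1 h2 h3 with ⟨hx, hy, hz⟩ | ⟨hx, hy, hz⟩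
  · rw [abs_of_pos hx, abs_of_pos hy, abs_of_pos hz]
    apply lead_congr
    · rw [c1, mul_pos_iff_of_pos_right hy, sub_pos]
    · rw [c2, mul_neg_iff]; omega
    · rw [c3, mul_pos_iff_of_pos_right hx, sub_pos]
    · rw [c4, mul_neg_iff]; omega
  · rw [abs_of_neg hx, abs_of_neg hy, abs_of_neg hz]
    apply lead_congr
    · rw [c1, mul_pos_iff]; omega
    · rw [c2, mul_neg_iff]; omega
    · rw [c3, mul_pos_iff]; omega
    · rw [c4, mul_neg_iff]; omega

/-- For nonnegative discriminant, the largest value determines the sign of the fixed points. -/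
theorem lead_eq_of_disc_nonneg (h : FixedForm a b c d n m x y z) (hn : 0 < n) (hm : 4 * n ≤ m)
    (h1 : m ≤ (z - x) ^ 2) (h2 : m ≤ (z - y) ^ 2) (h3 : m ≤ (y - x) ^ 2) :
    1 - lead (hex a c) (hex b d) (hex (a + b) (c + d)) = pv !![a, b; c, d] := by
  rw [h.lead_eq hn h1 h2 h3, pv, h.sv_eq]
  have hd := h.disc_z
  -- Three positive values satisfying the triangle inequalities would have negative discriminant, so
  -- one value exceeds the sum of the other two.
  have key : ∀ x y z : ℤ, 0 < x → 0 < y → 0 < z → z * (2 * x + 2 * y - z) ≤ (y - x) ^ 2 →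
      (z < x + y ∧ (z < x ∨ z < y)) ∨ (x < z ∧ y < z ∧ x + y < z) := by
    intro x y z hx hy hz hxyz
    by_contra hcon
    have h4 : x ≤ z + y ∧ y ≤ z + x ∧ z ≤ x + y := by omega
    rcases le_total x y with h5 | h5
    · nlinarith [mul_nonneg (sub_nonneg.2 h4.2.1) (sub_nonneg.2 h4.2.2)]
    · nlinarith [mul_nonneg (sub_nonneg.2 h4.1) (sub_nonneg.2 h4.2.2)]
  rcases h.same_sign hn h1 h2 h3 with ⟨hx, hy, hz⟩ | ⟨hx, hy, hz⟩
  · rw [abs_of_pos hx, abs_of_pos hy, abs_of_pos hz, Int.sign_eq_one_of_pos hx,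
      Int.sign_eq_one_of_pos hy]
    rcases key x y z hx hy hz (by rw [hd]; linarith) with ⟨h4, h5⟩ | ⟨h4, h5, h6⟩
    · rw [lead_eq_zero h5, Int.sign_eq_one_of_pos (by omega)]; norm_num
    · rw [lead_eq_one h4 h5, Int.sign_eq_neg_one_of_neg (by omega)]; norm_num
  · rw [abs_of_neg hx, abs_of_neg hy, abs_of_neg hz, Int.sign_eq_neg_one_of_neg hx,
      Int.sign_eq_neg_one_of_neg hy]
    rcases key (-x) (-y) (-z) (by omega) (by omega) (by omega) (by linarith) with
      ⟨h4, h5⟩ | ⟨h4, h5, h6⟩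
    · rw [lead_eq_zero h5, Int.sign_eq_neg_one_of_neg (by omega)]; norm_num
    · rw [lead_eq_one h4 h5, Int.sign_eq_one_of_pos (by omega)]; norm_num

end FixedForm

/-- Conjugation by an element of `SL₂(ℤ)`. -/
def cj (g : SL(2, ℤ)) (N : Mat) : Mat := (g : Mat) * N * ((g⁻¹ : SL(2, ℤ)) : Mat)

theorem cj_S_mk (a b c d : ℤ) : cj ModularGroup.S !![a, b; c, d] = !![d, -c; -b, a] := by
  rw [cj, coe_S, coe_S_inv, Matrix.mul_fin_two, Matrix.mul_fin_two]
  ring_nf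

theorem cj_U_mk (a b c d : ℤ) :
    cj U !![a, b; c, d] = !![d - b, a - c + b - d; -b, a + b] := by
  rw [cj, coe_U, coe_U_inv, Matrix.mul_fin_two, Matrix.mul_fin_two]
  ring_nf

theorem cj_T_mk (a b c d : ℤ) :
    cj ModularGroup.T !![a, b; c, d] = !![a + c, b + d - a - c; c, d - c] := by
  rw [cj, coe_T, coe_T_inv, Matrix.mul_fin_two, Matrix.mul_fin_two]
  ring_nf

/-- The correction of `pv` for matrices fixing the cusp `∞`. -/
def kap (N : Mat) : ℚ := if N 1 0 = 0 then hv N - pv N else 0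

theorem kap_mk (a b c d : ℤ) : kap !![a, b; c, d] =
    if c = 0 then hv !![a, b; c, d] - pv !![a, b; c, d] else 0 := rfl

theorem pv_cj_S (N : Mat) : pv (cj ModularGroup.S N) = 1 - pv N := by
  obtain ⟨a, b, c, d, rfl⟩ := exists_entries N
  rw [cj_S_mk, pv, pv, sv_mk, sv_mk, Int.sign_neg, Int.sign_neg, ← neg_sub a d, Int.sign_neg]
  push_cast
  ring

theorem hv_cj_S (N : Mat) : hv (cj ModularGroup.S N) = 1 - hv N := by
  rw [← hv_S_mul N, ← hv_mul_S, cj, show ((ModularGroup.S⁻¹ : SL(2, ℤ)) : Mat) =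
    -((ModularGroup.S : SL(2, ℤ)) : Mat) by rw [coe_S_inv, coe_S, neg_fin_two]; norm_num,
    mul_neg, hv_neg]

/-- If exactly one of `b`, `c` vanishes, the correction cancels `hv - pv` exactly. For `c = 0` this
is the term `kap N`; for `b = 0` it is the other term, since conjugation by `S` changes the sign of
`hv - pv`. -/
theorem finite_hv_correction (n : ℤ) (hn : 0 < n) (m : ℤ) :
    {N : Mat | N.det = n ∧ N.trace ^ 2 = m ∧
      hv N - pv N - (kap N - kap (cj ModularGroup.S N)) ≠ 0}.Finite := by
  refine (finite_hv_ne_pv n hn m).subset fun N ⟨hdet, ht, hne⟩ => ⟨hdet, ht, ?_⟩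
  have h1 := hv_cj_S N
  have h2 := pv_cj_S N
  obtain ⟨a, b, c, d, rfl⟩ := exists_entries N
  rw [cj_S_mk] at h1 h2 hne
  rw [kap_mk, kap_mk, h1, h2] at hne
  refine ⟨fun h => hne (by rw [h]; simp), ?_⟩
  change b ≠ 0 ∧ c ≠ 0 ∨ b = 0 ∧ c = 0
  by_cases hb : b = 0 <;> by_cases hc : c = 0
  · exact Or.inr ⟨hb, hc⟩
  · rw [if_neg hc, if_pos (by rw [hb, neg_zero])] at hne
    exact absurd (by ring) hne
  · rw [if_pos hc, if_neg (by omega)] at hne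
    exact absurd (by ring) hne
  · exact Or.inl ⟨hb, hc⟩

/-- Large values of a form of given discriminant on a superbase, two of which are close. -/
theorem degenerate_of_close {x y z n m : ℤ} (hn : 0 < n)
    (hy : y * (2 * x + 2 * z - y) = (z - x) ^ 2 - m + 4 * n)
    (hK : 3 * (4 * m + 4 * n) ^ 2 < x ^ 2 + y ^ 2 + z ^ 2) (hw : (z - x) ^ 2 < m) :
    (y = 0 ∨ y = 2 * (x + z)) ∧ (z - x) ^ 2 = m - 4 * n ∧ m ≤ (z - y) ^ 2 ∧ m ≤ (y - x) ^ 2 := by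
  have hm : 0 < m := lt_of_le_of_lt (sq_nonneg _) hw
  have hzx : |z - x| ≤ m := abs_le_of_sq_le hw.le
  -- The product is bounded in terms of `m` and `n`. If it were nonzero, both factors would be
  -- bounded, hence also `x`, `y`, `z`, against `hK`.
  have h0 : y * (2 * x + 2 * z - y) = 0 := by
    by_contra hP
    have hy0 : y ≠ 0 := left_ne_zero_of_mul hP
    have hr0 : 2 * x + 2 * z - y ≠ 0 := right_ne_zero_of_mul hP
    have hP' : |y * (2 * x + 2 * z - y)| ≤ m + 4 * n := by
      rw [hy, abs_le]; constructor <;> nlinarith [sq_nonneg (z - x)]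
    rw [abs_mul] at hP'
    have h1 : 1 ≤ |y| := Int.one_le_abs hy0
    have h2 : 1 ≤ |2 * x + 2 * z - y| := Int.one_le_abs hr0
    have h3 : |y| ≤ m + 4 * n := by nlinarith
    have h4 : |2 * x + 2 * z - y| ≤ m + 4 * n := by nlinarith
    rw [abs_le] at h3 h4 hzx
    have b1 : x ^ 2 ≤ (4 * m + 4 * n) ^ 2 := sq_le_sq' (by linarith) (by linarith)
    have b2 : y ^ 2 ≤ (4 * m + 4 * n) ^ 2 := sq_le_sq' (by linarith) (by linarith)
    have b3 : z ^ 2 ≤ (4 * m + 4 * n) ^ 2 := sq_le_sq' (by linarith) (by linarith)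
    linarith
  have hbig : 5 * m + 4 * n ≤ 3 * (4 * m + 4 * n) ^ 2 := by nlinarith
  refine ⟨?_, by linarith, ?_, ?_⟩
  · rcases mul_eq_zero.1 h0 with h | h
    · exact Or.inl h
    · exact Or.inr (by linarith)
  · by_contra! h
    nlinarith [sq_nonneg ((z - x) + (z - y))]
  · by_contra! h
    nlinarith [sq_nonneg ((z - x) - (y - x))]

namespace FixedForm

variable {a b c d n m x y z : ℤ}

theorem entries_le (h : FixedForm a b c d n m x y z) {K : ℤ} (hK : x ^ 2 + y ^ 2 + z ^ 2 ≤ K) :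
    |a| ≤ 3 * K + m ∧ |b| ≤ 3 * K + m ∧ |c| ≤ 3 * K + m ∧ |d| ≤ 3 * K + m := by
  have h1 : |x| ≤ K := abs_le_of_sq_le (by nlinarith [sq_nonneg y, sq_nonneg z])
  have h2 : |y| ≤ K := abs_le_of_sq_le (by nlinarith [sq_nonneg x, sq_nonneg z])
  have h3 : |z| ≤ K := abs_le_of_sq_le (by nlinarith [sq_nonneg y, sq_nonneg x])
  have h4 : |a + d| ≤ m := abs_le_of_sq_le h.tr.le
  have hx := h.hx
  have hy := h.hy
  have hz := h.hz
  have hm := abs_nonneg (a + d)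
  rw [abs_le] at h1 h2 h3 h4
  refine ⟨abs_le.2 ⟨?_, ?_⟩, abs_le.2 ⟨?_, ?_⟩, abs_le.2 ⟨?_, ?_⟩, abs_le.2 ⟨?_, ?_⟩⟩ <;> omega

/-- Two close values of a large form would make the discriminant a square, which is impossible when
it is negative. -/
theorem lead_eq_abs (h : FixedForm a b c d n m x y z) (hn : 0 < n) (hm : m < 4 * n)
    (hK : 3 * (4 * m + 4 * n) ^ 2 < x ^ 2 + y ^ 2 + z ^ 2) :
    lead (hex a c) (hex b d) (hex (a + b) (c + d)) = lead |x| |y| |z| := by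
  apply h.lead_eq hn
  · by_contra! h1
    have := (degenerate_of_close hn h.disc_y hK h1).2.1
    nlinarith [sq_nonneg (z - x)]
  · by_contra! h1
    have := (degenerate_of_close (x := y) (y := x) (z := z) hn h.disc_x
      (by linarith) h1).2.1
    nlinarith [sq_nonneg (z - y)]
  · by_contra! h1
    have := (degenerate_of_close (x := x) (y := z) (z := y) hn (by linarith [h.disc_z])
      (by linarith) h1).2.1
    nlinarith [sq_nonneg (y - x)]

end FixedForm

theorem sign_add_of_abs_lt {x e : ℤ} (h : |e| < |x|) : (x + e).sign = x.sign := by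
  rcases lt_trichotomy x 0 with hx | hx | hx
  · rw [abs_of_neg hx, abs_lt] at h
    rw [Int.sign_eq_neg_one_of_neg hx, Int.sign_eq_neg_one_of_neg (by omega)]
  · subst hx; rw [abs_zero] at h; exact absurd h (not_lt.2 (abs_nonneg e))
  · rw [abs_of_pos hx, abs_lt] at h
    rw [Int.sign_eq_one_of_pos hx, Int.sign_eq_one_of_pos (by omega)]

theorem sign_cases {x : ℤ} (hx : x ≠ 0) : (0 < x ∧ x.sign = 1) ∨ (x < 0 ∧ x.sign = -1) := by
  rcases lt_or_gt_of_ne hx with h | h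
  · exact Or.inr ⟨h, Int.sign_eq_neg_one_of_neg h⟩
  · exact Or.inl ⟨h, Int.sign_eq_one_of_pos h⟩

/-- Matrices fixing `0`, far from the diagonal. -/
theorem qv_lower {a c d : ℤ} (had : 0 < a * d) (hc : 3 * (|a| + |d|) < |c|) :
    qv !![a, 0; c, d] = pv !![a, 0; c, d] -
      (hv (cj U !![a, 0; c, d]) - pv (cj U !![a, 0; c, d])) := by
  have ha : a ≠ 0 := by rintro rfl; simp at had
  have hd : d ≠ 0 := by rintro rfl; simp at had
  have hc0 : c ≠ 0 := by
    rintro rfl; rw [abs_zero] at hc; linarith [abs_nonneg a, abs_nonneg d]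
  have e : (a - c + 0 - d).sign = -c.sign := by
    rw [← Int.sign_neg, ← sign_add_of_abs_lt (x := -c) (e := a - d)]
    · congr 1; ring
    · rw [abs_neg]; have := abs_sub a d; linarith [abs_nonneg a, abs_nonneg d]
  rw [cj_U_mk, qv_mk, hv_mk, pv, pv, sv_mk, sv_mk]
  have e2 : ((d - 0) * (a - c + 0 - d) + -0 * (a + 0)).sign = d.sign * -c.sign := by
    rw [← e, ← Int.sign_mul]; congr 1; ring
  have e3 : (d - 0 - (a + 0)).sign = -(a - d).sign := by rw [← Int.sign_neg]; congr 1; ring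
  rw [e2, e, e3]
  have hlead : lead (hex a c) (hex 0 d) (hex (a + 0) (c + d)) = (1 + (d.sign * c.sign : ℤ)) / 2 := by
    have hD : 3 * |d| < |c| := by linarith [abs_nonneg a]
    have hA : 3 * |a| < |c| := by linarith [abs_nonneg d]
    rcases sign_cases hd with ⟨hd, sd⟩ | ⟨hd, sd⟩ <;> rcases sign_cases hc0 with ⟨hc, sc⟩ | ⟨hc, sc⟩ <;>
      rw [sd, sc]
    · rw [abs_of_pos hd, abs_of_pos hc] at hD
      have ha : 0 < a := by by_contra!; nlinarith
      rw [abs_of_pos ha, abs_of_pos hc] at hA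
      rw [lead_eq_one]
      · norm_num
      · unfold hex; nlinarith
      · unfold hex; nlinarith
    · rw [lead_eq_zero]
      · norm_num
      · left
        rw [abs_of_pos hd, abs_of_neg hc] at hD
        have ha : 0 < a := by by_contra!; nlinarith
        unfold hex; nlinarith
    · rw [lead_eq_zero]
      · norm_num
      · left
        rw [abs_of_neg hd, abs_of_pos hc] at hD
        have ha : a < 0 := by by_contra!; nlinarith
        unfold hex; nlinarith
    · rw [abs_of_neg hd, abs_of_neg hc] at hD
      have ha : a < 0 := by by_contra!; nlinarith
      rw [abs_of_neg ha, abs_of_neg hc] at hA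
      rw [lead_eq_one]
      · norm_num
      · unfold hex; nlinarith
      · unfold hex; nlinarith
  rw [hlead]
  simp
  ring

/-- Matrices fixing `∞`, far from the diagonal. -/
theorem qv_upper {a b d : ℤ} (had : 0 < a * d) (hb : 3 * (|a| + |d|) < |b|) :
    qv !![a, b; 0, d] = hv !![a, b; 0, d] := by
  have ha : a ≠ 0 := by rintro rfl; simp at had
  have hb0 : b ≠ 0 := by
    rintro rfl; rw [abs_zero] at hb; linarith [abs_nonneg a, abs_nonneg d]
  rw [qv_mk, hv_mk, zero_mul, add_zero, Int.sign_mul]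
  have hD : 3 * |d| < |b| := by linarith [abs_nonneg a]
  have hA : 3 * |a| < |b| := by linarith [abs_nonneg d]
  have hlead : lead (hex a 0) (hex b d) (hex (a + b) (0 + d)) = (1 + (a.sign * b.sign : ℤ)) / 2 := by
    rcases sign_cases ha with ⟨ha, sa⟩ | ⟨ha, sa⟩ <;> rcases sign_cases hb0 with ⟨hb, sb⟩ | ⟨hb, sb⟩ <;>
      rw [sa, sb]
    · rw [abs_of_pos ha, abs_of_pos hb] at hA
      have hd : 0 < d := by by_contra!; nlinarith
      rw [abs_of_pos hd, abs_of_pos hb] at hD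
      rw [lead_eq_one]
      · norm_num
      · unfold hex; nlinarith
      · unfold hex; nlinarith
    · rw [lead_eq_zero]
      · norm_num
      · right
        rw [abs_of_pos ha, abs_of_neg hb] at hA
        have hd : 0 < d := by by_contra!; nlinarith
        unfold hex; nlinarith
    · rw [lead_eq_zero]
      · norm_num
      · right
        rw [abs_of_neg ha, abs_of_pos hb] at hA
        have hd : d < 0 := by by_contra!; nlinarith
        unfold hex; nlinarith
    · rw [abs_of_neg ha, abs_of_neg hb] at hA
      have hd : d < 0 := by by_contra!; nlinarith
      rw [abs_of_neg hd, abs_of_neg hb] at hD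
      rw [lead_eq_one]
      · norm_num
      · unfold hex; nlinarith
      · unfold hex; nlinarith
  rw [hlead]
  push_cast
  ring

theorem abs_gt_of_close {x z m n : ℤ} (hn : 0 < n) (hK : 3 * (4 * m + 4 * n) ^ 2 < x ^ 2 + z ^ 2)
    (hw : (z - x) ^ 2 < m) : 3 * m < |x| := by
  have hm : 0 < m := lt_of_le_of_lt (sq_nonneg _) hw
  by_contra! hx
  have hzx : |z - x| ≤ m := abs_le_of_sq_le hw.le
  rw [abs_le] at hx hzx
  have b1 : x ^ 2 ≤ (4 * m + 4 * n) ^ 2 := sq_le_sq' (by linarith) (by linarith)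
  have b3 : z ^ 2 ≤ (4 * m + 4 * n) ^ 2 := sq_le_sq' (by linarith) (by linarith)
  nlinarith

theorem same_sign_of_mul_add {x z : ℤ} (h1 : 0 < x * (x + 2 * z)) (h2 : 0 < z * (z + 2 * x)) :
    (0 < x ∧ 0 < z) ∨ (x < 0 ∧ z < 0) := by
  rcases mul_pos_iff.1 h1 with ⟨_, _⟩ | ⟨_, _⟩ <;> rcases mul_pos_iff.1 h2 with
    ⟨_, _⟩ | ⟨_, _⟩ <;> omega

theorem same_sign_of_mul_sub {x y : ℤ} (h1 : 0 < x * (2 * y - x)) (h2 : 0 < y * (2 * x - y)) :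
    (0 < x ∧ 0 < y) ∨ (x < 0 ∧ y < 0) := by
  rcases mul_pos_iff.1 h1 with ⟨_, _⟩ | ⟨_, _⟩ <;> rcases mul_pos_iff.1 h2 with
    ⟨_, _⟩ | ⟨_, _⟩ <;> omega

namespace FixedForm

variable {a b c d n m x y z : ℤ}

theorem pv_eq_one (h : FixedForm a b c d n m x y z)
    (hs : (0 < x ∧ 0 < y ∧ z < x + y) ∨ (x < 0 ∧ y < 0 ∧ x + y < z)) :
    pv !![a, b; c, d] = 1 := by
  rw [pv, h.sv_eq]
  rcases hs with ⟨hx, hy, hz⟩ | ⟨hx, hy, hz⟩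
  · rw [Int.sign_eq_one_of_pos hx, Int.sign_eq_one_of_pos hy, Int.sign_eq_one_of_pos (by omega)]
    norm_num
  · rw [Int.sign_eq_neg_one_of_neg hx, Int.sign_eq_neg_one_of_neg hy,
      Int.sign_eq_neg_one_of_neg (by omega)]
    norm_num

theorem pv_eq_zero (h : FixedForm a b c d n m x y z)
    (hs : (0 < x ∧ 0 < y ∧ x + y < z) ∨ (x < 0 ∧ y < 0 ∧ z < x + y)) :
    pv !![a, b; c, d] = 0 := by
  rw [pv, h.sv_eq]
  rcases hs with ⟨hx, hy, hz⟩ | ⟨hx, hy, hz⟩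
  · rw [Int.sign_eq_one_of_pos hx, Int.sign_eq_one_of_pos hy,
      Int.sign_eq_neg_one_of_neg (by omega)]
    norm_num
  · rw [Int.sign_eq_neg_one_of_neg hx, Int.sign_eq_neg_one_of_neg hy,
      Int.sign_eq_one_of_pos (by omega)]
    norm_num

theorem kap_eq_zero (h : FixedForm a b c d n m x y z) (hx : x ≠ 0) (hy : y ≠ 0) :
    kap !![a, b; c, d] - kap (cj U !![a, b; c, d]) = 0 := by
  rw [cj_U_mk, kap_mk, kap_mk, if_neg (by rw [← h.hx]; exact hx),
    if_neg (by rw [← h.hy]; exact hy), sub_zero]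

/-- Close values force a rational fixed point. If `y = 0`, the matrix fixes `0` and the defect is
the `kap` term of its `U`-conjugate, by `qv_lower`. If `y = 2 * (x + z)`, no correction occurs and
both tests give 1. The other two close pairs are analogous, with `qv_upper` covering matrices that
fix `∞`. -/
theorem qv_eq_of_zx (h : FixedForm a b c d n m x y z) (hn : 0 < n)
    (hK : 3 * (4 * m + 4 * n) ^ 2 < x ^ 2 + y ^ 2 + z ^ 2) (h1 : (z - x) ^ 2 < m) :
    qv !![a, b; c, d] = pv !![a, b; c, d] +
      (kap !![a, b; c, d] - kap (cj U !![a, b; c, d])) := by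
  have dx := h.disc_x
  have dz := h.disc_z
  obtain ⟨hy, e1, e2, e3⟩ := degenerate_of_close hn h.disc_y hK h1
  have hx : x ≠ 0 := by rintro rfl; linarith
  rcases hy with hy | hy
  · have hb : b = 0 := by have := h.hy; omega
    have had : a * d = n := by have := h.det; rw [hb] at this; linarith
    have hxK : 3 * m < |x| := abs_gt_of_close hn (by rw [hy] at hK; linarith) h1
    have ham := sq_le_of_mul_pos h.tr (by rw [had]; exact hn)
    subst hb
    rw [qv_lower (by rw [had]; exact hn) (by rw [← h.hx]; linarith), kap_mk,
      if_neg (by rw [← h.hx]; exact hx), cj_U_mk, kap_mk, if_pos neg_zero]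
    ring
  · have p1 : 0 < x * (2 * y + 2 * z - x) := by linarith
    have p2 : 0 < z * (2 * x + 2 * y - z) := by linarith
    have hzx := same_sign_of_mul_add (x := x) (z := z)
      (by rw [hy] at p1; linarith) (by rw [hy] at p2; linarith)
    have hD : hex (a + b) (c + d) < hex b d := (h.compare_zy hn e2).2.2 (by
      rw [mul_neg_iff]; omega)
    rw [h.kap_eq_zero hx (by omega), add_zero, qv_mk, lead_eq_zero (Or.inr hD), sub_zero,
      h.pv_eq_one (by omega)]

theorem qv_eq_of_zy (h : FixedForm a b c d n m x y z) (hn : 0 < n)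
    (hK : 3 * (4 * m + 4 * n) ^ 2 < x ^ 2 + y ^ 2 + z ^ 2) (h2 : (z - y) ^ 2 < m) :
    qv !![a, b; c, d] = pv !![a, b; c, d] +
      (kap !![a, b; c, d] - kap (cj U !![a, b; c, d])) := by
  have dy := h.disc_y
  have dz := h.disc_z
  have hs := h.sq_sum
  obtain ⟨hx, e1, e2, e3⟩ := degenerate_of_close (x := y) (y := x) (z := z) hn h.disc_x
    (by linarith) h2
  have hy : y ≠ 0 := by rintro rfl; linarith
  rcases hx with hx | hx
  · have hc : c = 0 := by rw [← h.hx, hx]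
    have had : a * d = n := by have := h.det; rw [hc] at this; linarith
    have hyK : 3 * m < |y| := abs_gt_of_close hn (by rw [hx] at hK; linarith) h2
    have ham := sq_le_of_mul_pos h.tr (by rw [had]; exact hn)
    subst hc
    have hb : |y| = |b| := by rw [h.hy, abs_neg]
    rw [qv_upper (by rw [had]; exact hn) (by rw [← hb]; linarith), kap_mk,
      if_pos rfl, cj_U_mk, kap_mk, if_neg (by rw [← h.hy]; exact hy)]
    ring
  · have p1 : 0 < y * (2 * x + 2 * z - y) := by linarith
    have p2 : 0 < z * (2 * x + 2 * y - z) := by linarith [sub_sq_comm x y]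
    have hzy := same_sign_of_mul_add (x := y) (z := z)
      (by rw [hx] at p1; linarith) (by rw [hx] at p2; linarith)
    have hD : hex (a + b) (c + d) < hex a c := (h.compare_zx hn e2).2.2 (by
      rw [mul_neg_iff]; omega)
    rw [h.kap_eq_zero (by omega) hy, add_zero, qv_mk, lead_eq_zero (Or.inl hD), sub_zero,
      h.pv_eq_one (by omega)]

theorem qv_eq_of_yx (h : FixedForm a b c d n m x y z) (hn : 0 < n)
    (hK : 3 * (4 * m + 4 * n) ^ 2 < x ^ 2 + y ^ 2 + z ^ 2) (h3 : (y - x) ^ 2 < m) :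
    qv !![a, b; c, d] = pv !![a, b; c, d] +
      (kap !![a, b; c, d] - kap (cj U !![a, b; c, d])) := by
  have dx := h.disc_x
  have dy := h.disc_y
  have dz := h.disc_z
  have hs := h.sq_sum
  obtain ⟨hz, e1, e2, e3⟩ := degenerate_of_close (x := x) (y := z) (z := y) hn (by linarith)
    (by linarith) h3
  have f1 : m ≤ (z - x) ^ 2 := e3
  have f2 : m ≤ (z - y) ^ 2 := by rw [sub_sq_comm]; exact e2
  have p1 : 0 < x * (2 * y + 2 * z - x) := by linarith
  have p2 : 0 < y * (2 * x + 2 * z - y) := by linarith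
  have hxy : (0 < x ∧ 0 < y) ∨ (x < 0 ∧ y < 0) := by
    rcases hz with hz | hz <;> rw [hz] at p1 p2
    · exact same_sign_of_mul_sub (by linarith) (by linarith)
    · exact same_sign_of_mul_add (by linarith) (by linarith)
  rw [h.kap_eq_zero (by omega) (by omega), add_zero, qv_mk]
  rcases hz with hz | hz
  · rw [lead_eq_zero (Or.inl ((h.compare_zx hn f1).2.2 (by rw [mul_neg_iff]; omega))),
      h.pv_eq_one (by omega), sub_zero]
  · rw [lead_eq_one ((h.compare_zx hn f1).1.2 (by rw [mul_pos_iff]; omega))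
      ((h.compare_zy hn f2).1.2 (by rw [mul_pos_iff]; omega)), h.pv_eq_zero (by omega), sub_self]

theorem qv_eq (h : FixedForm a b c d n m x y z) (hn : 0 < n) (hm : 4 * n ≤ m)
    (hK : 3 * (4 * m + 4 * n) ^ 2 < x ^ 2 + y ^ 2 + z ^ 2) :
    qv !![a, b; c, d] = pv !![a, b; c, d] +
      (kap !![a, b; c, d] - kap (cj U !![a, b; c, d])) := by
  by_cases h1 : (z - x) ^ 2 < m
  · exact h.qv_eq_of_zx hn hK h1
  by_cases h2 : (z - y) ^ 2 < m
  · exact h.qv_eq_of_zy hn hK h2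
  by_cases h3 : (y - x) ^ 2 < m
  · exact h.qv_eq_of_yx hn hK h3
  push Not at h1 h2 h3
  have hx : x ≠ 0 := by rintro rfl; linarith [h.disc_x]
  have hy : y ≠ 0 := by rintro rfl; linarith [h.disc_y]
  rw [h.kap_eq_zero hx hy, add_zero, qv_mk]
  exact h.lead_eq_of_disc_nonneg hn hm h1 h2 h3

end FixedForm

theorem fixedForm_of {a b c d n m : ℤ} (h1 : Matrix.det !![a, b; c, d] = n)
    (h2 : Matrix.trace !![a, b; c, d] ^ 2 = m) :
    FixedForm a b c d n m c (-b) (c + d - a - b) := by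
  rw [Matrix.det_fin_two_of] at h1
  rw [Matrix.trace_fin_two_of] at h2
  exact ⟨h1, h2, rfl, rfl, rfl⟩

theorem finite_qv_correction (n : ℤ) (hn : 0 < n) (m : ℤ) (hm : 4 * n ≤ m) :
    {N : Mat | N.det = n ∧ N.trace ^ 2 = m ∧
      qv N - pv N - (kap N - kap (cj U N)) ≠ 0}.Finite := by
  refine finite_of_bounded (3 * (3 * (4 * m + 4 * n) ^ 2) + m) fun a b c d ⟨hdet, ht, hne⟩ => ?_
  have h := fixedForm_of hdet ht
  apply h.entries_le
  by_contra! hK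
  apply hne
  rw [h.qv_eq hn hm hK]
  ring

/-- The weight of an elliptic matrix in terms of its fixed point. -/
def chi (N : Mat) : ℚ :=
  lead |N 1 0| |N 0 1| |N 1 0 + N 1 1 - N 0 0 - N 0 1| - (1 - sv N) / 2

theorem chi_mk (a b c d : ℤ) :
    chi !![a, b; c, d] = lead |c| |b| |c + d - a - b| - (1 - sv !![a, b; c, d]) / 2 := rfl

theorem finite_qv_elliptic (n : ℤ) (hn : 0 < n) (m : ℤ) (hm : m < 4 * n) :
    {N : Mat | N.det = n ∧ N.trace ^ 2 = m ∧ qv N ≠ pv N - chi N}.Finite := by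
  refine finite_of_bounded (3 * (3 * (4 * m + 4 * n) ^ 2) + m) fun a b c d ⟨hdet, ht, hne⟩ => ?_
  have h := fixedForm_of hdet ht
  apply h.entries_le
  by_contra! hK
  apply hne
  rw [qv_mk, h.lead_eq_abs hn hm hK, chi_mk, pv, abs_neg]
  ring

theorem finite_hv_elliptic (n : ℤ) (hn : 0 < n) (m : ℤ) (hm : m < 4 * n) :
    {N : Mat | N.det = n ∧ N.trace ^ 2 = m ∧ hv N ≠ pv N}.Finite := by
  refine (finite_hv_ne_pv n hn m).subset fun N ⟨hdet, ht, hne⟩ => ⟨hdet, ht, hne, Or.inl ?_⟩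
  obtain ⟨a, b, c, d, rfl⟩ := exists_entries N
  rw [Matrix.det_fin_two_of] at hdet
  rw [Matrix.trace_fin_two_of] at ht
  have hbc : b * c ≠ 0 := by
    intro h0
    nlinarith [sq_nonneg (a - d)]
  exact ⟨left_ne_zero_of_mul hbc, right_ne_zero_of_mul hbc⟩

/-- For nonnegative discriminant, the fixed points contribute to two of three sides. -/
theorem sign_form_sum {x y z : ℤ} (h0 : x ≠ 0 ∨ y ≠ 0 ∨ z ≠ 0)
    (hd : z * (2 * x + 2 * y - z) ≤ (y - x) ^ 2) :
    (x + y - z).sign * (x.sign + y.sign) + (y + z - x).sign * (y.sign + z.sign) +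
      (z + x - y).sign * (z.sign + x.sign) = 2 := by
  have hpos : 0 < x → 0 < y → 0 < z → x + y < z ∨ y + z < x ∨ z + x < y := by
    intro hx hy hz
    by_contra! h4
    rcases le_total x y with h5 | h5
    · nlinarith [mul_nonneg (sub_nonneg.2 h4.2.2) (sub_nonneg.2 h4.1)]
    · nlinarith [mul_nonneg (sub_nonneg.2 h4.2.1) (sub_nonneg.2 h4.1)]
  have hneg : x < 0 → y < 0 → z < 0 → z < x + y ∨ x < y + z ∨ y < z + x := by
    intro hx hy hz
    by_contra! h4
    rcases le_total x y with h5 | h5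
    · nlinarith [mul_nonneg (sub_nonneg.2 h4.2.1) (sub_nonneg.2 h4.1)]
    · nlinarith [mul_nonneg (sub_nonneg.2 h4.2.2) (sub_nonneg.2 h4.1)]
  rcases Int.sign_trichotomy x with sx | sx | sx <;>
  rcases Int.sign_trichotomy y with sy | sy | sy <;>
  rcases Int.sign_trichotomy z with sz | sz | sz <;>
  rcases Int.sign_trichotomy (x + y - z) with s1 | s1 | s1 <;>
  rcases Int.sign_trichotomy (y + z - x) with s2 | s2 | s2 <;>
  rcases Int.sign_trichotomy (z + x - y) with s3 | s3 | s3 <;>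
  rw [sx, sy, sz, s1, s2, s3] <;>
  simp only [Int.sign_eq_one_iff_pos, Int.sign_eq_zero_iff_zero,
    Int.sign_eq_neg_one_iff_neg] at sx sy sz s1 s2 s3 <;>
  omega

/-! ### Sums over conjugacy classes -/

theorem cj_mul (g h : SL(2, ℤ)) (N : Mat) : cj (g * h) N = cj g (cj h N) := by
  simp only [cj, mul_inv_rev, Matrix.SpecialLinearGroup.coe_mul, mul_assoc]

theorem cj_one (N : Mat) : cj 1 N = N := by
  simp [cj]

theorem cj_neg (g : SL(2, ℤ)) (N : Mat) : cj g (-N) = -cj g N := by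
  simp [cj]

theorem cj_inv_cj (g : SL(2, ℤ)) (N : Mat) : cj g⁻¹ (cj g N) = N := by
  rw [← cj_mul, inv_mul_cancel, cj_one]

theorem cj_cj_inv (g : SL(2, ℤ)) (N : Mat) : cj g (cj g⁻¹ N) = N := by
  rw [← cj_mul, mul_inv_cancel, cj_one]

theorem det_cj (g : SL(2, ℤ)) (N : Mat) : (cj g N).det = N.det := by
  rw [cj, Matrix.det_mul, Matrix.det_mul, g.det_coe, g⁻¹.det_coe, one_mul, mul_one]

theorem coe_inv_mul (g : SL(2, ℤ)) : ((g⁻¹ : SL(2, ℤ)) : Mat) * (g : Mat) = 1 := by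
  rw [← Matrix.SpecialLinearGroup.coe_mul, inv_mul_cancel, Matrix.SpecialLinearGroup.coe_one]

theorem coe_mul_inv (g : SL(2, ℤ)) : (g : Mat) * ((g⁻¹ : SL(2, ℤ)) : Mat) = 1 := by
  rw [← Matrix.SpecialLinearGroup.coe_mul, mul_inv_cancel, Matrix.SpecialLinearGroup.coe_one]

theorem trace_cj (g : SL(2, ℤ)) (N : Mat) : (cj g N).trace = N.trace := by
  rw [cj, Matrix.trace_mul_comm, ← mul_assoc, coe_inv_mul, one_mul]

theorem bar_eq_iff {A B : Mat} : bar A = bar B ↔ A = B ∨ A = -B :=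
  (Con.eq signCon).trans Iff.rfl

theorem bar_mul (A B : Mat) : bar (A * B) = bar A * bar B := rfl

theorem conjClass_eq_iff {N M : Mat} :
    conjClass N = conjClass M ↔ ∃ g, N = cj g M ∨ N = -cj g M := by
  constructor
  · intro h
    obtain ⟨g, hg⟩ := Quotient.exact h.symm
    exact ⟨g, bar_eq_iff.1 hg.symm⟩
  · rintro ⟨g, hg⟩
    exact (Quotient.sound ⟨g, (bar_eq_iff.2 hg).symm⟩ : conjClass M = conjClass N).symm

theorem conjClass_cj (g : SL(2, ℤ)) (N : Mat) : conjClass (cj g N) = conjClass N :=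
  conjClass_eq_iff.2 ⟨g, Or.inl rfl⟩

theorem conjClass_neg (N : Mat) : conjClass (-N) = conjClass N :=
  conjClass_eq_iff.2 ⟨1, Or.inr (by rw [cj_one])⟩

/-- The matrices whose class modulo `±1` is conjugate to that of `M`. -/
def classSet (M : Mat) : Set Mat := {N | conjClass N = conjClass M}

theorem mem_classSet_self (M : Mat) : M ∈ classSet M := rfl

theorem cj_mem_classSet {M N : Mat} (g : SL(2, ℤ)) (h : N ∈ classSet M) : cj g N ∈ classSet M :=
  (conjClass_cj g N).trans h

theorem neg_mem_classSet {M N : Mat} (h : N ∈ classSet M) : -N ∈ classSet M :=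
  (conjClass_neg N).trans h

theorem det_of_mem_classSet {M N : Mat} (h : N ∈ classSet M) : N.det = M.det := by
  obtain ⟨g, rfl | rfl⟩ := conjClass_eq_iff.1 h
  · exact det_cj g M
  · rw [Matrix.det_neg, det_cj]; simp

theorem trace_of_mem_classSet {M N : Mat} (h : N ∈ classSet M) : N.trace ^ 2 = M.trace ^ 2 := by
  obtain ⟨g, rfl | rfl⟩ := conjClass_eq_iff.1 h
  · rw [trace_cj]
  · rw [Matrix.trace_neg, neg_sq, trace_cj]

theorem bijOn_cj (g : SL(2, ℤ)) (M : Mat) : Set.BijOn (cj g) (classSet M) (classSet M) :=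
  ⟨fun _ h => cj_mem_classSet g h,
    fun A _ B _ h => by rw [← cj_inv_cj g A, ← cj_inv_cj g B, h],
    fun N h => ⟨cj g⁻¹ N, cj_mem_classSet _ h, cj_cj_inv g N⟩⟩

theorem sum_classSet_cj (g : SL(2, ℤ)) (M : Mat) (f : Mat → ℚ) :
    ∑ᶠ N ∈ classSet M, f (cj g N) = ∑ᶠ N ∈ classSet M, f N :=
  finsum_mem_eq_of_bijOn (cj g) (bijOn_cj g M) fun _ _ => rfl

theorem finite_support_cj {M : Mat} {f : Mat → ℚ} (g : SL(2, ℤ))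
    (hf : (classSet M ∩ Function.support f).Finite) :
    (classSet M ∩ Function.support fun N => f (cj g N)).Finite := by
  refine (hf.image (cj g⁻¹)).subset fun N ⟨h1, h2⟩ => ⟨cj g N, ⟨cj_mem_classSet g h1, h2⟩, ?_⟩
  exact cj_inv_cj g N

/-- The sum equals its own negative. No finiteness is needed, because `finsum` commutes with
negation even when its value is the default 0. In the version for `U` below, finiteness is needed to
split a sum of three terms. -/
theorem sum_eq_zero_of_S {M : Mat} {f : Mat → ℚ}
    (h : ∀ N ∈ classSet M, f (cj ModularGroup.S N) = -f N) : ∑ᶠ N ∈ classSet M, f N = 0 := by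
  have h1 := sum_classSet_cj ModularGroup.S M f
  rw [finsum_mem_congr rfl h] at h1
  have h2 : ∑ᶠ N ∈ classSet M, -f N = -∑ᶠ N ∈ classSet M, f N := by
    rw [← finsum_neg_distrib]
    refine finsum_congr fun N => ?_
    rw [← finsum_neg_distrib]
  linarith

theorem sum_eq_zero_of_U {M : Mat} {f : Mat → ℚ}
    (hf : (classSet M ∩ Function.support f).Finite)
    (h : ∀ N ∈ classSet M, f N + f (cj U N) + f (cj U (cj U N)) = 0) :
    ∑ᶠ N ∈ classSet M, f N = 0 := by
  have h1 := sum_classSet_cj U M f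
  have h2 := sum_classSet_cj U M fun N => f (cj U N)
  have f1 := finite_support_cj U hf
  have f2 := finite_support_cj U f1
  have h3 : ∑ᶠ N ∈ classSet M, (f N + f (cj U N) + f (cj U (cj U N))) = 0 := by
    rw [finsum_mem_congr rfl h]
    simp
  rw [finsum_mem_add_distrib' ((hf.union f1).subset _) f2, finsum_mem_add_distrib' hf f1] at h3
  · linarith
  · rw [← Set.inter_union_distrib_left]
    exact Set.inter_subset_inter_right _ (Function.support_add _ _)

theorem U_cube : (U * U * U : SL(2, ℤ)) = -1 := by
  ext i j
  simp only [Matrix.SpecialLinearGroup.coe_mul, Matrix.SpecialLinearGroup.coe_neg,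
    Matrix.SpecialLinearGroup.coe_one, coe_U, Matrix.mul_fin_two]
  fin_cases i <;> fin_cases j <;> simp

theorem cj_neg_one (N : Mat) : cj (-1) N = N := by
  have : ((-1 : SL(2, ℤ))⁻¹) = -1 := by
    rw [inv_eq_iff_mul_eq_one]; simp
  rw [cj, this]
  simp

theorem cj_U_cube (N : Mat) : cj U (cj U (cj U N)) = N := by
  rw [← cj_mul, ← cj_mul, U_cube, cj_neg_one]

theorem S_mul_S : (ModularGroup.S * ModularGroup.S : SL(2, ℤ)) = -1 := by
  ext i j
  simp only [Matrix.SpecialLinearGroup.coe_mul, Matrix.SpecialLinearGroup.coe_neg,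
    Matrix.SpecialLinearGroup.coe_one, coe_S, Matrix.mul_fin_two]
  fin_cases i <;> fin_cases j <;> simp

theorem cj_S_S (N : Mat) : cj ModularGroup.S (cj ModularGroup.S N) = N := by
  rw [← cj_mul, S_mul_S, cj_neg_one]

theorem qv_cj_U_sum (N : Mat) : qv N + qv (cj U N) + qv (cj U (cj U N)) = 2 := by
  have hU2 : ((U⁻¹ : SL(2, ℤ)) : Mat) = -((U : Mat) * U) := by
    rw [coe_U_inv, coe_U, Matrix.mul_fin_two, neg_fin_two]; norm_num
  have hU4 : ((U⁻¹ : SL(2, ℤ)) : Mat) * ((U⁻¹ : SL(2, ℤ)) : Mat) = -(U : Mat) := by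
    rw [coe_U_inv, coe_U, Matrix.mul_fin_two, neg_fin_two]; norm_num
  have h1 : qv (cj U N) = qv (N * U * U) := by
    rw [cj, mul_assoc, qv_U_mul, hU2, mul_neg, qv_neg, mul_assoc]
  have h2 : qv (cj U (cj U N)) = qv (N * U) := by
    rw [cj, mul_assoc, qv_U_mul, cj, mul_assoc, mul_assoc, qv_U_mul, hU4, mul_neg, qv_neg]
  linarith [qv_mul_U N]

/-- A scalar matrix. -/
def IsScalarMat (N : Mat) : Prop := ∃ l : ℤ, N = Matrix.scalar (Fin 2) l

theorem isScalarMat_iff {a b c d : ℤ} :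
    IsScalarMat !![a, b; c, d] ↔ b = 0 ∧ c = 0 ∧ a = d := by
  constructor
  · rintro ⟨l, hl⟩
    have h := fun i j => congrFun (congrFun hl i) j
    have h1 := h 0 0
    have h2 := h 0 1
    have h3 := h 1 0
    have h4 := h 1 1
    simp at h1 h2 h3 h4
    exact ⟨h2, h3, h1.trans h4.symm⟩
  · rintro ⟨rfl, rfl, rfl⟩
    refine ⟨a, ?_⟩
    ext i j
    rw [Matrix.scalar_apply]
    fin_cases i <;> fin_cases j <;> rfl

theorem isScalarMat_cj {g : SL(2, ℤ)} {N : Mat} (h : IsScalarMat N) : IsScalarMat (cj g N) := by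
  obtain ⟨l, rfl⟩ := h
  refine ⟨l, ?_⟩
  rw [cj, (Matrix.scalar_commute l (fun r => Commute.all l r) (g : Mat)).eq.symm, mul_assoc,
    coe_mul_inv, mul_one]

theorem isScalarMat_neg {N : Mat} (h : IsScalarMat N) : IsScalarMat (-N) := by
  obtain ⟨l, rfl⟩ := h
  exact ⟨-l, by rw [map_neg]⟩

theorem isScalarMat_of_mem_classSet {M N : Mat} (h : N ∈ classSet M) (hN : IsScalarMat N) :
    IsScalarMat M := by
  obtain ⟨g, hg⟩ := conjClass_eq_iff.1 (show conjClass M = conjClass N from h.symm)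
  rcases hg with hg | hg <;> rw [hg]
  · exact isScalarMat_cj hN
  · exact isScalarMat_neg (isScalarMat_cj hN)

/-- Conjugation by `U` rotates the triple `c`, `-b`, `c + d - a - b`, so this is `sign_form_sum`. A
nonscalar matrix has a nonzero triple. -/
theorem pv_cj_U_sum {N : Mat} (hd : 4 * N.det ≤ N.trace ^ 2) (hs : ¬IsScalarMat N) :
    pv N + pv (cj U N) + pv (cj U (cj U N)) = 2 := by
  obtain ⟨a, b, c, d, rfl⟩ := exists_entries N
  rw [Matrix.det_fin_two_of, Matrix.trace_fin_two_of] at hd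
  have key := sign_form_sum (x := c) (y := -b) (z := c + d - a - b)
    (by
      by_contra! h
      exact hs (isScalarMat_iff.2 ⟨by omega, by omega, by omega⟩))
    (by nlinarith)
  have key' : (((c + -b - (c + d - a - b)).sign : ℤ) : ℚ) * (c.sign + (-b).sign) +
    (-b + (c + d - a - b) - c).sign * ((-b).sign + (c + d - a - b).sign) +
    ((c + d - a - b) + c - -b).sign * ((c + d - a - b).sign + c.sign) = 2 := by exact_mod_cast key
  rw [cj_U_mk, cj_U_mk, pv, pv, pv, sv_mk, sv_mk, sv_mk]
  have e1 : c + -b - (c + d - a - b) = a - d := by ring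
  have e2 : -b + (c + d - a - b) - c = d - b - (a + b) := by ring
  have e3 : c + d - a - b + c - -b =
    a + b - (a - c + b - d) - (d - b + (a - c + b - d)) := by ring
  have e4 : a - c + b - d = -(c + d - a - b) := by ring
  have e5 : d - b - -b + (a - c + b - d) - (a + b) = -c := by ring
  rw [e1, e2, e3] at key'
  simp only [e5]
  rw [e4] at key' ⊢
  simp only [Int.sign_neg] at key' ⊢
  push_cast at key' ⊢
  linarith

/-- For nonnegative discriminant, the sum of the weights over a class is computed at the
matrices fixing the cusp `∞`. -/
theorem sum_wt_eq_sum_kap {n : ℕ} (hn : 0 < n) {M : Mat} (hdet : M.det = n)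
    (hd : 4 * M.det ≤ M.trace ^ 2) (hs : ¬IsScalarMat M) :
    (classSet M ∩ Function.support fun N => kap N - kap (cj ModularGroup.T N)).Finite ∧
    ∑ᶠ N ∈ classSet M, wt N =
      ∑ᶠ N ∈ classSet M, (kap N - kap (cj ModularGroup.T N)) := by
  have hn' : 0 < (n : ℤ) := by exact_mod_cast hn
  set r : Mat → ℚ := fun N => qv N - pv N - (kap N - kap (cj U N)) with hr
  set g : Mat → ℚ := fun N => hv N - pv N - (kap N - kap (cj ModularGroup.S N)) with hg
  have fr : (classSet M ∩ Function.support r).Finite :=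
    (finite_qv_correction n hn' (M.trace ^ 2) (by rw [← hdet]; exact hd)).subset
      fun N ⟨h1, h2⟩ => ⟨(det_of_mem_classSet h1).trans hdet, trace_of_mem_classSet h1, h2⟩
  have fg : (classSet M ∩ Function.support g).Finite :=
    (finite_hv_correction n hn' (M.trace ^ 2)).subset
      fun N ⟨h1, h2⟩ => ⟨(det_of_mem_classSet h1).trans hdet, trace_of_mem_classSet h1, h2⟩
  have fw : (classSet M ∩ Function.support wt).Finite :=
    (finite_wt_ne_zero hn).subset
      fun N ⟨h1, h2⟩ => ⟨(det_of_mem_classSet h1).trans hdet, h2⟩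
  have sr : ∑ᶠ N ∈ classSet M, r N = 0 := by
    refine sum_eq_zero_of_U fr fun N hN => ?_
    have h1 := qv_cj_U_sum N
    have h2 := pv_cj_U_sum (N := N)
      (by rw [det_of_mem_classSet hN, trace_of_mem_classSet hN]; exact hd)
      fun h => hs (isScalarMat_of_mem_classSet hN h)
    simp only [hr]
    rw [cj_U_cube]
    linarith
  have sg : ∑ᶠ N ∈ classSet M, g N = 0 := by
    refine sum_eq_zero_of_S fun N _ => ?_
    simp only [hg]
    rw [cj_S_S, hv_cj_S, pv_cj_S]
    ring
  set k : Mat → ℚ := fun N => kap (cj ModularGroup.S N) - kap (cj U N) with hk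
  -- The two copies of `kap N` cancel. The two terms of `k` need not have finite support separately;
  -- only their difference is known to.
  have hkw : ∀ N, wt N = r N - g N + k N := fun N => by
    simp only [hr, hg, hk, wt]; ring
  have frg : (classSet M ∩ Function.support fun N => r N - g N).Finite := by
    refine (fr.union fg).subset ?_
    rw [← Set.inter_union_distrib_left]
    exact Set.inter_subset_inter_right _ (Function.support_sub _ _)
  have fk : (classSet M ∩ Function.support k).Finite := by
    refine (fw.union frg).subset ?_
    rw [← Set.inter_union_distrib_left]
    refine Set.inter_subset_inter_right _ ?_
    have : k = fun N => wt N - (r N - g N) := by funext N; rw [hkw]; ring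
    rw [this]
    exact Function.support_sub _ _
  -- Since `U * S⁻¹ = T`, reindexing by `S⁻¹` turns `k` into a `T`-difference. Its sum need not
  -- vanish, as `kap` may have infinite support.
  have hkT : ∀ N, k (cj ModularGroup.S⁻¹ N) = kap N - kap (cj ModularGroup.T N) := by
    intro N
    simp only [hk]
    rw [cj_cj_inv, ← cj_mul, U, mul_inv_cancel_right]
  constructor
  · have := finite_support_cj ModularGroup.S⁻¹ fk
    simpa only [hkT] using this
  · rw [finsum_mem_congr rfl fun N _ => hkw N, finsum_mem_add_distrib' frg fk,
      finsum_mem_congr rfl fun N _ => (sub_eq_add_neg (r N) (g N)),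
      finsum_mem_add_distrib' fr (by simpa using fg), sr, ← sum_classSet_cj ModularGroup.S⁻¹ M k,
      finsum_mem_congr rfl fun N _ => hkT N]
    have : ∑ᶠ N ∈ classSet M, -g N = 0 := by
      rw [← neg_zero, ← sg, ← finsum_neg_distrib]
      exact finsum_congr fun N => finsum_neg_distrib _
    rw [this]
    simp

/-! ### Classes of nonnegative discriminant: upper triangular members and telescoping -/

open Filter

theorem sign_eventually {τ : ℤ} (β : ℤ) (hτ : τ ≠ 0) :
    (∀ᶠ j : ℤ in atBot, (β + j * τ).sign = -τ.sign) ∧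
      ∀ᶠ j : ℤ in atTop, (β + j * τ).sign = τ.sign := by
  rcases sign_cases hτ with ⟨h, hs⟩ | ⟨h, hs⟩ <;> rw [hs]
  · constructor
    · filter_upwards [linear_pos_atBot (q := -τ) (-β) (by omega)] with j hj
      exact Int.sign_eq_neg_one_of_neg (by linarith)
    · filter_upwards [linear_pos_atTop (q := τ) β (by omega)] with j hj
      exact Int.sign_eq_one_of_pos (by linarith)
  · constructor
    · filter_upwards [linear_pos_atBot (q := τ) β (by omega)] with j hj
      exact Int.sign_eq_one_of_pos (by linarith)
    · filter_upwards [linear_pos_atTop (q := -τ) (-β) (by omega)] with j hj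
      exact Int.sign_eq_neg_one_of_neg (by linarith)

theorem kap_upper (α b δ : ℤ) : kap !![α, b; 0, δ] =
    (-(α.sign * b.sign : ℤ) + ((α - δ).sign * b.sign : ℤ) / 2) / 2 := by
  rw [kap_mk, if_pos rfl, hv_mk, pv, sv_mk, zero_mul, add_zero, Int.sign_mul]
  push_cast
  rw [Int.sign_zero]
  push_cast
  ring

/-- Along the orbit of `T` the diagonal is constant and only the sign of the upper right entry
matters. The sum is the jump of `kap` as this sign changes from that of `α - δ` to that of `δ - α`.
-/
theorem sum_kap_telescope {α δ : ℤ} (β : ℤ) (hne : α ≠ δ) :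
    ∑ᶠ j : ℤ, (kap !![α, β + j * (δ - α); 0, δ] - kap !![α, β + (j + 1) * (δ - α); 0, δ]) =
      1 / 2 + (α.sign * (δ - α).sign : ℤ) := by
  have hτ : δ - α ≠ 0 := sub_ne_zero.2 hne.symm
  obtain ⟨h0, h1⟩ := sign_eventually β hτ
  have e : (α - δ).sign = -(δ - α).sign := by rw [← neg_sub, Int.sign_neg]
  have hsq : ((δ - α).sign * (δ - α).sign : ℤ) = 1 := by
    rcases sign_cases hτ with ⟨_, h⟩ | ⟨_, h⟩ <;> rw [h] <;> norm_num
  have hsq' : (((δ - α).sign : ℤ) : ℚ) * (δ - α).sign = 1 := by exact_mod_cast hsq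
  have := (telescope (f := fun j => kap !![α, β + j * (δ - α); 0, δ])
    (h0.mono fun j hj => by rw [kap_upper, hj]) (h1.mono fun j hj => by rw [kap_upper, hj])).2
  rw [this, e]
  push_cast
  linear_combination (1 / 2) * hsq'

/-- A conjugating matrix preserves the eigenline spanned by the first basis vector, so it is `±` a
power of `T`. Conjugacy to the negative is excluded by the trace, as `α` and `δ` have the same sign.
-/
theorem class_upper {α β δ b d : ℤ} (hpos : 0 < α * δ) (hne : α ≠ δ)
    (h : !![α, b; 0, d] ∈ classSet !![α, β; 0, δ]) : d = δ ∧ ∃ j : ℤ, b = β + j * (δ - α) := by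
  have hα : α ≠ 0 := by rintro rfl; simp at hpos
  have hdet := det_of_mem_classSet h
  rw [Matrix.det_fin_two_of, Matrix.det_fin_two_of] at hdet
  have hd : d = δ := mul_left_cancel₀ hα (by linarith)
  subst hd
  refine ⟨rfl, ?_⟩
  obtain ⟨g, hg | hg⟩ := conjClass_eq_iff.1 h
  · have hmul : !![α, b; 0, d] * (g : Mat) = (g : Mat) * !![α, β; 0, d] := by
      rw [hg, cj, mul_assoc, coe_inv_mul, mul_one]
    have hdetg : (g : Mat).det = 1 := g.det_coe
    obtain ⟨p, q, r, s, hpq⟩ := exists_entries (g : Mat)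
    rw [hpq, Matrix.det_fin_two_of] at hdetg
    rw [hpq, Matrix.mul_fin_two, Matrix.mul_fin_two] at hmul
    have h10 := congrFun (congrFun hmul 1) 0
    have h01 := congrFun (congrFun hmul 0) 1
    simp only [Matrix.of_apply, Matrix.cons_val', Matrix.cons_val_zero, Matrix.cons_val_one,
      Matrix.cons_val_fin_one] at h10 h01
    have hr : r = 0 := by
      have : r * (d - α) = 0 := by linarith
      exact (mul_eq_zero.1 this).resolve_right (sub_ne_zero.2 hne.symm)
    subst hr
    have hps : p * s = 1 := by linarith
    have hp2 : p * p = 1 := by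
      rcases Int.isUnit_iff.1 (IsUnit.of_mul_eq_one s hps) with h | h <;> rw [h] <;> norm_num
    refine ⟨p * q, ?_⟩
    linear_combination (-b) * hps + β * hp2 + p * h01
  · have htr := congrArg Matrix.trace hg
    rw [Matrix.trace_neg, trace_cj, Matrix.trace_fin_two_of, Matrix.trace_fin_two_of] at htr
    have : d = -α := by linarith
    rw [this] at hpos
    nlinarith [sq_nonneg α]

theorem coe_T_zpow (j : ℤ) : ((ModularGroup.T ^ j : SL(2, ℤ)) : Mat) = !![1, j; 0, 1] :=
  ModularGroup.coe_T_zpow j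

theorem cj_T_zpow_upper (α β δ j : ℤ) :
    cj (ModularGroup.T ^ j) !![α, β; 0, δ] = !![α, β + j * (δ - α); 0, δ] := by
  rw [cj, ← zpow_neg, coe_T_zpow, coe_T_zpow, Matrix.mul_fin_two, Matrix.mul_fin_two]
  ring_nf

theorem sum_upper {α β δ : ℤ} (hpos : 0 < α * δ) (hne : α ≠ δ) :
    ∑ᶠ N ∈ {N | N ∈ classSet !![α, β; 0, δ] ∧ N 1 0 = 0 ∧ N 0 0 = α},
      (kap N - kap (cj ModularGroup.T N)) = 1 / 2 + (α.sign * (δ - α).sign : ℤ) := by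
  have hset : {N : Mat | N ∈ classSet !![α, β; 0, δ] ∧ N 1 0 = 0 ∧ N 0 0 = α} =
      Set.range fun j : ℤ => (!![α, β + j * (δ - α); 0, δ] : Mat) := by
    ext N
    constructor
    · rintro ⟨h1, h2, h3⟩
      obtain ⟨a, b, c, d, rfl⟩ := exists_entries N
      obtain rfl : c = 0 := h2
      obtain rfl : a = α := h3
      obtain ⟨rfl, j, rfl⟩ := class_upper hpos hne h1
      exact ⟨j, rfl⟩
    · rintro ⟨j, rfl⟩
      refine ⟨?_, rfl, rfl⟩
      change !![α, β + j * (δ - α); 0, δ] ∈ _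
      rw [← cj_T_zpow_upper]
      exact cj_mem_classSet _ (mem_classSet_self _)
  rw [hset, finsum_mem_range, ← sum_kap_telescope β hne]
  · refine finsum_congr fun j => ?_
    rw [cj_T_mk]
    ring_nf
  · intro i j hij
    have h := congrFun (congrFun hij 0) 1
    have h' : β + i * (δ - α) = β + j * (δ - α) := h
    exact mul_right_cancel₀ (sub_ne_zero.2 hne.symm) (by linarith)

theorem exists_cj_upper {M : Mat} {l : ℤ}
    (hl : (M 0 0 - l) * (M 1 1 - l) = M 0 1 * M 1 0) :
    ∃ (g : SL(2, ℤ)) (b d : ℤ), cj g M = !![l, b; 0, d] := by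
  obtain ⟨a, b, c, d, rfl⟩ := exists_entries M
  change (a - l) * (d - l) = b * c at hl
  -- A primitive integral eigenvector for `l`: a nonzero vector orthogonal to a nonzero row of `M -
  -- l`, divided by its content. It becomes the first column of the conjugating matrix.
  have hv : ∃ u w : ℤ, IsCoprime u w ∧ a * u + b * w = l * u ∧ c * u + d * w = l * w := by
    by_cases h0 : a - l = 0 ∧ b = 0
    · by_cases h1 : c = 0 ∧ d - l = 0
      · exact ⟨1, 0, isCoprime_one_left, by rw [h0.2]; linarith, by rw [h1.1]; ring⟩
      · have hg : 0 < Int.gcd (d - l) c := by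
          rw [Int.gcd_pos_iff]; tauto
        obtain ⟨p, q, hpq, hp, hq⟩ := Int.exists_gcd_one hg
        refine ⟨p, -q, (Int.isCoprime_iff_gcd_eq_one.2 hpq).neg_right, ?_, ?_⟩
        · rw [h0.2]; linear_combination p * h0.1
        · have hg' : ((Int.gcd (d - l) c : ℕ) : ℤ) ≠ 0 := by exact_mod_cast hg.ne'
          linear_combination p * hq - q * hp
    · have hg : 0 < Int.gcd b (a - l) := by
        rw [Int.gcd_pos_iff]; tauto
      obtain ⟨p, q, hpq, hp, hq⟩ := Int.exists_gcd_one hg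
      refine ⟨p, -q, (Int.isCoprime_iff_gcd_eq_one.2 hpq).neg_right, ?_, ?_⟩
      · linear_combination p * hq - q * hp
      · have hg' : ((Int.gcd b (a - l) : ℕ) : ℤ) ≠ 0 := by exact_mod_cast hg.ne'
        apply mul_left_cancel₀ hg'
        linear_combination (-c) * hp + (d - l) * hq - hl
  obtain ⟨u, w, huw, h1, h2⟩ := hv
  obtain ⟨h, hu, hw⟩ := huw.exists_SL2_col 0
  have hdet : (h : Mat).det = 1 := h.det_coe
  obtain ⟨p, x, r, y, hp⟩ := exists_entries (h : Mat)
  have hinv : ((h⁻¹ : SL(2, ℤ)) : Mat) = !![y, -x; -r, p] := by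
    rw [Matrix.SpecialLinearGroup.coe_inv, hp, Matrix.adjugate_fin_two_of]
  have hpu : p = u := by rw [← hu, hp]; rfl
  have hrw : r = w := by rw [← hw, hp]; rfl
  subst hpu hrw
  rw [hp, Matrix.det_fin_two_of] at hdet
  refine ⟨h⁻¹, y * (a * x + b * y) - x * (c * x + d * y),
    -r * (a * x + b * y) + p * (c * x + d * y), ?_⟩
  rw [cj, inv_inv, hinv, hp, Matrix.mul_fin_two, Matrix.mul_fin_two]
  ext i j
  fin_cases i <;> fin_cases j <;> simp
  · linear_combination y * h1 - x * h2 + l * hdet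
  · ring
  · linear_combination (-r) * h1 + p * h2
  · ring

theorem classSet_eq {M N : Mat} (h : N ∈ classSet M) : classSet N = classSet M := by
  ext A
  exact ⟨fun hA => Eq.trans hA h, fun hA => Eq.trans hA (Eq.symm h)⟩

theorem kap_cj_T_of_ne {N : Mat} (h : N 1 0 ≠ 0) : kap N - kap (cj ModularGroup.T N) = 0 := by
  obtain ⟨a, b, c, d, rfl⟩ := exists_entries N
  have h' : c ≠ 0 := h
  rw [cj_T_mk, kap_mk, kap_mk, if_neg h', if_neg h', sub_zero]

/-- An upper triangular member has discriminant `(a - d) ^ 2`. For a nonsquare discriminant there is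
none; for discriminant 0 it commutes with `T`, so the `T`-difference of `kap` is zero. -/
theorem sum_wt_of_not_split {n : ℕ} (hn : 0 < n) {M : Mat} (hdet : M.det = n)
    (hd : 4 * M.det ≤ M.trace ^ 2) (hs : ¬IsScalarMat M)
    (hsq : M.trace ^ 2 - 4 * M.det = 0 ∨ ¬IsSquare (M.trace ^ 2 - 4 * M.det)) :
    ∑ᶠ N ∈ classSet M, wt N = 0 := by
  rw [(sum_wt_eq_sum_kap hn hdet hd hs).2]
  refine finsum_mem_eq_zero_of_forall_eq_zero fun N hN => ?_
  by_cases hc : N 1 0 = 0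
  · have h1 := det_of_mem_classSet hN
    have h2 := trace_of_mem_classSet hN
    rw [← h1, ← h2] at hsq
    obtain ⟨a, b, c, d, rfl⟩ := exists_entries N
    obtain rfl : c = 0 := hc
    rw [Matrix.det_fin_two_of, Matrix.trace_fin_two_of] at hsq
    have e : (a + d) ^ 2 - 4 * (a * d - b * 0) = (a - d) * (a - d) := by ring
    rw [e] at hsq
    rcases hsq with h | h
    · have : a = d := by
        have := mul_self_eq_zero.1 h
        omega
      subst this
      rw [cj_T_mk]
      ring_nf
    · exact absurd ⟨_, rfl⟩ h
  · exact kap_cj_T_of_ne hc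

/-- A matrix with two rational eigenvalues has trace and determinant given by integers. -/
theorem exists_eigenvalues {M : Mat} {k : ℤ} (hk : k ≠ 0)
    (hd : M.trace ^ 2 - 4 * M.det = k * k) :
    ∃ l μ : ℤ, l ≠ μ ∧ l * μ = M.det ∧ l + μ = M.trace := by
  have hpar : Even (M.trace + k) := by
    have h1 : Even ((M.trace + k) * (M.trace - k)) :=
      ⟨2 * M.det, by linear_combination hd⟩
    rcases Int.even_mul.1 h1 with h | h
    · exact h
    · have : M.trace + k = M.trace - k + 2 * k := by ring
      rw [this]
      exact h.add (even_two_mul k)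
  obtain ⟨l, hl⟩ := hpar
  refine ⟨l, M.trace - l, fun h => hk (by linarith), ?_, by ring⟩
  have : k = 2 * l - M.trace := by linarith
  rw [this] at hd
  linarith

theorem eigen_eq {M : Mat} {l μ : ℤ} (h1 : l * μ = M.det) (h2 : l + μ = M.trace) :
    (M 0 0 - l) * (M 1 1 - l) = M 0 1 * M 1 0 := by
  rw [Matrix.det_fin_two] at h1
  rw [Matrix.trace_fin_two] at h2
  linear_combination -h1 + l * h2

theorem exists_upper_mem {M : Mat} {l μ : ℤ} (hl : l ≠ 0) (h1 : l * μ = M.det)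
    (h2 : l + μ = M.trace) : ∃ b, !![l, b; 0, μ] ∈ classSet M := by
  obtain ⟨g, b, d, hg⟩ := exists_cj_upper (eigen_eq h1 h2)
  have hmem : !![l, b; 0, d] ∈ classSet M := hg ▸ cj_mem_classSet g (mem_classSet_self M)
  have hdet := det_of_mem_classSet hmem
  rw [Matrix.det_fin_two_of] at hdet
  have : d = μ := mul_left_cancel₀ hl (by linarith)
  exact ⟨b, this ▸ hmem⟩

theorem sum_corner {M : Mat} {α β δ : ℤ} (hpos : 0 < α * δ) (hne : α ≠ δ)
    (h : !![α, β; 0, δ] ∈ classSet M) :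
    ∑ᶠ N ∈ {N | N ∈ classSet M ∧ N 1 0 = 0 ∧ N 0 0 = α},
      (kap N - kap (cj ModularGroup.T N)) = 1 / 2 + (α.sign * (δ - α).sign : ℤ) := by
  rw [← classSet_eq h]
  exact sum_upper hpos hne

/-- The upper triangular members have upper left entry `l`, `μ`, `-l` or `-μ`, each choice giving
one `T`-orbit. Each orbit contributes `1 / 2` plus a sign, and the signs for `l` and `μ` are
opposite, as are those for `-l` and `-μ`. -/
theorem sum_wt_of_split {n : ℕ} (hn : 0 < n) {M : Mat} (hdet : M.det = n) (hs : ¬IsScalarMat M)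
    {k : ℤ} (hk : k ≠ 0) (hd : M.trace ^ 2 - 4 * M.det = k * k) :
    ∑ᶠ N ∈ classSet M, wt N = 2 := by
  have hpos : 0 < M.det := by rw [hdet]; exact_mod_cast hn
  obtain ⟨fk, hsum⟩ := sum_wt_eq_sum_kap hn hdet (by nlinarith [mul_self_nonneg k]) hs
  rw [hsum]
  obtain ⟨l, μ, hne, hmul, hadd⟩ := exists_eigenvalues hk hd
  have hlμ : 0 < l * μ := by rw [hmul]; exact hpos
  have hl : l ≠ 0 := by rintro rfl; simp at hlμ
  have hμ : μ ≠ 0 := by rintro rfl; simp at hlμ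
  obtain ⟨b, hb⟩ := exists_upper_mem hl hmul hadd
  obtain ⟨b', hb'⟩ := exists_upper_mem hμ (by rw [mul_comm]; exact hmul)
    (by rw [add_comm]; exact hadd)
  have nb := neg_mem_classSet hb
  have nb' := neg_mem_classSet hb'
  rw [neg_fin_two, neg_zero] at nb nb'
  set f : Mat → ℚ := fun N => kap N - kap (cj ModularGroup.T N) with hf
  have s1 := sum_corner hlμ hne hb
  have s2 := sum_corner (by linarith) hne.symm hb'
  have s3 := sum_corner (by linarith) (by omega) nb
  have s4 := sum_corner (by linarith) (by omega) nb'
  have hfin : ∀ ν : ℤ, ({N | N ∈ classSet M ∧ N 1 0 = 0 ∧ N 0 0 = ν} ∩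
      Function.support f).Finite := fun ν => fk.subset fun N hN => ⟨hN.1.1, hN.2⟩
  have hopp : l.sign * (μ - l).sign + μ.sign * (l - μ).sign = 0 := by
    rw [← Int.sign_mul, ← Int.sign_mul]
    rcases mul_pos_iff.1 hlμ with ⟨h1, h2⟩ | ⟨h1, h2⟩ <;> rcases lt_or_gt_of_ne hne with h3 | h3
    · rw [Int.sign_eq_one_of_pos (by nlinarith), Int.sign_eq_neg_one_of_neg (by nlinarith)]
      rfl
    · rw [Int.sign_eq_neg_one_of_neg (by nlinarith), Int.sign_eq_one_of_pos (by nlinarith)]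
      rfl
    · rw [Int.sign_eq_neg_one_of_neg (by nlinarith), Int.sign_eq_one_of_pos (by nlinarith)]
      rfl
    · rw [Int.sign_eq_one_of_pos (by nlinarith), Int.sign_eq_neg_one_of_neg (by nlinarith)]
      rfl
  have hopp' : ((l.sign * (μ - l).sign : ℤ) : ℚ) + (μ.sign * (l - μ).sign : ℤ) = 0 := by
    exact_mod_cast hopp
  rw [show -μ - -l = -(μ - l) by ring, Int.sign_neg, Int.sign_neg, neg_mul_neg] at s3
  rw [show -l - -μ = -(l - μ) by ring, Int.sign_neg, Int.sign_neg, neg_mul_neg] at s4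
  have hunion : ∑ᶠ N ∈ classSet M, f N = ∑ᶠ N ∈
      (({N | N ∈ classSet M ∧ N 1 0 = 0 ∧ N 0 0 = l} ∪
        {N | N ∈ classSet M ∧ N 1 0 = 0 ∧ N 0 0 = μ}) ∪
      ({N | N ∈ classSet M ∧ N 1 0 = 0 ∧ N 0 0 = -l} ∪
        {N | N ∈ classSet M ∧ N 1 0 = 0 ∧ N 0 0 = -μ})), f N := by
    refine finsum_mem_inter_support_eq f _ _ (Set.ext fun N => ⟨?_, ?_⟩)
    · rintro ⟨h1, h2⟩
      refine ⟨?_, h2⟩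
      have hc : N 1 0 = 0 := by
        by_contra hc
        exact h2 (kap_cj_T_of_ne hc)
      have e1 := det_of_mem_classSet h1
      have e2 := trace_of_mem_classSet h1
      rw [← hmul] at e1
      rw [← hadd] at e2
      have key : N 0 0 = l ∨ N 0 0 = μ ∨ N 0 0 = -l ∨ N 0 0 = -μ := by
        rw [Matrix.det_fin_two, hc] at e1
        rw [Matrix.trace_fin_two] at e2
        rcases sq_eq_sq_iff_eq_or_eq_neg.1 e2 with h | h
        · have : (N 0 0 - l) * (N 0 0 - μ) = 0 := by linear_combination N 0 0 * h - e1
          rcases mul_eq_zero.1 this with h | h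
          · exact Or.inl (by omega)
          · exact Or.inr (Or.inl (by omega))
        · have : (N 0 0 + l) * (N 0 0 + μ) = 0 := by linear_combination N 0 0 * h - e1
          rcases mul_eq_zero.1 this with h | h
          · exact Or.inr (Or.inr (Or.inl (by omega)))
          · exact Or.inr (Or.inr (Or.inr (by omega)))
      rcases key with h | h | h | h
      · exact Or.inl (Or.inl ⟨h1, hc, h⟩)
      · exact Or.inl (Or.inr ⟨h1, hc, h⟩)
      · exact Or.inr (Or.inl ⟨h1, hc, h⟩)
      · exact Or.inr (Or.inr ⟨h1, hc, h⟩)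
    · rintro ⟨(h | h) | (h | h), h2⟩ <;> exact ⟨h.1, h2⟩
  have hne1 : l ≠ -l := fun h => hl (by omega)
  have hne2 : l ≠ -μ := fun h => by rw [h] at hlμ; nlinarith [sq_nonneg μ]
  have hne3 : μ ≠ -μ := fun h => hμ (by omega)
  have hne4 : μ ≠ -l := fun h => by rw [h] at hlμ; nlinarith [sq_nonneg l]
  have disj : ∀ ν ν' : ℤ, ν ≠ ν' → Disjoint {N : Mat | N ∈ classSet M ∧ N 1 0 = 0 ∧ N 0 0 = ν}
      {N | N ∈ classSet M ∧ N 1 0 = 0 ∧ N 0 0 = ν'} := fun ν ν' h =>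
    Set.disjoint_left.2 fun N h1 h2 => h (h1.2.2.symm.trans h2.2.2)
  rw [hunion, finsum_mem_union', finsum_mem_union' (disj _ _ hne) (hfin _) (hfin _),
    finsum_mem_union' (disj _ _ (by omega)) (hfin _) (hfin _), s1, s2, s3, s4]
  · linarith
  · rw [Set.disjoint_union_left, Set.disjoint_union_right, Set.disjoint_union_right]
    exact ⟨⟨disj _ _ hne1, disj _ _ hne2⟩, ⟨disj _ _ hne4, disj _ _ hne3⟩⟩
  · rw [Set.union_inter_distrib_right]
    exact (hfin _).union (hfin _)
  · rw [Set.union_inter_distrib_right]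
    exact (hfin _).union (hfin _)

/-! ### Stabilizers -/

theorem barSL_eq_iff {g h : SL(2, ℤ)} : barSL g = barSL h ↔ g = h ∨ g = -h := by
  rw [barSL, barSL, bar_eq_iff, ← Matrix.SpecialLinearGroup.coe_neg]
  constructor
  · rintro (h | h)
    · exact Or.inl (Subtype.ext h)
    · exact Or.inr (Subtype.ext h)
  · rintro (rfl | rfl)
    · exact Or.inl rfl
    · exact Or.inr rfl

theorem mem_stab_iff {M : Mat} {γ : BarMat} :
    γ ∈ stab M ↔ ∃ g, γ = barSL g ∧ (cj g M = M ∨ cj g M = -M) := by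
  constructor <;> rintro ⟨g, hg, h⟩ <;> refine ⟨g, hg, ?_⟩
  · exact bar_eq_iff.1 h
  · exact bar_eq_iff.2 h

theorem barSL_mem_stab_iff {M : Mat} {g : SL(2, ℤ)} :
    barSL g ∈ stab M ↔ cj g M = M ∨ cj g M = -M := by
  rw [mem_stab_iff]
  constructor
  · rintro ⟨h, hh, hM⟩
    rcases barSL_eq_iff.1 hh with rfl | rfl
    · exact hM
    · have : cj (-h) M = cj h M := by
        rw [← neg_one_mul, cj_mul, cj_neg_one]
      rwa [this]
  · exact fun h => ⟨g, rfl, h⟩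

theorem cj_eq_iff {g : SL(2, ℤ)} {M N : Mat} : cj g M = N ↔ (g : Mat) * M = N * (g : Mat) := by
  constructor
  · rintro rfl
    rw [cj, mul_assoc, coe_inv_mul, mul_one]
  · intro h
    rw [cj, h, mul_assoc, coe_mul_inv, mul_one]

/-- Solutions of Pell's equation give the norm-one elements `x + w * (2 * M - tr M)` of the order
generated by `M`; they have determinant 1 and commute with `M`. -/
theorem stab_infinite {M : Mat} (hd : 0 < M.trace ^ 2 - 4 * M.det)
    (hsq : ¬IsSquare (M.trace ^ 2 - 4 * M.det)) : (stab M).Infinite := by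
  set D := M.trace ^ 2 - 4 * M.det with hD
  obtain ⟨a, b, c, d, rfl⟩ := exists_entries M
  rw [Matrix.det_fin_two_of, Matrix.trace_fin_two_of] at hD
  have hbc : b ≠ 0 := by
    rintro rfl
    exact hsq ⟨a - d, by rw [hD]; ring⟩
  have key : ∀ m : ℕ, ∃ g : SL(2, ℤ), barSL g ∈ stab !![a, b; c, d] ∧ m < |(g : Mat) 0 1| := by
    intro m
    have hm : ((m : ℤ) + 1) ≠ 0 := by positivity
    -- The factor `(m + 1) ^ 2` makes `w` a multiple of `m + 1`, which pushes the upper right entry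
    -- of `g` beyond `m`.
    obtain ⟨x, y, hxy, hy⟩ := Pell.exists_of_not_isSquare (d := D * ((m + 1 : ℤ)) ^ 2)
      (by positivity) (by
        rintro ⟨r, hr⟩
        apply hsq
        have hdvd : ((m : ℤ) + 1) ^ 2 ∣ r ^ 2 := ⟨D, by linarith⟩
        obtain ⟨s, rfl⟩ := (Int.pow_dvd_pow_iff two_ne_zero).1 hdvd
        refine ⟨s, mul_right_cancel₀ (pow_ne_zero 2 hm) ?_⟩
        linarith)
    set w := ((m : ℤ) + 1) * y with hw
    have hdet : (x + w * (a - d)) * (x - w * (a - d)) - (2 * w * b) * (2 * w * c) = 1 := by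
      rw [← hxy, hD, hw]; ring
    obtain ⟨g, hg⟩ : ∃ g : SL(2, ℤ), (g : Mat) =
        !![x + w * (a - d), 2 * w * b; 2 * w * c, x - w * (a - d)] :=
      ⟨⟨_, by rw [Matrix.det_fin_two_of]; exact hdet⟩, rfl⟩
    refine ⟨g, ?_, ?_⟩
    · rw [barSL_mem_stab_iff]
      left
      rw [cj_eq_iff, hg, Matrix.mul_fin_two, Matrix.mul_fin_two]
      ring_nf
    · rw [hg]
      change (m : ℤ) < |2 * w * b|
      rw [abs_mul, abs_mul, hw, abs_mul]
      have h1 : 1 ≤ |y| := Int.one_le_abs hy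
      have h2 : 1 ≤ |b| := Int.one_le_abs hbc
      have h3 : |(m : ℤ) + 1| = m + 1 := abs_of_nonneg (by positivity)
      rw [h3, abs_of_pos (by norm_num : (0 : ℤ) < 2)]
      have h4 : (m : ℤ) + 1 ≤ (m + 1) * |y| := le_mul_of_one_le_right (by positivity) h1
      have h5 : 2 * (((m : ℤ) + 1) * |y|) ≤ 2 * (((m : ℤ) + 1) * |y|) * |b| :=
        le_mul_of_one_le_right (by positivity) h2
      linarith
  intro hfin
  have hfin2 : (Set.range fun γ : stab !![a, b; c, d] => |(Quotient.out γ.1 : Mat) 0 1|).Finite :=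
    haveI := hfin.to_subtype
    Set.finite_range _
  obtain ⟨B, hB⟩ := hfin2.bddAbove
  obtain ⟨g, hg, hlt⟩ := key B.toNat
  have h1 := hB ⟨⟨barSL g, hg⟩, rfl⟩
  have h2 : bar (Quotient.out (barSL g)) = bar (g : Mat) := Quotient.out_eq (barSL g)
  have h3 : |(Quotient.out (barSL g) : Mat) 0 1| = |(g : Mat) 0 1| := by
    rcases bar_eq_iff.1 h2 with h | h <;> rw [h]
    rw [Matrix.neg_apply, abs_neg]
  have h4 : |(g : Mat) 0 1| ≤ B := by rw [← h3]; exact h1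
  omega

theorem stab_cj_ncard (g : SL(2, ℤ)) (M : Mat) : Nat.card (stab (cj g M)) = Nat.card (stab M) := by
  have hmul : ∀ g h : SL(2, ℤ), barSL (g * h) = barSL g * barSL h := fun g h => by
    simp [barSL, bar]
  have hone : barSL 1 = 1 := by simp [barSL, bar]
  have hinv : ∀ g, barSL g⁻¹ * barSL g = 1 := fun g => by rw [← hmul, inv_mul_cancel, hone]
  refine (Nat.card_congr ((Equiv.ofBijective (fun γ : stab M =>
    (⟨barSL g * γ.1 * barSL g⁻¹, ?_⟩ : stab (cj g M))) ⟨?_, ?_⟩))).symm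
  · obtain ⟨h, hh, hM⟩ := mem_stab_iff.1 γ.2
    refine mem_stab_iff.2 ⟨g * h * g⁻¹, by rw [hh, hmul, hmul], ?_⟩
    rw [cj_mul, cj_inv_cj, cj_mul, ← cj_neg]
    exact hM.imp (fun h => by rw [h]) fun h => by rw [h]
  · intro γ γ' h
    have h' : barSL g * γ.1 * barSL g⁻¹ = barSL g * γ'.1 * barSL g⁻¹ := congrArg Subtype.val h
    apply Subtype.ext
    have h2 := congrArg (fun x => barSL g⁻¹ * x * barSL g) h'
    simp only [mul_assoc, hinv, mul_one] at h2
    simpa only [← mul_assoc, hinv, one_mul] using h2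
  · rintro ⟨γ, hγ⟩
    obtain ⟨h, rfl, hM⟩ := mem_stab_iff.1 hγ
    refine ⟨⟨barSL (g⁻¹ * h * g), barSL_mem_stab_iff.2 ?_⟩, ?_⟩
    · rw [cj_mul, cj_mul]
      rcases hM with hM | hM <;> rw [hM]
      · exact Or.inl (cj_inv_cj g M)
      · exact Or.inr (by rw [cj_neg, cj_inv_cj])
    · apply Subtype.ext
      change barSL g * barSL (g⁻¹ * h * g) * barSL g⁻¹ = barSL h
      rw [← hmul, ← hmul]
      congr 1
      group

/-- After conjugation the matrix is upper triangular with distinct eigenvalues. An element of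
`SL₂(ℤ)` commuting with it is upper triangular with equal diagonal entries `±1`, hence `±1`. Its
trace is nonzero, so it is not conjugate to its negative. -/
theorem card_stab_of_split {M : Mat} (hpos : 0 < M.det) {k : ℤ} (hk : k ≠ 0)
    (hd : M.trace ^ 2 - 4 * M.det = k * k) : Nat.card (stab M) = 1 := by
  obtain ⟨l, μ, hne, hmul, hadd⟩ := exists_eigenvalues hk hd
  obtain ⟨g, b, d, hg⟩ := exists_cj_upper (eigen_eq hmul hadd)
  rw [← stab_cj_ncard g, hg]
  have e1 : l * d = l * μ := by
    rw [hmul, ← det_cj g M, hg, Matrix.det_fin_two_of]; ring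
  have hl : l ≠ 0 := by rintro rfl; rw [← hmul] at hpos; simp at hpos
  have hdμ : d = μ := mul_left_cancel₀ hl e1
  subst hdμ
  have hone : stab !![l, b; 0, d] = {barSL 1} := by
    ext γ
    rw [Set.mem_singleton_iff]
    constructor
    · intro hγ
      obtain ⟨h, rfl, hM⟩ := mem_stab_iff.1 hγ
      rw [barSL_eq_iff]
      rcases hM with hM | hM
      · rw [cj_eq_iff] at hM
        have hdetg : (h : Mat).det = 1 := h.det_coe
        obtain ⟨p, q, r, s, hpq⟩ := exists_entries (h : Mat)
        rw [hpq, Matrix.det_fin_two_of] at hdetg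
        rw [hpq, Matrix.mul_fin_two, Matrix.mul_fin_two] at hM
        have h10 := congrFun (congrFun hM 1) 0
        have h01 := congrFun (congrFun hM 0) 1
        simp only [Matrix.of_apply, Matrix.cons_val', Matrix.cons_val_zero, Matrix.cons_val_one,
          Matrix.cons_val_fin_one] at h10 h01
        have hr : r = 0 := by
          have : r * (l - d) = 0 := by linarith
          exact (mul_eq_zero.1 this).resolve_right (sub_ne_zero.2 hne)
        subst hr
        have hps : p * s = 1 := by linarith
        have hp : p = s := by
          rcases Int.isUnit_iff.1 (IsUnit.of_mul_eq_one s hps) with h | h <;> rw [h] at hps ⊢ <;>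
            linarith
        subst hp
        have hq : q = 0 := by
          have : q * (d - l) = 0 := by linarith
          exact (mul_eq_zero.1 this).resolve_right (sub_ne_zero.2 hne.symm)
        subst hq
        rcases Int.isUnit_iff.1 (IsUnit.of_mul_eq_one p hps) with h | h
        · left
          apply Subtype.ext
          rw [hpq, h]
          ext i j
          fin_cases i <;> fin_cases j <;> rfl
        · right
          apply Subtype.ext
          rw [hpq, h]
          ext i j
          fin_cases i <;> fin_cases j <;> rfl
      · have htr := congrArg Matrix.trace hM
        rw [Matrix.trace_neg, trace_cj, Matrix.trace_fin_two_of] at htr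
        have : d = -l := by linarith
        rw [← hmul, this] at hpos
        nlinarith [sq_nonneg l]
    · rintro rfl
      exact barSL_mem_stab_iff.2 (Or.inl (cj_one _))
  rw [hone]
  simp

/-! ### Elliptic classes -/

theorem finite_of_entries_SL {p : SL(2, ℤ) → Prop} (B : ℤ)
    (h : ∀ g : SL(2, ℤ), p g → ∀ i j, |(g : Mat) i j| ≤ B) : {g | p g}.Finite :=
  Set.Finite.of_finite_image ((finite_of_entries_le B).subset
    (by rintro _ ⟨g, hg, rfl⟩; exact h g hg)) fun _ _ _ _ h => Subtype.ext h

/-- The entries of `gMg⁻¹` below and above the diagonal are values of a quadratic form at the rows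
of `g`. -/
theorem cj_entries (g : SL(2, ℤ)) (a b c d : ℤ) :
    cj g !![a, b; c, d] 1 0 = c * (g : Mat) 1 1 ^ 2 + (a - d) * (g : Mat) 1 0 * (g : Mat) 1 1 -
      b * (g : Mat) 1 0 ^ 2 ∧
    -cj g !![a, b; c, d] 0 1 = c * (g : Mat) 0 1 ^ 2 + (a - d) * (g : Mat) 0 0 * (g : Mat) 0 1 -
      b * (g : Mat) 0 0 ^ 2 := by
  obtain ⟨p, q, r, s, hp⟩ := exists_entries (g : Mat)
  rw [cj, Matrix.SpecialLinearGroup.coe_inv, hp, Matrix.adjugate_fin_two_of, Matrix.mul_fin_two,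
    Matrix.mul_fin_two]
  constructor
  · simp; ring
  · simp; ring

/-- Bounds for the arguments of a definite form with a given value. -/
theorem definite_bound {b c e r s v : ℤ} (hdisc : e ^ 2 + 4 * b * c < 0)
    (hv : c * s ^ 2 + e * r * s - b * r ^ 2 = v) :
    |r| ≤ 4 * |c * v| ∧ |s| ≤ 4 * |b * v| := by
  constructor
  · refine abs_le_of_sq_le ?_
    have h1 : 4 * (c * v) = (2 * c * s + e * r) ^ 2 - (e ^ 2 + 4 * b * c) * r ^ 2 := by
      rw [← hv]; ring
    have := le_abs_self (c * v)
    nlinarith [sq_nonneg (2 * c * s + e * r), sq_nonneg r]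
  · refine abs_le_of_sq_le ?_
    have h1 : 4 * (-(b * v)) = (2 * b * r - e * s) ^ 2 - (e ^ 2 + 4 * b * c) * s ^ 2 := by
      rw [← hv]; ring
    have := neg_le_abs (b * v)
    nlinarith [sq_nonneg (2 * b * r - e * s), sq_nonneg s]

theorem definite_pos {b c e r s : ℤ} (hdisc : e ^ 2 + 4 * b * c < 0) (hc : 0 < c)
    (hrs : r ≠ 0 ∨ s ≠ 0) : 0 < c * s ^ 2 + e * r * s - b * r ^ 2 := by
  have h1 : 4 * c * (c * s ^ 2 + e * r * s - b * r ^ 2) =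
    (2 * c * s + e * r) ^ 2 - (e ^ 2 + 4 * b * c) * r ^ 2 := by ring
  have h2 : 0 < (2 * c * s + e * r) ^ 2 - (e ^ 2 + 4 * b * c) * r ^ 2 := by
    by_cases hr : r = 0
    · have hs : s ≠ 0 := hrs.resolve_left (not_not.2 hr)
      subst hr
      have : 0 < (2 * c * s) ^ 2 := by positivity
      linarith
    · have : 0 < r ^ 2 := by positivity
      nlinarith [sq_nonneg (2 * c * s + e * r)]
  rw [← h1] at h2
  exact pos_of_mul_pos_right h2 (by linarith)

theorem row_ne_zero (g : SL(2, ℤ)) :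
    ((g : Mat) 1 0 ≠ 0 ∨ (g : Mat) 1 1 ≠ 0) ∧ ((g : Mat) 0 0 ≠ 0 ∨ (g : Mat) 0 1 ≠ 0) := by
  have hdet : (g : Mat).det = 1 := g.det_coe
  rw [Matrix.det_fin_two] at hdet
  constructor <;>
  · by_contra! h
    rw [h.1, h.2] at hdet
    simp at hdet

theorem disc_of_elliptic {a b c d : ℤ}
    (h : Matrix.trace !![a, b; c, d] ^ 2 < 4 * Matrix.det !![a, b; c, d]) :
    (a - d) ^ 2 + 4 * b * c < 0 := by
  rw [Matrix.det_fin_two_of, Matrix.trace_fin_two_of] at h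
  nlinarith

/-- The off-diagonal entries of `cj g M` are, up to sign, values of a definite form at the rows of
`g`; prescribing them bounds all entries of `g`. -/
theorem finite_fiber {M : Mat} (h : M.trace ^ 2 < 4 * M.det) (N : Mat) :
    {g : SL(2, ℤ) | cj g M = N}.Finite := by
  obtain ⟨a, b, c, d, rfl⟩ := exists_entries M
  have hd := disc_of_elliptic h
  refine finite_of_entries_SL (4 * |c * N 1 0| + 4 * |b * N 1 0| + 4 * |c * -N 0 1| +
    4 * |b * -N 0 1|) fun g hg => ?_
  obtain ⟨h1, h2⟩ := cj_entries g a b c d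
  rw [hg] at h1 h2
  obtain ⟨b1, b2⟩ := definite_bound hd h1.symm
  obtain ⟨b3, b4⟩ := definite_bound hd h2.symm
  have n1 := abs_nonneg (c * N 1 0)
  have n2 := abs_nonneg (b * N 1 0)
  have n3 := abs_nonneg (c * -N 0 1)
  have n4 := abs_nonneg (b * -N 0 1)
  intro i j
  have k : |(g : Mat) 0 0| ≤ _ ∧ |(g : Mat) 0 1| ≤ _ ∧ |(g : Mat) 1 0| ≤ _ ∧ |(g : Mat) 1 1| ≤ _ :=
    ⟨b3, b4, b1, b2⟩
  fin_cases i <;> fin_cases j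
  · exact k.1.trans (by linarith)
  · exact k.2.1.trans (by linarith)
  · exact k.2.2.1.trans (by linarith)
  · exact k.2.2.2.trans (by linarith)

theorem finite_preimage {M : Mat} (h : M.trace ^ 2 < 4 * M.det) {F : Set Mat} (hF : F.Finite) :
    {g : SL(2, ℤ) | cj g M ∈ F}.Finite := by
  have : {g : SL(2, ℤ) | cj g M ∈ F} = ⋃ N ∈ F, {g : SL(2, ℤ) | cj g M = N} := by
    ext g; simp
  rw [this]
  exact hF.biUnion fun N _ => finite_fiber h N

theorem sum_group_S {f : SL(2, ℤ) → ℚ} (h : ∀ g, f (ModularGroup.S * g) = -f g) :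
    ∑ᶠ g, f g = 0 := by
  have h1 := finsum_comp_equiv (Equiv.mulLeft (ModularGroup.S : SL(2, ℤ))) (f := f)
  simp only [Equiv.coe_mulLeft] at h1
  rw [finsum_congr h, finsum_neg_distrib] at h1
  linarith

theorem sum_group_U {f : SL(2, ℤ) → ℚ} (hf : (Function.support f).Finite)
    (h : ∀ g, f g + f (U * g) + f (U * (U * g)) = 0) : ∑ᶠ g, f g = 0 := by
  have h1 := finsum_comp_equiv (Equiv.mulLeft (U : SL(2, ℤ))) (f := f)
  have h2 := finsum_comp_equiv (Equiv.mulLeft (U : SL(2, ℤ))) (f := fun g => f (U * g))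
  have f1 : (Function.support fun g => f (U * g)).Finite :=
    hf.preimage (mul_right_injective U).injOn
  have f2 : (Function.support fun g => f (U * (U * g))).Finite :=
    f1.preimage (mul_right_injective U).injOn
  have h3 : ∑ᶠ g, (f g + f (U * g) + f (U * (U * g))) = 0 := by
    rw [finsum_congr h]; simp
  rw [finsum_add_distrib ((hf.union f1).subset (Function.support_add _ _)) f2,
    finsum_add_distrib hf f1] at h3
  simp only [Equiv.coe_mulLeft] at h1 h2
  linarith

/-- The part of `chi` which is averaged out by `U`. -/
def lq (N : Mat) : ℚ := lead |N 1 0| |N 0 1| |N 1 0 + N 1 1 - N 0 0 - N 0 1|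

theorem chi_eq (N : Mat) : chi N = lq N - 1 + pv N := by
  rw [chi, lq, pv]; ring

theorem lq_cj_U_sum (N : Mat) : lq N + lq (cj U N) + lq (cj U (cj U N)) = 1 := by
  obtain ⟨a, b, c, d, rfl⟩ := exists_entries N
  have e : ∀ a b c d : ℤ, lq !![a, b; c, d] = lead |c| |b| |c + d - a - b| := fun _ _ _ _ => rfl
  rw [cj_U_mk, cj_U_mk, e, e, e]
  have e1 : -b + (a + b) - (d - b) - (a - c + b - d) = c := by ring
  have e2 : d - b - -b + (a - c + b - d) - (a + b) = -c := by ring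
  have e3 : -(a - c + b - d) + (d - b + (a - c + b - d)) - (a + b - (a - c + b - d)) - -c = -b := by ring
  have e4 : |a - c + b - d| = |c + d - a - b| := by rw [← abs_neg]; congr 1; ring
  rw [e1, e2, e3, abs_neg, abs_neg, abs_neg, e4]
  have h1 := lead_cyc |c| |b| |c + d - a - b|
  rw [lead_comm |b| |c + d - a - b| |c|]  at h1
  linarith [lead_comm |b| |c + d - a - b| |c|, lead_comm |c| |c + d - a - b| |b|]

/-- Two definite forms whose cross term on a basis has opposite signs have bounded diagonals. -/
theorem joint_bound {x y m x' y' m' J : ℤ} (hx : 0 < x) (hy : 0 < y) (hx' : 0 < x') (hy' : 0 < y')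
    (hJ : 2 * (x * y' + x' * y) - m * m' = J) (hm : m * m' ≤ 0) : x' ≤ J ∧ y' ≤ J := by
  have h1 : y' ≤ x * y' := le_mul_of_one_le_left hy'.le hx
  have h2 : x' ≤ x' * y := le_mul_of_one_le_right hx'.le hy
  have h3 : 0 < x * y' := mul_pos hx hy'
  have h4 : 0 < x' * y := mul_pos hx' hy
  constructor <;> linarith

theorem sign_agree {m m' : ℤ} (h : 0 < m * m') : (0 < m ↔ 0 < m') ∧ (m < 0 ↔ m' < 0) := by
  rcases mul_pos_iff.1 h with ⟨h1, h2⟩ | ⟨h1, h2⟩ <;> omega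

theorem sign_eq_of_agree {m m' : ℤ} (h : 0 < m * m') : m.sign = m'.sign := by
  rcases mul_pos_iff.1 h with ⟨h1, h2⟩ | ⟨h1, h2⟩
  · rw [Int.sign_eq_one_of_pos h1, Int.sign_eq_one_of_pos h2]
  · rw [Int.sign_eq_neg_one_of_neg h1, Int.sign_eq_neg_one_of_neg h2]

/-- Two matrices with positive definite fixed forms which are jointly large have the same `lq`
and `pv`. -/
theorem lq_pv_eq {a b c d a' b' c' d' J : ℤ} (hd : (a - d) ^ 2 + 4 * b * c < 0)
    (hd' : (a' - d') ^ 2 + 4 * b' * c' < 0) (hc : 0 < c) (hb : b < 0) (hc' : 0 < c') (hb' : b' < 0)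
    (hJ : -2 * (c * b' + c' * b) - (a - d) * (a' - d') = J)
    (hbig : 4 * J < c' ∨ 4 * J < -b') :
    lq !![a, b; c, d] = lq !![a', b'; c', d'] ∧ pv !![a, b; c, d] = pv !![a', b'; c', d'] := by
  obtain ⟨z, hz⟩ : ∃ z, z = c + d - a - b := ⟨_, rfl⟩
  obtain ⟨z', hz'⟩ : ∃ z', z' = c' + d' - a' - b' := ⟨_, rfl⟩
  have ry : 0 < -b * (2 * c + 2 * z + b) := by
    have : -b * (2 * c + 2 * z + b) = (z - c) ^ 2 - ((a - d) ^ 2 + 4 * b * c) := by rw [hz]; ring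
    nlinarith [sq_nonneg (z - c)]
  have ry' : 0 < -b' * (2 * c' + 2 * z' + b') := by
    have : -b' * (2 * c' + 2 * z' + b') = (z' - c') ^ 2 - ((a' - d') ^ 2 + 4 * b' * c') := by
      rw [hz']; ring
    nlinarith [sq_nonneg (z' - c')]
  have rx : 0 < c * (2 * -b + 2 * z - c) := by
    have : c * (2 * -b + 2 * z - c) = (z + b) ^ 2 - ((a - d) ^ 2 + 4 * b * c) := by rw [hz]; ring
    nlinarith [sq_nonneg (z + b)]
  have rx' : 0 < c' * (2 * -b' + 2 * z' - c') := by
    have : c' * (2 * -b' + 2 * z' - c') = (z' + b') ^ 2 - ((a' - d') ^ 2 + 4 * b' * c') := by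
      rw [hz']; ring
    nlinarith [sq_nonneg (z' + b')]
  have py := pos_of_mul_pos_right ry (by omega)
  have py' := pos_of_mul_pos_right ry' (by omega)
  have px := pos_of_mul_pos_right rx (by omega)
  have px' := pos_of_mul_pos_right rx' (by omega)
  have hz0 : 0 < z := by
    have : z * (2 * c - 2 * b - z) = (-b - c) ^ 2 - ((a - d) ^ 2 + 4 * b * c) := by rw [hz]; ring
    by_contra! h
    nlinarith [sq_nonneg (-b - c), mul_nonneg (neg_nonneg.2 h) (show 0 ≤ 2 * c - 2 * b - z by omega)]
  have hz0' : 0 < z' := by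
    have : z' * (2 * c' - 2 * b' - z') = (-b' - c') ^ 2 - ((a' - d') ^ 2 + 4 * b' * c') := by
      rw [hz']; ring
    by_contra! h
    nlinarith [sq_nonneg (-b' - c'),
      mul_nonneg (neg_nonneg.2 h) (show 0 ≤ 2 * c' - 2 * b' - z' by omega)]
  have k1 : 0 < (c + -b - z) * (c' + -b' - z') := by
    by_contra! h
    obtain ⟨h1, h2⟩ := joint_bound (x := c) (y := -b) (x' := c') (y' := -b') (J := J) hc (by omega)
      hc' (by omega) (by rw [← hJ, hz, hz']; ring) h
    omega
  -- Here and in `k3` the basis consists of a sum and a difference of basis vectors. It spans a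
  -- sublattice of index 2, so the polarized discriminant `J` is multiplied by 4.
  have k2 : 0 < (z - c) * (z' - c') := by
    by_contra! h
    obtain ⟨h1, h2⟩ := joint_bound (x := -b) (y := 2 * c + 2 * z + b) (x' := -b')
      (y' := 2 * c' + 2 * z' + b') (m := 2 * (z - c)) (m' := 2 * (z' - c')) (J := 4 * J) (by omega)
      py (by omega) py' (by rw [← hJ, hz, hz']; ring) (by linarith)
    omega
  have k3 : 0 < (z - -b) * (z' - -b') := by
    by_contra! h
    obtain ⟨h1, h2⟩ := joint_bound (x := c) (y := 2 * -b + 2 * z - c) (x' := c')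
      (y' := 2 * -b' + 2 * z' - c') (m := 2 * (z - -b)) (m' := 2 * (z' - -b')) (J := 4 * J) hc
      px hc' px' (by rw [← hJ, hz, hz']; ring) (by linarith)
    omega
  constructor
  · change lead |c| |b| |c + d - a - b| = lead |c'| |b'| |c' + d' - a' - b'|
    rw [← hz, ← hz', abs_of_pos hc, abs_of_pos hc', abs_of_neg hb, abs_of_neg hb', abs_of_pos hz0,
      abs_of_pos hz0']
    have g2 := sign_agree k2
    have g3 := sign_agree k3
    apply lead_congr <;> omega
  · rw [pv, pv, sv_mk, sv_mk, Int.sign_eq_one_of_pos hc, Int.sign_eq_one_of_pos hc',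
      Int.sign_eq_neg_one_of_neg hb, Int.sign_eq_neg_one_of_neg hb',
      show a - d = c + -b - z by rw [hz]; ring, show a' - d' = c' + -b' - z' by rw [hz']; ring,
      sign_eq_of_agree k1]

theorem cj_fixed_pos {a b c d : ℤ} (hd : (a - d) ^ 2 + 4 * b * c < 0) (hc : 0 < c)
    (g : SL(2, ℤ)) :
    0 < cj g !![a, b; c, d] 1 0 ∧ cj g !![a, b; c, d] 0 1 < 0 := by
  obtain ⟨h1, h2⟩ := cj_entries g a b c d
  obtain ⟨r1, r2⟩ := row_ne_zero g
  have p1 := definite_pos hd hc r1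
  have p2 := definite_pos hd hc r2
  rw [← h1] at p1
  rw [← h2] at p2
  exact ⟨p1, by linarith⟩

theorem trace_cj_mul (g : SL(2, ℤ)) (A B : Mat) : (cj g A * cj g B).trace = (A * B).trace := by
  have : cj g A * cj g B = cj g (A * B) := by
    simp only [cj, mul_assoc]
    rw [← mul_assoc _ (g : Mat), coe_inv_mul, one_mul]
  rw [this, trace_cj]

/-- The constant `J` is unchanged when `M` and `S` are conjugated simultaneously. The off-diagonal
entries of `cj g S` are, up to sign, the squared lengths of the rows of `g`, so `lq_pv_eq` applies
for all but finitely many `g`. -/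
theorem finite_lq_pv_ne {M : Mat} (h : M.trace ^ 2 < 4 * M.det) (hc : 0 < M 1 0) :
    {g : SL(2, ℤ) | ¬(lq (cj g M) = lq (cj g (ModularGroup.S : SL(2, ℤ))) ∧
      pv (cj g M) = pv (cj g (ModularGroup.S : SL(2, ℤ))))}.Finite := by
  set J := -2 * (M * ((ModularGroup.S : SL(2, ℤ)) : Mat)).trace with hJ
  refine finite_of_entries_SL (4 * J) fun g hg => ?_
  obtain ⟨a, b, c, d, rfl⟩ := exists_entries M
  have hd := disc_of_elliptic h
  have dS : ((0 : ℤ) - 0) ^ 2 + 4 * -1 * 1 < 0 := by norm_num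
  obtain ⟨p1, p2⟩ := cj_fixed_pos hd hc g
  obtain ⟨s1, s2⟩ := cj_fixed_pos dS one_pos g
  obtain ⟨v1, v2⟩ := cj_entries g 0 (-1) 1 0
  have ht := trace_cj_mul g !![a, b; c, d] ((ModularGroup.S : SL(2, ℤ)) : Mat)
  have dM : (cj g !![a, b; c, d]).trace ^ 2 < 4 * (cj g !![a, b; c, d]).det := by
    rw [trace_cj, det_cj]; exact h
  have dS' : (cj g !![0, -1; 1, 0]).trace ^ 2 < 4 * (cj g !![0, -1; 1, 0]).det := by
    rw [trace_cj, det_cj, Matrix.trace_fin_two_of, Matrix.det_fin_two_of]; norm_num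
  have tS : (cj g !![0, -1; 1, 0]).trace = 0 := by
    rw [trace_cj, Matrix.trace_fin_two_of]; norm_num
  rw [coe_S] at ht hg hJ
  obtain ⟨a₁, b₁, c₁, d₁, e₁⟩ := exists_entries (cj g !![a, b; c, d])
  obtain ⟨a₂, b₂, c₂, d₂, e₂⟩ := exists_entries (cj g !![0, -1; 1, 0])
  rw [e₁] at p1 p2 dM
  rw [e₂] at s1 s2 dS' tS v1 v2
  rw [e₁, e₂] at ht
  simp only [e₁, e₂] at hg
  have hbig : ¬(4 * J < c₂ ∨ 4 * J < -b₂) := by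
    intro hbig
    refine hg (lq_pv_eq (disc_of_elliptic dM) (disc_of_elliptic dS') p1 p2 s1 s2 ?_ hbig)
    rw [hJ, ← ht, Matrix.mul_fin_two, Matrix.trace_fin_two_of]
    rw [Matrix.trace_fin_two_of] at tS
    have : a₂ = -d₂ := by linarith
    rw [this]
    ring
  push Not at hbig
  have v1' : c₂ = (g : Mat) 1 1 ^ 2 + (g : Mat) 1 0 ^ 2 := by
    have : c₂ = _ := v1
    rw [this]; ring
  have v2' : -b₂ = (g : Mat) 0 1 ^ 2 + (g : Mat) 0 0 ^ 2 := by
    have : -b₂ = _ := v2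
    rw [this]; ring
  have q1 := sq_nonneg ((g : Mat) 1 1)
  have q2 := sq_nonneg ((g : Mat) 1 0)
  have q3 := sq_nonneg ((g : Mat) 0 1)
  have q4 := sq_nonneg ((g : Mat) 0 0)
  intro i j
  apply abs_le_of_sq_le
  have k : (g : Mat) 0 0 ^ 2 ≤ 4 * J ∧ (g : Mat) 0 1 ^ 2 ≤ 4 * J ∧ (g : Mat) 1 0 ^ 2 ≤ 4 * J ∧
      (g : Mat) 1 1 ^ 2 ≤ 4 * J := by
    refine ⟨?_, ?_, ?_, ?_⟩ <;> linarith
  fin_cases i <;> fin_cases j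
  exacts [k.1, k.2.1, k.2.2.1, k.2.2.2]

theorem ne_neg_SL (g : SL(2, ℤ)) : g ≠ -g := by
  intro h
  have e : ∀ i j, (g : Mat) i j = 0 := fun i j => by
    have : (g : Mat) i j = -(g : Mat) i j := congrArg (fun x : SL(2, ℤ) => (x : Mat) i j) h
    omega
  rcases (row_ne_zero g).1 with h | h <;> exact h (e _ _)

/-- `chi` along the class of `S` is concentrated on `±S`. -/
theorem chi_of_disc_neg_four {a b c : ℤ} (hdet : -(a * a) - b * c = 1) (hc : 0 < c) (hb : b < 0) :
    chi !![a, b; c, -a] = if a = 0 ∧ b = -1 ∧ c = 1 then 1 / 2 else 0 := by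
  have hz : 0 < c + -a - a - b := by
    have : (c - 2 * a - b) * (c - b) * 2 = (c - b - a) ^ 2 + (c + b) ^ 2 + 3 * a ^ 2 + 4 * (-(a * a) - b * c)
      - 2 * a * (c - b) := by ring
    nlinarith [sq_nonneg (c - b - 2 * a), sq_nonneg (c + b)]
  rw [chi_mk, sv_mk, Int.sign_eq_one_of_pos hc, Int.sign_eq_neg_one_of_neg hb, abs_of_pos hc,
    abs_of_neg hb, abs_of_pos hz]
  rcases lt_trichotomy a 0 with ha | ha | ha
  · rw [if_neg (by omega), lead_eq_one (by omega) (by omega),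
      Int.sign_eq_neg_one_of_neg (by omega)]
    norm_num
  · subst ha
    have h1 : c = 1 := Int.eq_one_of_mul_eq_one_right (b := -b) hc.le (by linarith)
    subst h1
    have h2 : b = -1 := by linarith
    subst h2
    norm_num [lead]
  · rw [if_neg (by omega), lead_eq_zero, Int.sign_eq_one_of_pos (by omega)]
    · norm_num
    · by_contra! h
      nlinarith [mul_nonneg (sub_nonneg.2 h.1) (sub_nonneg.2 h.2)]

theorem mk_eq_mk_iff {a b c d a' b' c' d' : ℤ} :
    !![a, b; c, d] = !![a', b'; c', d'] ↔ a = a' ∧ b = b' ∧ c = c' ∧ d = d' := by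
  constructor
  · intro h
    exact ⟨congrFun (congrFun h 0) 0, congrFun (congrFun h 0) 1, congrFun (congrFun h 1) 0,
      congrFun (congrFun h 1) 1⟩
  · rintro ⟨rfl, rfl, rfl, rfl⟩; rfl

theorem cj_S_eq_S_iff (g : SL(2, ℤ)) :
    cj g (ModularGroup.S : SL(2, ℤ)) = ((ModularGroup.S : SL(2, ℤ)) : Mat) ↔
      g ∈ ({1, -1, ModularGroup.S, -ModularGroup.S} : Finset SL(2, ℤ)) := by
  simp only [Finset.mem_insert, Finset.mem_singleton]
  constructor
  · intro h
    rw [cj_eq_iff] at h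
    have hdet := g.det_coe
    obtain ⟨p, q, r, s, hp⟩ := exists_entries (g : Mat)
    rw [hp, coe_S, Matrix.mul_fin_two, Matrix.mul_fin_two] at h
    have h1 := congrFun (congrFun h 0) 0
    have h2 := congrFun (congrFun h 0) 1
    simp at h1 h2
    obtain rfl : r = -q := by linarith
    have hsp : s = p := by linarith
    subst s
    rw [hp, Matrix.det_fin_two_of] at hdet
    have hp1 : p ^ 2 ≤ 1 := by nlinarith [sq_nonneg q]
    have hq1 : q ^ 2 ≤ 1 := by nlinarith [sq_nonneg p]
    have hp2 := abs_le.1 ((sq_le_one_iff_abs_le_one p).1 hp1)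
    have hq2 := abs_le.1 ((sq_le_one_iff_abs_le_one q).1 hq1)
    have e : ∀ x : SL(2, ℤ), g = x ↔ (g : Mat) = (x : Mat) := fun x => Subtype.ext_iff
    simp only [e, Matrix.SpecialLinearGroup.coe_neg, Matrix.SpecialLinearGroup.coe_one, hp, coe_S,
      neg_fin_two, Matrix.one_fin_two, mk_eq_mk_iff]
    obtain ⟨a1, a2⟩ := hp2
    obtain ⟨b1, b2⟩ := hq2
    interval_cases p <;> interval_cases q <;> omega
  · have hn : ∀ (x : SL(2, ℤ)) (N : Mat), cj (-x) N = cj x N := fun x N => by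
      rw [← neg_one_mul, cj_mul, cj_neg_one]
    have h1 : cj ModularGroup.S (ModularGroup.S : SL(2, ℤ)) =
        ((ModularGroup.S : SL(2, ℤ)) : Mat) := by
      rw [coe_S, cj_S_mk]; norm_num
    rintro (rfl | rfl | rfl | rfl)
    · exact cj_one _
    · exact cj_neg_one _
    · exact h1
    · rw [hn, h1]

theorem chi_cj_S (g : SL(2, ℤ)) :
    chi (cj g (ModularGroup.S : SL(2, ℤ))) =
      if g ∈ ({1, -1, ModularGroup.S, -ModularGroup.S} : Finset SL(2, ℤ)) then 1 / 2 else 0 := by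
  simp only [← cj_S_eq_S_iff]
  have hdet := det_cj g (ModularGroup.S : SL(2, ℤ))
  have htr := trace_cj g (ModularGroup.S : SL(2, ℤ))
  have hpos : 0 < cj g (ModularGroup.S : SL(2, ℤ)) 1 0 ∧
      cj g (ModularGroup.S : SL(2, ℤ)) 0 1 < 0 := by
    rw [coe_S]; exact cj_fixed_pos (by norm_num) one_pos g
  obtain ⟨a, b, c, d, e⟩ := exists_entries (cj g (ModularGroup.S : SL(2, ℤ)))
  rw [e, coe_S, Matrix.det_fin_two_of, Matrix.det_fin_two_of] at hdet
  rw [e, coe_S, Matrix.trace_fin_two_of, Matrix.trace_fin_two_of] at htr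
  rw [e] at hpos
  obtain rfl : d = -a := by linarith
  have hc : 0 < c := hpos.1
  have hb : b < 0 := hpos.2
  rw [e, chi_of_disc_neg_four (by linarith) hc hb]
  congr 1
  rw [coe_S]
  apply propext
  constructor
  · rintro ⟨rfl, rfl, rfl⟩; simp
  · intro h
    exact ⟨congrFun (congrFun h 0) 0, congrFun (congrFun h 0) 1, congrFun (congrFun h 1) 0⟩

theorem sum_chi_cj_S : (Function.support fun g : SL(2, ℤ) =>
      chi (cj g (ModularGroup.S : SL(2, ℤ)))).Finite ∧
    ∑ᶠ g : SL(2, ℤ), chi (cj g (ModularGroup.S : SL(2, ℤ))) = 2 := by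
  have hs : (Function.support fun g : SL(2, ℤ) => chi (cj g (ModularGroup.S : SL(2, ℤ)))) ⊆
      (({1, -1, ModularGroup.S, -ModularGroup.S} : Finset SL(2, ℤ)) : Set SL(2, ℤ)) := by
    intro g hg
    by_contra h
    apply hg
    change chi _ = 0
    rw [chi_cj_S, if_neg fun hh => h (Finset.mem_coe.2 hh)]
  refine ⟨(Finset.finite_toSet _).subset hs, ?_⟩
  rw [finsum_eq_sum_of_support_subset _ hs, Finset.sum_congr rfl fun g hg =>
    (chi_cj_S g).trans (if_pos hg), Finset.sum_const]
  have hc : ({1, -1, ModularGroup.S, -ModularGroup.S} : Finset SL(2, ℤ)).card = 4 := by decide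
  rw [hc]; norm_num

/-- Compared with `S`, the change of `lq` has finite support and is averaged out by `U`, and that of
`pv` by `S`. So the total agrees with the one for `S`, where four group elements contribute `1 / 2`
each. -/
theorem sum_chi_cj {M : Mat} (h : M.trace ^ 2 < 4 * M.det) (hc : 0 < M 1 0) :
    (Function.support fun g : SL(2, ℤ) => chi (cj g M)).Finite ∧
    ∑ᶠ g : SL(2, ℤ), chi (cj g M) = 2 := by
  have hne := finite_lq_pv_ne h hc
  set Sm : Mat := ((ModularGroup.S : SL(2, ℤ)) : Mat) with hSm
  have f1 : (Function.support fun g : SL(2, ℤ) => lq (cj g M) - lq (cj g Sm)).Finite :=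
    hne.subset fun g hg h => hg (sub_eq_zero.2 h.1)
  have f2 : (Function.support fun g : SL(2, ℤ) => pv (cj g M) - pv (cj g Sm)).Finite :=
    hne.subset fun g hg h => hg (sub_eq_zero.2 h.2)
  have s1 : ∑ᶠ g : SL(2, ℤ), (lq (cj g M) - lq (cj g Sm)) = 0 := by
    refine sum_group_U f1 fun g => ?_
    simp only [cj_mul]
    linarith [lq_cj_U_sum (cj g M), lq_cj_U_sum (cj g Sm)]
  have s2 : ∑ᶠ g : SL(2, ℤ), (pv (cj g M) - pv (cj g Sm)) = 0 := by
    refine sum_group_S fun g => ?_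
    simp only [cj_mul, pv_cj_S]
    ring
  obtain ⟨f3, s3⟩ := sum_chi_cj_S
  have e : (fun g : SL(2, ℤ) => chi (cj g M)) = fun g => (lq (cj g M) - lq (cj g Sm)) +
      (pv (cj g M) - pv (cj g Sm)) + chi (cj g Sm) := by
    funext g; rw [chi_eq, chi_eq]; ring
  have f12 := (f1.union f2).subset (Function.support_add
    (fun g : SL(2, ℤ) => lq (cj g M) - lq (cj g Sm)) fun g => pv (cj g M) - pv (cj g Sm))
  rw [e]
  refine ⟨(f12.union f3).subset (Function.support_add _ _), ?_⟩
  rw [finsum_add_distrib f12 f3, finsum_add_distrib f1 f2, s1, s2, s3]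
  norm_num

/-- Split `wt` as `(qv - 1 + lq) - (hv - pv) - chi`. All three pieces have finite support on the
group; the first is killed by `U`, the second by `S`, and the last has total 2. -/
theorem sum_wt_cj {n : ℕ} (hn : 0 < n) {M : Mat} (hdet : M.det = n)
    (h : M.trace ^ 2 < 4 * M.det) (hc : 0 < M 1 0) :
    ∑ᶠ g : SL(2, ℤ), wt (cj g M) = -2 := by
  have hn' : (0 : ℤ) < n := by exact_mod_cast hn
  obtain ⟨f1, s1⟩ := sum_chi_cj h hc
  have f2 : (Function.support fun g : SL(2, ℤ) => hv (cj g M) - pv (cj g M)).Finite :=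
    (finite_preimage h (finite_hv_elliptic n hn' _ (hdet ▸ h))).subset fun g hg =>
      ⟨(det_cj g M).trans hdet, congrArg (· ^ 2) (trace_cj g M), fun e => hg (sub_eq_zero.2 e)⟩
  have f3 : (Function.support fun g : SL(2, ℤ) => qv (cj g M) - 1 + lq (cj g M)).Finite :=
    (finite_preimage h (finite_qv_elliptic n hn' _ (hdet ▸ h))).subset fun g hg =>
      ⟨(det_cj g M).trans hdet, congrArg (· ^ 2) (trace_cj g M), fun e => hg (by
        change qv _ - 1 + lq _ = 0
        rw [e, chi_eq]; ring)⟩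
  have s2 : ∑ᶠ g : SL(2, ℤ), (hv (cj g M) - pv (cj g M)) = 0 := by
    refine sum_group_S fun g => ?_
    simp only [cj_mul, pv_cj_S, hv_cj_S]
    ring
  have s3 : ∑ᶠ g : SL(2, ℤ), (qv (cj g M) - 1 + lq (cj g M)) = 0 := by
    refine sum_group_U f3 fun g => ?_
    simp only [cj_mul]
    linarith [lq_cj_U_sum (cj g M), qv_cj_U_sum (cj g M)]
  have e : (fun g : SL(2, ℤ) => wt (cj g M)) = fun g => (qv (cj g M) - 1 + lq (cj g M)) -
      (hv (cj g M) - pv (cj g M)) - chi (cj g M) := by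
    funext g; rw [chi_eq, wt]; ring
  have f23 := (f3.union f2).subset (Function.support_sub
    (fun g : SL(2, ℤ) => qv (cj g M) - 1 + lq (cj g M)) fun g => hv (cj g M) - pv (cj g M))
  rw [e, finsum_sub_distrib f23 f1, finsum_sub_distrib f3 f2, s1, s2, s3]
  norm_num

theorem ncard_eq_two_mul_stab {M : Mat} (hfin : {g : SL(2, ℤ) | cj g M = M ∨ cj g M = -M}.Finite) :
    {g : SL(2, ℤ) | cj g M = M ∨ cj g M = -M}.ncard = 2 * Nat.card (stab M) := by
  classical
  have himg : stab M = (hfin.toFinset.image barSL : Finset BarMat) := by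
    ext γ
    simp only [Finset.coe_image, Set.Finite.coe_toFinset]
    constructor
    · rintro ⟨g, rfl, hg⟩
      exact ⟨g, barSL_mem_stab_iff.1 ⟨g, rfl, hg⟩, rfl⟩
    · rintro ⟨g, hg, rfl⟩
      exact barSL_mem_stab_iff.2 hg
  rw [Nat.card_coe_set_eq, himg, Set.ncard_coe_finset, Set.ncard_eq_toFinset_card _ hfin,
    Finset.card_eq_sum_card_image barSL, mul_comm]
  apply Finset.sum_const_nat
  intro γ hγ
  obtain ⟨g, hg, rfl⟩ := Finset.mem_image.1 hγ
  have : (hfin.toFinset.filter fun x => barSL x = barSL g) = {g, -g} := by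
    ext x
    simp only [Finset.mem_filter, Set.Finite.mem_toFinset, Finset.mem_insert, Finset.mem_singleton,
      barSL_eq_iff]
    refine ⟨fun h => h.2, fun h => ⟨?_, h⟩⟩
    rw [Set.Finite.mem_toFinset] at hg
    rcases h with rfl | rfl
    · exact hg
    · change cj (-g) M = M ∨ cj (-g) M = -M
      rw [← neg_one_mul, cj_mul, cj_neg_one]; exact hg
  rw [this, Finset.card_pair (ne_neg_SL g)]

theorem ncard_fibers {M N : Mat} (h : M.trace ^ 2 < 4 * M.det) (hM : M ≠ -M)
    (hN : N ∈ classSet M) :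
    {g : SL(2, ℤ) | cj g M = N}.ncard + {g : SL(2, ℤ) | cj g M = -N}.ncard =
      2 * Nat.card (stab M) := by
  have key : ∀ g₀ : SL(2, ℤ), ∀ A : Mat, {g : SL(2, ℤ) | cj g M = cj g₀ A}.ncard =
      {g : SL(2, ℤ) | cj g M = A}.ncard := fun g₀ A => by
    have : {g : SL(2, ℤ) | cj g M = cj g₀ A} = (g₀ * ·) '' {g : SL(2, ℤ) | cj g M = A} := by
      ext g
      constructor
      · intro hg
        refine ⟨g₀⁻¹ * g, ?_, mul_inv_cancel_left _ _⟩
        change cj _ _ = _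
        rw [cj_mul, show cj g M = _ from hg, cj_inv_cj]
      · rintro ⟨x, hx, rfl⟩
        change cj (g₀ * x) M = _
        rw [cj_mul, show cj x M = _ from hx]
    rw [this, Set.ncard_image_of_injective _ (mul_right_injective g₀)]
  have h0 : {g : SL(2, ℤ) | cj g M = M}.ncard + {g : SL(2, ℤ) | cj g M = -M}.ncard =
      2 * Nat.card (stab M) := by
    rw [← ncard_eq_two_mul_stab ((finite_fiber h M).union (finite_fiber h (-M))),
      ← Set.ncard_union_eq _ (finite_fiber h M) (finite_fiber h (-M))]
    · rfl
    · rw [Set.disjoint_left]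
      intro g hg hg'
      exact hM (hg.symm.trans hg')
  obtain ⟨g₀, rfl | rfl⟩ := conjClass_eq_iff.1 hN
  · rw [← cj_neg, key, key, h0]
  · rw [neg_neg, ← cj_neg, key, key, add_comm, h0]

/-- The fibers over `N` and `-N` together have `2 * Nat.card (stab M)` elements. As `f` is even,
each fiber may be replaced by the average of the two. -/
theorem sum_group_eq_stab_mul {M : Mat} (h : M.trace ^ 2 < 4 * M.det) (hM : M ≠ -M) {f : Mat → ℚ}
    (hf : (classSet M ∩ Function.support f).Finite) (heven : ∀ N, f (-N) = f N) :
    ∑ᶠ g : SL(2, ℤ), f (cj g M) = Nat.card (stab M) * ∑ᶠ N ∈ classSet M, f N := by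
  classical
  have hA := finite_preimage h hf
  have hmem : ∀ g : SL(2, ℤ), cj g M ∈ classSet M := fun g => conjClass_cj g M
  have e1 : ∑ᶠ g : SL(2, ℤ), f (cj g M) = ∑ g ∈ hA.toFinset, f (cj g M) :=
    finsum_eq_sum_of_support_subset _ fun g hg => by
      simpa using (⟨hmem g, hg⟩ : cj g M ∈ classSet M ∩ Function.support f)
  have e2 : ∑ᶠ N ∈ classSet M, f N = ∑ N ∈ hf.toFinset, f N := by
    rw [← finsum_mem_inter_support, finsum_mem_eq_finite_toFinset_sum _ hf]
  have e3 : ∑ g ∈ hA.toFinset, f (cj g M) =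
      ∑ N ∈ hf.toFinset, ({g : SL(2, ℤ) | cj g M = N}.ncard : ℚ) * f N := by
    rw [← Finset.sum_fiberwise_of_maps_to (g := fun g => cj g M) (t := hf.toFinset)
      (fun g hg => by simpa using hg)]
    refine Finset.sum_congr rfl fun N hN => ?_
    rw [Finset.sum_congr rfl fun g hg => congrArg f (Finset.mem_filter.1 hg).2, Finset.sum_const,
      nsmul_eq_mul]
    congr 2
    rw [Set.ncard_eq_toFinset_card _ (finite_fiber h N)]
    congr 1
    ext g
    simp only [Finset.mem_filter, Set.Finite.mem_toFinset]
    refine ⟨fun h => h.2, fun hg => ⟨?_, hg⟩⟩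
    have hg' : cj g M = N := hg
    change cj g M ∈ classSet M ∩ Function.support f
    rw [hg']
    exact hf.mem_toFinset.1 hN
  have e4 : ∑ N ∈ hf.toFinset, ({g : SL(2, ℤ) | cj g M = N}.ncard : ℚ) * f N =
      ∑ N ∈ hf.toFinset, ({g : SL(2, ℤ) | cj g M = -N}.ncard : ℚ) * f N := by
    refine Finset.sum_nbij' (fun N => -N) (fun N => -N) ?_ ?_ (fun _ _ => neg_neg _)
      (fun _ _ => neg_neg _) fun N _ => by rw [neg_neg, heven]
    all_goals
      intro N hN
      rw [Set.Finite.mem_toFinset] at hN ⊢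
      exact ⟨neg_mem_classSet hN.1, by rw [Function.mem_support, heven]; exact hN.2⟩
  have e5 : 2 * ∑ N ∈ hf.toFinset, ({g : SL(2, ℤ) | cj g M = N}.ncard : ℚ) * f N =
      2 * (Nat.card (stab M) * ∑ N ∈ hf.toFinset, f N) := by
    rw [two_mul]
    nth_rewrite 2 [e4]
    rw [← Finset.sum_add_distrib, Finset.mul_sum, Finset.mul_sum]
    refine Finset.sum_congr rfl fun N hN => ?_
    have := ncard_fibers h hM ((Set.Finite.mem_toFinset hf).1 hN).1
    rw [← add_mul, ← Nat.cast_add, this]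
    push_cast
    ring
  rw [e1, e2, e3]
  linarith

theorem finite_classSet_inter_wt {n : ℕ} (hn : 0 < n) {M : Mat} (hdet : M.det = n) :
    (classSet M ∩ Function.support wt).Finite :=
  (finite_wt_ne_zero hn).subset fun _ hN => ⟨(det_of_mem_classSet hN.1).trans hdet, hN.2⟩

theorem sum_wt_of_elliptic {n : ℕ} (hn : 0 < n) {M : Mat} (hdet : M.det = n)
    (h : M.trace ^ 2 < 4 * M.det) :
    Nat.card (stab M) * ∑ᶠ N ∈ classSet M, wt N = -2 := by
  have hc : M 1 0 ≠ 0 := by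
    obtain ⟨a, b, c, d, rfl⟩ := exists_entries M
    have := disc_of_elliptic h
    rintro h0
    obtain rfl : c = 0 := h0
    nlinarith [sq_nonneg (a - d)]
  have hM : M ≠ -M := fun e => hc (by
    have : M 1 0 = -M 1 0 := congrFun (congrFun e 1) 0
    omega)
  rw [← sum_group_eq_stab_mul h hM (finite_classSet_inter_wt hn hdet) wt_neg]
  rcases hc.lt_or_gt with hc | hc
  · rw [finsum_congr fun g => (by rw [cj_neg, wt_neg] : wt (cj g M) = wt (cj g (-M)))]
    refine sum_wt_cj hn (M := -M) ?_ ?_ ?_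
    · rw [Matrix.det_neg, hdet]; simp
    · rw [Matrix.det_neg, Matrix.trace_neg, neg_sq]; simpa using h
    · change 0 < -M 1 0; omega
  · exact sum_wt_cj hn hdet h hc

/-! ### The area of the standard fundamental domain -/

open MeasureTheory in
theorem lintegral_inv_sq_Ici {r : ℝ} (hr : 0 < r) :
    ∫⁻ y in Set.Ici r, ((((1 / ‖y‖₊) ^ 2 : NNReal)) : ENNReal) =
      ENNReal.ofReal (1 / Real.sqrt (r ^ 2)) := by
  rw [← setLIntegral_congr (Ioi_ae_eq_Ici (a := r)), Real.sqrt_sq hr.le]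
  have h1 : ∫⁻ y in Set.Ioi r, ((((1 / ‖y‖₊) ^ 2 : NNReal)) : ENNReal) =
      ∫⁻ y in Set.Ioi r, ENNReal.ofReal (y ^ (-2 : ℝ)) := by
    refine setLIntegral_congr_fun measurableSet_Ioi fun y hy => ?_
    have hy0 : 0 < y := hr.trans hy
    have e : y ^ (-2 : ℝ) = ((1 / ‖y‖₊ : NNReal) ^ 2 : NNReal) := by
      rw [Real.rpow_neg hy0.le]
      simp [abs_of_pos hy0]
    simp only [e, ENNReal.ofReal_coe_nnreal]
  rw [h1, ← ofReal_integral_eq_lintegral_ofReal (integrableOn_Ioi_rpow_of_lt (by norm_num) hr)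
    ((ae_restrict_iff' measurableSet_Ioi).2 (.of_forall fun y hy =>
      Real.rpow_nonneg (hr.trans hy).le _)), integral_Ioi_rpow_of_lt (by norm_num) hr]
  congr 1
  norm_num
  rw [Real.rpow_neg_one]

open MeasureTheory in
theorem lintegral_inv_sqrt :
    ∫⁻ x in Set.Icc (-(1 / 2) : ℝ) (1 / 2), ENNReal.ofReal (1 / Real.sqrt (1 - x ^ 2)) =
      ENNReal.ofReal (Real.pi / 3) := by
  have hc : ContinuousOn (fun x : ℝ => 1 / Real.sqrt (1 - x ^ 2)) (Set.Icc (-(1 / 2)) (1 / 2)) := by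
    refine ContinuousOn.div continuousOn_const (by fun_prop) fun x hx => ?_
    have : 0 < 1 - x ^ 2 := by nlinarith [hx.1, hx.2]
    positivity
  rw [← ofReal_integral_eq_lintegral_ofReal (hc.integrableOn_Icc)
    (.of_forall fun x => by positivity), integral_Icc_eq_integral_Ioc,
    ← intervalIntegral.integral_of_le (by norm_num)]
  congr 1
  rw [intervalIntegral.integral_eq_sub_of_hasDerivAt (f := Real.arcsin)]
  · have h6 : Real.arcsin (1 / 2) = Real.pi / 6 := by
      have := Real.pi_pos
      exact Real.arcsin_eq_of_sin_eq Real.sin_pi_div_six ⟨by linarith, by linarith⟩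
    rw [Real.arcsin_neg, h6]
    ring
  · intro x hx
    rw [Set.uIcc_of_le (by norm_num)] at hx
    exact Real.hasDerivAt_arcsin (by linarith [hx.1]) (by linarith [hx.2])
  · exact (hc.mono (Set.uIcc_of_le (by norm_num)).le).intervalIntegrable

-- Integrating `y ^ (-2)` upwards from the unit circle leaves `1 / sqrt (1 - x ^ 2)`, whose
-- primitive is the arcsine.
open MeasureTheory in
theorem volume_fd : volume ModularGroup.fd = ENNReal.ofReal (Real.pi / 3) := by
  set G : ℝ → ENNReal := fun y => (((1 / ‖y‖₊) ^ 2 : NNReal) : ENNReal) with hG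
  have hGm : Measurable G := by rw [hG]; fun_prop
  set E : Set (ℝ × ℝ) := {p | 0 < p.2 ∧ 1 ≤ p.1 ^ 2 + p.2 ^ 2 ∧ |p.1| ≤ 1 / 2} with hE
  have hEm : MeasurableSet E := by
    have m1 : Measurable fun p : ℝ × ℝ => p.1 ^ 2 + p.2 ^ 2 := by fun_prop
    have m2 : Measurable fun p : ℝ × ℝ => |p.1| := by fun_prop
    exact (measurableSet_lt measurable_const measurable_snd).inter
      ((measurableSet_le measurable_const m1).inter (measurableSet_le m2 measurable_const))
  have himg : Complex.measurableEquivRealProd.symm ⁻¹' (UpperHalfPlane.coe '' ModularGroup.fd) =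
      E := by
    ext ⟨x, y⟩
    simp only [Set.mem_preimage, Set.mem_image]
    constructor
    · rintro ⟨z, ⟨h1, h2⟩, hz⟩
      have hx : z.re = x := congrArg Complex.re hz
      have hy : z.im = y := congrArg Complex.im hz
      rw [Complex.normSq_apply] at h1
      change 1 ≤ z.re * z.re + z.im * z.im at h1
      rw [hx, hy] at h1
      rw [hx] at h2
      exact ⟨hy ▸ z.im_pos, by change 1 ≤ x ^ 2 + y ^ 2; linarith, h2⟩
    · rintro ⟨h0, h1, h2⟩
      refine ⟨⟨⟨x, y⟩, h0⟩, ⟨?_, h2⟩, rfl⟩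
      rw [Complex.normSq_apply]
      change 1 ≤ x * x + y * y
      change 1 ≤ x ^ 2 + y ^ 2 at h1
      linarith
  have hmp := Complex.volume_preserving_equiv_real_prod.symm
  rw [UpperHalfPlane.volume_eq_lintegral, ← hmp.setLIntegral_comp_preimage_emb
    (MeasurableEquiv.measurableEmbedding _), himg]
  change ∫⁻ p in E, G p.2 = _
  rw [← lintegral_indicator hEm, Measure.volume_eq_prod,
    lintegral_prod _ (Measurable.indicator (show Measurable fun p : ℝ × ℝ => G p.2 from
      hGm.comp measurable_snd) hEm).aemeasurable]
  rw [← lintegral_inv_sqrt, ← lintegral_indicator measurableSet_Icc]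
  refine lintegral_congr fun x => ?_
  by_cases hx : x ∈ Set.Icc (-(1 / 2) : ℝ) (1 / 2)
  · rw [Set.indicator_of_mem hx]
    have hpos : 0 < 1 - x ^ 2 := by nlinarith [hx.1, hx.2]
    have := lintegral_inv_sq_Ici (Real.sqrt_pos.2 hpos)
    rw [Real.sq_sqrt hpos.le] at this
    rw [← this, ← lintegral_indicator measurableSet_Ici]
    refine lintegral_congr fun y => ?_
    have hiff : (x, y) ∈ E ↔ y ∈ Set.Ici (Real.sqrt (1 - x ^ 2)) := by
      rw [Set.mem_Ici]
      constructor
      · rintro ⟨h0, h1, -⟩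
        refine Real.sqrt_le_iff.2 ⟨le_of_lt h0, ?_⟩
        change 1 ≤ x ^ 2 + y ^ 2 at h1
        linarith
      · intro h
        refine ⟨(Real.sqrt_pos.2 hpos).trans_le h, ?_, abs_le.2 hx⟩
        change 1 ≤ x ^ 2 + y ^ 2
        linarith [(Real.sqrt_le_iff.1 h).2]
    by_cases hy : (x, y) ∈ E
    · rw [Set.indicator_of_mem hy, Set.indicator_of_mem (hiff.1 hy)]
    · rw [Set.indicator_of_notMem hy, Set.indicator_of_notMem (hiff.not.1 hy)]
  · rw [Set.indicator_of_notMem hx]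
    refine lintegral_eq_zero_of_ae_eq_zero (.of_forall fun y => ?_)
    exact Set.indicator_of_notMem (fun h => hx (abs_le.1 h.2.2)) _

theorem modularArea_eq : modularArea = Real.pi / 3 := by
  rw [modularArea, volume_fd, ENNReal.toReal_ofReal (by positivity)]

/-- The class is `{M, -M}`. A threefold tie gives `qv = 2 / 3`, and `hv = 1 / 2`, so each element
has weight `1 / 6`. -/
theorem sum_wt_of_isScalarMat {M : Mat} (hM0 : 0 < M.det) (hM : IsScalarMat M) :
    ∑ᶠ N ∈ classSet M, wt N = 1 / 3 := by
  have hset : classSet M = {M, -M} := by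
    have hg : ∀ g : SL(2, ℤ), cj g M = M := fun g => by
      obtain ⟨l, rfl⟩ := hM
      rw [cj, (Matrix.scalar_commute l (fun r => Commute.all l r) (g : Mat)).eq.symm, mul_assoc,
        coe_mul_inv, mul_one]
    ext N
    constructor
    · intro hN
      obtain ⟨g, h | h⟩ := conjClass_eq_iff.1 hN
      · exact Or.inl (h.trans (hg g))
      · rw [hg] at h; exact Or.inr h
    · rintro (rfl | rfl)
      · exact mem_classSet_self _
      · exact neg_mem_classSet (mem_classSet_self _)
  obtain ⟨a, b, c, d, rfl⟩ := exists_entries M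
  obtain ⟨rfl, rfl, rfl⟩ := isScalarMat_iff.1 hM
  rw [Matrix.det_fin_two_of] at hM0
  have ha : 0 < a * a := by linarith
  have ha0 : a ≠ 0 := by rintro rfl; simp at ha
  have hne : !![a, 0; 0, a] ≠ -!![a, 0; 0, a] := fun h => ha0 (by
    have : a = -a := congrFun (congrFun h 0) 0
    omega)
  rw [hset, finsum_mem_pair hne, wt_neg, wt, hv_mk, qv_mk]
  have h1 : hex a 0 = a * a := by unfold hex; ring
  have h2 : hex 0 a = a * a := by unfold hex; ring
  have h3 : hex (a + 0) (0 + a) = a * a := by unfold hex; ring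
  rw [h1, h2, h3]
  norm_num [lead]

theorem two_mul_eps {n : ℕ} (hn : 0 < n) {M : Mat} (hdet : M.det = n) :
    2 * eps M = ((∑ᶠ N ∈ classSet M, wt N : ℚ) : ℝ) := by
  have hpos : 0 < M.det := by rw [hdet]; exact_mod_cast hn
  by_cases hs : IsScalarMat M
  · rw [eps, if_pos (show ∃ l : ℤ, M = Matrix.scalar (Fin 2) l from hs),
      sum_wt_of_isScalarMat hpos hs, modularArea_eq]
    have := Real.pi_ne_zero
    push_cast
    field_simp
  rw [eps, if_neg (show ¬∃ l : ℤ, M = Matrix.scalar (Fin 2) l from hs)]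
  rcases lt_trichotomy (M.trace ^ 2 - 4 * M.det) 0 with h | h | h
  · have key := sum_wt_of_elliptic hn hdet (by linarith)
    have hc : (Nat.card (stab M) : ℝ) ≠ 0 := by
      intro h0
      rw [Nat.cast_eq_zero.1 h0] at key
      norm_num at key
    rw [sign_neg h]
    have key' : (Nat.card (stab M) : ℝ) * ((∑ᶠ N ∈ classSet M, wt N : ℚ) : ℝ) = -2 := by
      exact_mod_cast key
    refine mul_left_cancel₀ hc ?_
    rw [key']
    field_simp
    simp
  · rw [sum_wt_of_not_split hn hdet (by linarith) hs (Or.inl h), h]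
    simp
  · by_cases hsq : IsSquare (M.trace ^ 2 - 4 * M.det)
    · obtain ⟨k, hk⟩ := hsq
      have hk0 : k ≠ 0 := by rintro rfl; simp [hk] at h
      rw [sum_wt_of_split hn hdet hs hk0 hk, card_stab_of_split hpos hk0 hk, sign_pos h]
      simp
    · rw [sum_wt_of_not_split hn hdet (by linarith) hs (Or.inr hsq)]
      have := (stab_infinite h hsq).to_subtype
      -- An infinite stabilizer has `Nat.card` equal to 0, and division by 0 gives 0: this is the
      -- convention `1 / ∞ = 0`.
      rw [Nat.card_eq_zero_of_infinite]
      simp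

/-! ### Coefficients -/

/-- The coefficient of `±N` in `x`. -/
def co (x : BarAlg) (N : Mat) : ℚ := x.coeff (bar N)

theorem bar_surjective : Function.Surjective bar := Quotient.mk_surjective

theorem ext_co {x y : BarAlg} (h : ∀ N, co x N = co y N) : x = y := by
  apply MonoidAlgebra.coeff_injective
  ext X
  obtain ⟨N, rfl⟩ := bar_surjective X
  exact h N

theorem bar_neg (N : Mat) : bar (-N) = bar N := bar_eq_iff.2 (Or.inr rfl)

theorem co_neg (x : BarAlg) (N : Mat) : co x (-N) = co x N := by rw [co, co, bar_neg]

theorem co_add (x y : BarAlg) (N : Mat) : co (x + y) N = co x N + co y N := rfl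

theorem co_sub (x y : BarAlg) (N : Mat) : co (x - y) N = co x N - co y N := by
  rw [co, MonoidAlgebra.coeff_sub]; rfl

theorem co_zero (N : Mat) : co 0 N = 0 := rfl

theorem co_basisElt_mul (g : SL(2, ℤ)) (x : BarAlg) (N : Mat) :
    co (basisElt (g : Mat) * x) N = co x (((g⁻¹ : SL(2, ℤ)) : Mat) * N) := by
  rw [co, basisElt, MonoidAlgebra.coeff_single_mul_eq_mul_coeff (bar (((g⁻¹ : SL(2, ℤ)) : Mat) * N)),
    one_mul, co]
  intro X _
  obtain ⟨A, rfl⟩ := bar_surjective X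
  rw [← bar_mul]
  constructor
  · intro h
    rw [bar_mul, ← h, ← bar_mul, ← mul_assoc, coe_inv_mul, one_mul]
  · intro h
    rw [bar_mul, h, ← bar_mul, ← mul_assoc, coe_mul_inv, one_mul]

theorem co_mul_basisElt (g : SL(2, ℤ)) (x : BarAlg) (N : Mat) :
    co (x * basisElt (g : Mat)) N = co x (N * ((g⁻¹ : SL(2, ℤ)) : Mat)) := by
  rw [co, basisElt, MonoidAlgebra.coeff_mul_single_eq_coeff_mul (bar (N * ((g⁻¹ : SL(2, ℤ)) : Mat))),
    mul_one, co]
  intro X _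
  obtain ⟨A, rfl⟩ := bar_surjective X
  rw [← bar_mul]
  constructor
  · intro h
    rw [bar_mul, ← h, ← bar_mul, mul_assoc, coe_mul_inv, mul_one]
  · intro h
    rw [bar_mul, h, ← bar_mul, mul_assoc, coe_inv_mul, mul_one]

theorem mem_R_iff {n : ℕ} {x : BarAlg} : x ∈ R n ↔ ∀ N, co x N ≠ 0 → N.det = n := by
  rw [R, MonoidAlgebra.mem_supported]
  constructor
  · intro h N hN
    obtain ⟨A, hA, hAN⟩ := h (Finsupp.mem_support_iff.2 hN)
    have hA' : A.det = n := hA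
    rcases bar_eq_iff.1 hAN with h | h
    · rw [← h]; exact hA'
    · rw [h, Matrix.det_neg] at hA'; simpa using hA'
  · intro h X hX
    obtain ⟨N, rfl⟩ := bar_surjective X
    exact ⟨N, h N (Finsupp.mem_support_iff.1 hX), rfl⟩

theorem finite_co_ne_zero (x : BarAlg) : {N | co x N ≠ 0}.Finite := by
  have : {N | co x N ≠ 0} = bar ⁻¹' (x.coeff.support : Set BarMat) := by
    ext N; simp [co]
  rw [this]
  refine (Finset.finite_toSet _).preimage' fun X _ => ?_
  obtain ⟨M, rfl⟩ := bar_surjective X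
  refine (Set.toFinite {M, -M}).subset fun N hN => ?_
  exact bar_eq_iff.1 hN

theorem det_SL_mul (g : SL(2, ℤ)) (N : Mat) : ((g : Mat) * N).det = N.det := by
  rw [Matrix.det_mul, g.det_coe, one_mul]

theorem det_mul_SL (N : Mat) (g : SL(2, ℤ)) : (N * (g : Mat)).det = N.det := by
  rw [Matrix.det_mul, g.det_coe, mul_one]

theorem basisElt_mul_mem_R {n : ℕ} {x : BarAlg} (g : SL(2, ℤ)) (hx : x ∈ R n) :
    basisElt (g : Mat) * x ∈ R n := by
  rw [mem_R_iff] at hx ⊢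
  intro N hN
  rw [co_basisElt_mul] at hN
  rw [← hx _ hN, det_SL_mul]

theorem mul_basisElt_mem_R {n : ℕ} {x : BarAlg} (g : SL(2, ℤ)) (hx : x ∈ R n) :
    x * basisElt (g : Mat) ∈ R n := by
  rw [mem_R_iff] at hx ⊢
  intro N hN
  rw [co_mul_basisElt] at hN
  rw [← hx _ hN, det_mul_SL]

theorem coe_S_inv_eq : ((ModularGroup.S⁻¹ : SL(2, ℤ)) : Mat) = -(ModularGroup.S : SL(2, ℤ)) := by
  rw [coe_S_inv, coe_S, neg_fin_two]; norm_num

theorem coe_U_inv_eq : ((U⁻¹ : SL(2, ℤ)) : Mat) = -((U : Mat) * U) := by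
  rw [coe_U_inv, coe_U, Matrix.mul_fin_two, neg_fin_two]; norm_num

theorem co_S_mul (x : BarAlg) (N : Mat) : co (basisElt (ModularGroup.S : SL(2, ℤ)) * x) N =
    co x ((ModularGroup.S : SL(2, ℤ)) * N) := by
  rw [co_basisElt_mul, coe_S_inv_eq, neg_mul, co_neg]

theorem co_mul_S (x : BarAlg) (N : Mat) : co (x * basisElt (ModularGroup.S : SL(2, ℤ))) N =
    co x (N * (ModularGroup.S : SL(2, ℤ))) := by
  rw [co_mul_basisElt, coe_S_inv_eq, mul_neg, co_neg]

theorem co_U_mul (x : BarAlg) (N : Mat) : co (basisElt (U : Mat) * x) N =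
    co x ((U : Mat) * ((U : Mat) * N)) := by
  rw [co_basisElt_mul, coe_U_inv_eq, neg_mul, co_neg, mul_assoc]

theorem co_mul_U (x : BarAlg) (N : Mat) : co (x * basisElt (U : Mat)) N =
    co x (N * (U : Mat) * (U : Mat)) := by
  rw [co_mul_basisElt, coe_U_inv_eq, mul_neg, co_neg, mul_assoc]

theorem coe_U_cube : (U : Mat) * ((U : Mat) * (U : Mat)) = -1 := by
  rw [coe_U, Matrix.mul_fin_two, Matrix.mul_fin_two, Matrix.one_fin_two, neg_fin_two]; norm_num

theorem co_U_mul_U_mul (x : BarAlg) (N : Mat) :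
    co (basisElt (U : Mat) * (basisElt (U : Mat) * x)) N = co x ((U : Mat) * N) := by
  rw [co_U_mul, co_U_mul, ← co_neg x ((U : Mat) * N)]
  congr 1
  have := coe_U_cube
  calc (U : Mat) * (U * (U * (U * N))) = ((U : Mat) * (U * U)) * (U * N) := by
        simp only [mul_assoc]
    _ = _ := by rw [this, neg_one_mul]

theorem co_mul_U_mul_U (x : BarAlg) (N : Mat) :
    co (x * basisElt (U : Mat) * basisElt (U : Mat)) N = co x (N * (U : Mat)) := by
  rw [co_mul_U, co_mul_U, ← co_neg x (N * (U : Mat))]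
  congr 1
  have := coe_U_cube
  calc N * (U : Mat) * U * U * U = (N * U) * ((U : Mat) * (U * U)) := by
        simp only [mul_assoc]
    _ = _ := by rw [this, mul_neg_one]

/-! ### Acyclicity of the tree of `SL₂(ℤ)` -/

/-- The image of `N` of a vector with irrational slope. -/
def irrVec (N : Mat) : ℝ × ℝ :=
  (N 0 0 + N 0 1 * Real.sqrt 2, N 1 0 + N 1 1 * Real.sqrt 2)

theorem add_mul_sqrt_two_ne_zero {a b : ℤ} (h : a ≠ 0 ∨ b ≠ 0) : (a : ℝ) + b * Real.sqrt 2 ≠ 0 := by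
  intro h0
  by_cases hb : b = 0
  · subst hb
    simp at h0 h
    exact h h0
  · refine irrational_sqrt_two ⟨-a / b, ?_⟩
    have hb' : (b : ℝ) ≠ 0 := by exact_mod_cast hb
    push_cast
    field_simp
    linarith

theorem irrVec_ne_zero {N : Mat} (h : N.det ≠ 0) : (irrVec N).1 * (irrVec N).2 ≠ 0 := by
  obtain ⟨a, b, c, d, rfl⟩ := exists_entries N
  rw [Matrix.det_fin_two_of] at h
  refine mul_ne_zero (add_mul_sqrt_two_ne_zero ?_) (add_mul_sqrt_two_ne_zero ?_)
  all_goals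
    by_contra! h0
    obtain ⟨h1, h2⟩ := h0
    simp at h1 h2
    simp [h1, h2] at h

theorem irrVec_S_mul (N : Mat) :
    irrVec ((ModularGroup.S : SL(2, ℤ)) * N) = (-(irrVec N).2, (irrVec N).1) := by
  obtain ⟨a, b, c, d, rfl⟩ := exists_entries N
  rw [coe_S, Matrix.mul_fin_two]
  simp [irrVec]
  ring

theorem irrVec_U_mul (N : Mat) :
    irrVec ((U : Mat) * N) = ((irrVec N).1 - (irrVec N).2, (irrVec N).1) := by
  obtain ⟨a, b, c, d, rfl⟩ := exists_entries N
  rw [coe_U, Matrix.mul_fin_two]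
  simp [irrVec]
  ring

/-- The height of a matrix. -/
def height (N : Mat) : ℝ := |(irrVec N).1| + |(irrVec N).2|

theorem height_lt {N : Mat} (h : (irrVec N).1 * (irrVec N).2 < 0) :
    height N < height ((U : Mat) * N) ∧ height N < height ((U : Mat) * ((U : Mat) * N)) := by
  simp only [height, irrVec_U_mul]
  rcases mul_neg_iff.1 h with ⟨h1, h2⟩ | ⟨h1, h2⟩
  · rw [abs_of_pos h1, abs_of_neg h2, abs_of_pos (show 0 < (irrVec N).1 - (irrVec N).2 by linarith),
      abs_of_pos (show 0 < (irrVec N).1 - (irrVec N).2 - (irrVec N).1 by linarith)]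
    constructor <;> linarith
  · rw [abs_of_neg h1, abs_of_pos h2, abs_of_neg (show (irrVec N).1 - (irrVec N).2 < 0 by linarith),
      abs_of_neg (show (irrVec N).1 - (irrVec N).2 - (irrVec N).1 < 0 by linarith)]
    constructor <;> linarith

/-- Take an element of the support of maximal height. Irrationality of the slope keeps both
coordinates of `irrVec` nonzero, so after replacing `N` by `S * N`, which has the same height, they
have opposite signs. Then `U * N` and `U * (U * N)` are strictly higher, so their coefficients
vanish, and the relation for `U` forces the one at `N` to vanish too. -/
theorem eq_zero_of_S_of_U {n : ℕ} (hn : 0 < n) {x : BarAlg} (hx : x ∈ R n)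
    (hS : x + basisElt (ModularGroup.S : SL(2, ℤ)) * x = 0)
    (hU : x + basisElt (U : Mat) * x + basisElt (U : Mat) * (basisElt (U : Mat) * x) = 0) :
    x = 0 := by
  by_contra hne
  have cS : ∀ N, co x N + co x ((ModularGroup.S : SL(2, ℤ)) * N) = 0 := fun N => by
    rw [← co_S_mul, ← co_add, hS, co_zero]
  have cU : ∀ N, co x N + co x ((U : Mat) * ((U : Mat) * N)) + co x ((U : Mat) * N) = 0 :=
    fun N => by rw [← co_U_mul, ← co_U_mul_U_mul, ← co_add, ← co_add, hU, co_zero]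
  have hfin := finite_co_ne_zero x
  have hnonempty : {N | co x N ≠ 0}.Nonempty := by
    by_contra h
    rw [Set.not_nonempty_iff_eq_empty] at h
    exact hne (ext_co fun N => by
      by_contra h0
      exact (Set.eq_empty_iff_forall_notMem.1 h N) h0)
  obtain ⟨N, hN, hmax⟩ := Set.exists_max_image _ height hfin hnonempty
  have key : ∀ N, co x N ≠ 0 → (∀ M, co x M ≠ 0 → height M ≤ height N) →
      ¬(irrVec N).1 * (irrVec N).2 < 0 := by
    intro N hN hmax hneg
    obtain ⟨h1, h2⟩ := height_lt hneg
    have z1 : co x ((U : Mat) * N) = 0 := by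
      by_contra h; exact (hmax _ h).not_gt h1
    have z2 : co x ((U : Mat) * ((U : Mat) * N)) = 0 := by
      by_contra h; exact (hmax _ h).not_gt h2
    have := cU N
    rw [z1, z2] at this
    exact hN (by linarith)
  have hdet : N.det ≠ 0 := by
    rw [mem_R_iff.1 hx N hN]; exact_mod_cast hn.ne'
  rcases (irrVec_ne_zero hdet).lt_or_gt with h | h
  · exact key N hN hmax h
  · refine key ((ModularGroup.S : SL(2, ℤ)) * N) (fun h0 => hN ?_) (fun M hM => ?_) ?_
    · have := cS N
      rw [h0] at this
      linarith
    · have : height ((ModularGroup.S : SL(2, ℤ)) * N) = height N := by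
        simp only [height, irrVec_S_mul, abs_neg]; ring
      rw [this]
      exact hmax M hM
    · rw [irrVec_S_mul]
      linarith

theorem basisElt_mul (A B : Mat) : basisElt A * basisElt B = basisElt (A * B) := by
  rw [basisElt, basisElt, MonoidAlgebra.single_mul_single, one_mul, basisElt, bar_mul]

theorem basisElt_S_sq (x : BarAlg) : basisElt (ModularGroup.S : SL(2, ℤ)) *
    (basisElt (ModularGroup.S : SL(2, ℤ)) * x) = x :=
  ext_co fun N => by
    rw [co_S_mul, co_S_mul, ← mul_assoc, ← Matrix.SpecialLinearGroup.coe_mul, S_mul_S]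
    simp [co_neg]

theorem basisElt_U_cube (x : BarAlg) : basisElt (U : Mat) * (basisElt (U : Mat) *
    (basisElt (U : Mat) * x)) = x :=
  ext_co fun N => by
    have e : (U : Mat) * (U * (U * N)) = -N := by
      rw [← neg_one_mul, ← coe_U_cube]; simp only [mul_assoc]
    rw [co_U_mul_U_mul, co_U_mul, e, co_neg]

theorem basisElt_T_eq : basisElt (ModularGroup.T : SL(2, ℤ)) =
    basisElt (U : Mat) * basisElt (ModularGroup.S : SL(2, ℤ)) := by
  rw [basisElt_mul, U_mul_S, basisElt, basisElt, bar_neg]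

/-- Elements whose image under `1 - S` lies in `(1 - T) R_n`. -/
theorem exists_decomposition {n : ℕ} (hn : 0 < n) {x y : BarAlg} (hy : y ∈ R n)
    (h : (1 - basisElt (ModularGroup.S : SL(2, ℤ))) * x =
      (1 - basisElt (ModularGroup.T : SL(2, ℤ))) * y) :
    ∃ α β : BarAlg, x = (α + basisElt (ModularGroup.S : SL(2, ℤ)) * α) +
      (β + basisElt (U : Mat) * β + basisElt (U : Mat) * (basisElt (U : Mat) * β)) := by
  set s := basisElt (ModularGroup.S : SL(2, ℤ)) with hs
  set u := basisElt (U : Mat) with hu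
  set z := s * y with hz
  have hsz : s * z = y := basisElt_S_sq y
  -- With `T = U * S` up to sign, the hypothesis exhibits one element as a left multiple of both `1
  -- - S` and `1 - U`. It is therefore annihilated by `1 + S` and by `1 + U + U²`, so it is zero.
  have e : (x + z) - s * (x + z) = z - u * z := by
    rw [basisElt_T_eq, ← hs, ← hu, sub_mul, sub_mul, one_mul, one_mul, mul_assoc, ← hz] at h
    rw [mul_add, hsz, show x + z - (s * x + y) = (x - s * x) - y + z by abel, h]
    abel
  have hzR : z ∈ R n := basisElt_mul_mem_R _ hy
  have hw : z - u * z = 0 := by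
    refine eq_zero_of_S_of_U hn ((R n).sub_mem hzR (basisElt_mul_mem_R _ hzR)) ?_ ?_
    · rw [← e, ← hs, mul_sub, basisElt_S_sq]
      abel
    · rw [← hu, mul_sub, mul_sub, basisElt_U_cube]
      abel
  have e1 : s * (x + z) = x + z := by rw [hw] at e; exact (sub_eq_zero.1 e).symm
  have e2 : u * z = z := (sub_eq_zero.1 hw).symm
  -- `x + z` is fixed by `S` and `z` by `U`, so `1 + S` doubles the former and `1 + U + U²` triples
  -- the latter.
  refine ⟨(1 / 2 : ℚ) • (x + z), (-(1 / 3) : ℚ) • z, ?_⟩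
  rw [mul_smul_comm, e1, mul_smul_comm, e2, mul_smul_comm, e2]
  module

/-! ### The Hecke element -/

theorem wt_out (N : Mat) : wt (Quotient.out (bar N)) = wt N := by
  have h : bar (Quotient.out (bar N)) = bar N := Quotient.out_eq _
  rcases bar_eq_iff.1 h with h | h
  · rw [h]
  · rw [h, wt_neg]

open Classical in
/-- The coefficients of the Hecke element. -/
def thetaCoeff (n : ℕ) (X : BarMat) : ℚ := if X ∈ barSet (detSet n) then wt (Quotient.out X) else 0

theorem finite_support_thetaCoeff {n : ℕ} (hn : 0 < n) : (Function.support (thetaCoeff n)).Finite := by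
  refine ((finite_wt_ne_zero hn).image bar).subset fun X hX => ?_
  have hmem : X ∈ barSet (detSet n) := by
    by_contra h; exact hX (if_neg h)
  have h : wt (Quotient.out X) ≠ 0 := fun h => hX ((if_pos hmem).trans h)
  obtain ⟨N, hN, rfl⟩ := hmem
  rw [wt_out] at h
  exact ⟨N, ⟨hN, h⟩, rfl⟩

/-- An explicit Hecke element with property (A). -/
def theta {n : ℕ} (hn : 0 < n) : BarAlg :=
  MonoidAlgebra.ofCoeff (Finsupp.ofSupportFinite (thetaCoeff n) (finite_support_thetaCoeff hn))

theorem bar_mem_barSet_iff {n : ℕ} {N : Mat} : bar N ∈ barSet (detSet n) ↔ N.det = n := by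
  constructor
  · rintro ⟨A, hA, hAN⟩
    have hA' : A.det = n := hA
    rcases bar_eq_iff.1 hAN with h | h
    · rw [← h]; exact hA'
    · rw [h, Matrix.det_neg] at hA'; simpa using hA'
  · exact fun h => ⟨N, h, rfl⟩

theorem co_theta {n : ℕ} (hn : 0 < n) {N : Mat} (hN : N.det = n) : co (theta hn) N = wt N := by
  change thetaCoeff n (bar N) = _
  rw [thetaCoeff, if_pos (bar_mem_barSet_iff.2 hN), wt_out]

theorem theta_mem_R {n : ℕ} (hn : 0 < n) : theta hn ∈ R n := by
  rw [mem_R_iff]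
  intro N hN
  by_contra h
  apply hN
  change thetaCoeff n (bar N) = _
  rw [thetaCoeff, if_neg (bar_mem_barSet_iff.not.2 h)]

theorem ext_of_mem_R {n : ℕ} {x y : BarAlg} (hx : x ∈ R n) (hy : y ∈ R n)
    (h : ∀ N : Mat, N.det = n → co x N = co y N) : x = y :=
  ext_co fun N => by
    by_cases hN : N.det = n
    · exact h N hN
    · have h1 : co x N = 0 := by by_contra h0; exact hN (mem_R_iff.1 hx N h0)
      have h2 : co y N = 0 := by by_contra h0; exact hN (mem_R_iff.1 hy N h0)
      rw [h1, h2]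

/-- `θ(1 + S)` is invariant under `U`. -/
theorem U_mul_theta_add {n : ℕ} (hn : 0 < n) :
    basisElt (U : Mat) * (theta hn + theta hn * basisElt (ModularGroup.S : SL(2, ℤ))) =
      theta hn + theta hn * basisElt (ModularGroup.S : SL(2, ℤ)) := by
  have hR := (R n).add_mem (theta_mem_R hn)
    (mul_basisElt_mem_R (ModularGroup.S : SL(2, ℤ)) (theta_mem_R hn))
  refine ext_of_mem_R (basisElt_mul_mem_R U hR) hR fun N hN => ?_
  have e : ∀ N : Mat, N.det = n → co (theta hn + theta hn * basisElt (ModularGroup.S : SL(2, ℤ))) N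
      = qv N + qv (N * (ModularGroup.S : SL(2, ℤ))) - 1 := fun N hN => by
    rw [co_add, co_mul_S, co_theta hn hN, co_theta hn ((det_mul_SL _ _).trans hN), wt, wt, hv_mul_S]
    ring
  rw [co_U_mul, e _ ((det_SL_mul _ _).trans ((det_SL_mul _ _).trans hN)), e _ hN, mul_assoc,
    mul_assoc, qv_U_mul, qv_U_mul, qv_U_mul, qv_U_mul]

/-- `θ(1 + U + U²)` is invariant under `S`. -/
theorem S_mul_theta_add {n : ℕ} (hn : 0 < n) :
    basisElt (ModularGroup.S : SL(2, ℤ)) * (theta hn + theta hn * basisElt (U : Mat) +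
      theta hn * basisElt (U : Mat) * basisElt (U : Mat)) =
      theta hn + theta hn * basisElt (U : Mat) +
        theta hn * basisElt (U : Mat) * basisElt (U : Mat) := by
  have hR := (R n).add_mem ((R n).add_mem (theta_mem_R hn) (mul_basisElt_mem_R U (theta_mem_R hn)))
    (mul_basisElt_mem_R U (mul_basisElt_mem_R U (theta_mem_R hn)))
  refine ext_of_mem_R (basisElt_mul_mem_R _ hR) hR fun N hN => ?_
  have e : ∀ N : Mat, N.det = n → co (theta hn + theta hn * basisElt (U : Mat) +
      theta hn * basisElt (U : Mat) * basisElt (U : Mat)) N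
      = 2 - hv N - hv (N * (U : Mat)) - hv (N * (U : Mat) * (U : Mat)) := fun N hN => by
    have h1 := (det_mul_SL N U).trans hN
    rw [co_add, co_add, co_mul_U_mul_U, co_mul_U, co_theta hn hN, co_theta hn h1,
      co_theta hn ((det_mul_SL _ U).trans h1), wt, wt, wt]
    linarith [qv_mul_U N]
  rw [co_S_mul, e _ ((det_SL_mul _ _).trans hN), e _ hN, mul_assoc, mul_assoc, mul_assoc,
    hv_S_mul, hv_S_mul, hv_S_mul]

/-! ### Property (A) -/

/-- Elements with vanishing sums along the orbits of `T` lie in `(1 - T) R_n`. -/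
theorem exists_one_sub_T_mul {n : ℕ} (hn : 0 < n) {x : BarAlg} (hx : x ∈ R n)
    (h : ∀ N : Mat, N.det = n →
      ∑ᶠ k : ℤ, co x (((ModularGroup.T ^ k : SL(2, ℤ)) : Mat) * N) = 0) :
    ∃ y ∈ R n, x = (1 - basisElt (ModularGroup.T : SL(2, ℤ))) * y := by
  classical
  set t := basisElt (ModularGroup.T : SL(2, ℤ)) with ht
  let p : Submodule ℚ BarAlg := (R n).map (LinearMap.mulLeft ℚ (1 - t))
  suffices hxp : x ∈ p by
    obtain ⟨y, hy, hyx⟩ := hxp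
    exact ⟨y, hy, hyx.symm⟩
  let sd : Setoid BarMat :=
    { r := fun X Y => ∃ k : ℤ, Y = barSL (ModularGroup.T ^ k) * X
      iseqv :=
        { refl := fun X => ⟨0, by
            obtain ⟨N, rfl⟩ := bar_surjective X
            rw [barSL, ← bar_mul]; simp⟩
          symm := by
            rintro X Y ⟨k, rfl⟩
            refine ⟨-k, ?_⟩
            obtain ⟨N, rfl⟩ := bar_surjective X
            rw [barSL, barSL, ← bar_mul, ← bar_mul, ← mul_assoc,
              ← Matrix.SpecialLinearGroup.coe_mul, ← zpow_add]
            simp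
          trans := by
            rintro X Y Z ⟨k, rfl⟩ ⟨l, rfl⟩
            refine ⟨l + k, ?_⟩
            obtain ⟨N, rfl⟩ := bar_surjective X
            rw [barSL, barSL, barSL, ← bar_mul, ← bar_mul, ← bar_mul, ← mul_assoc,
              ← Matrix.SpecialLinearGroup.coe_mul, ← zpow_add] } }
  -- Moving each basis element to a chosen representative of its `T`-orbit changes it by an element
  -- of `(1 - T) R_n`. What remains has the orbit sums as coefficients.
  let r : BarMat → BarMat := fun X => (Quotient.mk sd X).out
  have hr : ∀ X, ∃ k : ℤ, X = barSL (ModularGroup.T ^ k) * r X := fun X =>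
    Quotient.exact (Quotient.out_eq (Quotient.mk sd X))
  have hreq : ∀ X Y, r X = r Y ↔ ∃ k : ℤ, Y = barSL (ModularGroup.T ^ k) * X := fun X Y => by
    constructor
    · intro e
      have : Quotient.mk sd X = Quotient.mk sd Y := Quotient.out_injective e
      exact Quotient.exact this
    · intro e
      have : Quotient.mk sd X = Quotient.mk sd Y := Quotient.sound e
      exact congrArg Quotient.out this
  have hstep : ∀ (N : Mat), N.det = n → ∀ k : ℤ,
      basisElt (((ModularGroup.T ^ k : SL(2, ℤ)) : Mat) * N) - basisElt N ∈ p := by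
    intro N hN
    have hb : ∀ A : Mat, A.det = n → basisElt A - basisElt
        (((ModularGroup.T : SL(2, ℤ)) : Mat) * A) ∈ p := fun A hA => by
      refine ⟨basisElt A, ?_, ?_⟩
      · rw [SetLike.mem_coe, R, MonoidAlgebra.mem_supported]
        intro X hX
        have hX' : X = bar A := by
          simpa using Finsupp.support_single_subset hX
        rw [hX']; exact bar_mem_barSet_iff.2 hA
      · change (1 - t) * basisElt A = _
        rw [sub_mul, one_mul, ht, basisElt_mul]
    intro k
    induction k using Int.induction_on with
    | zero => simp
    | succ k ih =>
      have h1 := hb (((ModularGroup.T ^ (k : ℤ) : SL(2, ℤ)) : Mat) * N) ((det_SL_mul _ _).trans hN)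
      rw [← mul_assoc, ← Matrix.SpecialLinearGroup.coe_mul, ← zpow_one_add, add_comm] at h1
      have := p.sub_mem ih h1
      simpa using this
    | pred k ih =>
      have h1 := hb (((ModularGroup.T ^ (-(k : ℤ) - 1) : SL(2, ℤ)) : Mat) * N)
        ((det_SL_mul _ _).trans hN)
      rw [← mul_assoc, ← Matrix.SpecialLinearGroup.coe_mul, ← zpow_one_add, add_sub_cancel] at h1
      have := p.add_mem ih h1
      simpa using this
  have hrep : ∀ X ∈ x.coeff.support, MonoidAlgebra.single X (1 : ℚ) -
      MonoidAlgebra.single (r X) 1 ∈ p := by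
    intro X hX
    have hXd : X ∈ barSet (detSet n) := MonoidAlgebra.mem_supported.1 hx hX
    obtain ⟨k, hk⟩ := hr X
    obtain ⟨N, hN⟩ := bar_surjective (r X)
    rw [← hN, barSL, ← bar_mul] at hk
    rw [hk, bar_mem_barSet_iff, det_SL_mul] at hXd
    rw [← hN, hk]
    exact hstep N hXd k
  have hsum : x = ∑ X ∈ x.coeff.support, x.coeff X • MonoidAlgebra.single X (1 : ℚ) := by
    conv_lhs => rw [← MonoidAlgebra.sum_coeff_single x]
    rw [Finsupp.sum]
    exact Finset.sum_congr rfl fun X _ => by rw [MonoidAlgebra.smul_single, smul_eq_mul, mul_one]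
  have hzero : ∑ X ∈ x.coeff.support, x.coeff X • MonoidAlgebra.single (r X) (1 : ℚ) = 0 := by
    rw [← Finset.sum_fiberwise_of_maps_to (g := r) (t := x.coeff.support.image r)
      fun X hX => Finset.mem_image_of_mem r hX]
    refine Finset.sum_eq_zero fun Z hZ => ?_
    obtain ⟨Y, hY, rfl⟩ := Finset.mem_image.1 hZ
    have hYd : Y ∈ barSet (detSet n) := MonoidAlgebra.mem_supported.1 hx hY
    obtain ⟨N, hN, rfl⟩ := hYd
    have hN' : N.det = n := hN
    rw [Finset.sum_congr rfl fun X hX => by rw [(Finset.mem_filter.1 hX).2], ← Finset.sum_smul]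
    convert! zero_smul ℚ _
    rw [← h N hN']
    -- A nonzero determinant makes the translates `T ^ k * N` distinct modulo `±1`, so the sum over
    -- `k` counts each element of the orbit once.
    have hinj : Function.Injective fun k : ℤ => bar (((ModularGroup.T ^ k : SL(2, ℤ)) : Mat) * N) := by
      intro k l hkl
      obtain ⟨a, b, c, d, rfl⟩ := exists_entries N
      rw [Matrix.det_fin_two_of] at hN'
      have hn' : (0 : ℤ) < n := by exact_mod_cast hn
      simp only [coe_T_zpow, Matrix.mul_fin_two] at hkl
      rcases bar_eq_iff.1 hkl with e | e
      · rw [mk_eq_mk_iff] at e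
        obtain ⟨e1, e2, -, -⟩ := e
        by_contra hne
        have h1 : (k - l) * c = 0 := by linarith
        have h2 : (k - l) * d = 0 := by linarith
        rw [mul_eq_zero, or_iff_right (sub_ne_zero.2 hne)] at h1 h2
        rw [h1, h2] at hN'
        simp at hN'
        omega
      · rw [neg_fin_two, mk_eq_mk_iff] at e
        obtain ⟨-, -, e1, e2⟩ := e
        have h1 : c = 0 := by linarith
        have h2 : d = 0 := by linarith
        rw [h1, h2] at hN'
        simp at hN'
        omega
    have e := finsum_mem_range (f := fun X => x.coeff X) hinj
    change _ = ∑ᶠ k : ℤ, x.coeff (bar (((ModularGroup.T ^ k : SL(2, ℤ)) : Mat) * N))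
    rw [← e, finsum_mem_eq_sum_of_inter_support_eq]
    ext X
    simp only [Set.mem_inter_iff, Set.mem_range, Function.mem_support, Finset.coe_filter,
      Set.mem_ofPred_eq, Finsupp.mem_support_iff]
    constructor
    · rintro ⟨⟨k, rfl⟩, hk⟩
      exact ⟨⟨hk, ((hreq _ _).2 ⟨k, bar_mul _ _⟩).symm⟩, hk⟩
    · rintro ⟨⟨hk, e⟩, -⟩
      obtain ⟨k, rfl⟩ := (hreq _ _).1 e.symm
      exact ⟨⟨k, bar_mul _ _⟩, hk⟩
  have := p.sum_mem fun X hX => p.smul_mem (x.coeff X) (hrep X hX)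
  simp only [smul_sub, Finset.sum_sub_distrib] at this
  rwa [← hsum, hzero, sub_zero] at this

theorem basisElt_mem_R {n : ℕ} {A : Mat} (hA : A.det = n) : basisElt A ∈ R n := by
  rw [R, MonoidAlgebra.mem_supported]
  intro X hX
  have hX' : X = bar A := by simpa using Finsupp.support_single_subset hX
  rw [hX']
  exact bar_mem_barSet_iff.2 hA

theorem co_basisElt (A N : Mat) [Decidable (bar A = bar N)] :
    co (basisElt A) N = if bar A = bar N then 1 else 0 := by
  rw [co, basisElt, MonoidAlgebra.coeff_single]
  classical
  rw [Finsupp.single_apply]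

/-- The sum of the coefficients of `T_n^∞` along an orbit of `T`. -/
theorem sum_co_Tinf {n : ℕ} (hn : 0 < n) {s : Finset Mat} (hs : IsCuspReps n s) {a b c d : ℤ}
    (hN : Matrix.det !![a, b; c, d] = n) :
    (Function.support fun k : ℤ =>
      co (Tinf s) (((ModularGroup.T ^ k : SL(2, ℤ)) : Mat) * !![a, b; c, d])).Finite ∧
    ∑ᶠ k : ℤ, co (Tinf s) (((ModularGroup.T ^ k : SL(2, ℤ)) : Mat) * !![a, b; c, d]) =
      if c = 0 then 1 else 0 := by
  classical
  have hco : ∀ N : Mat, co (Tinf s) N = ∑ M ∈ s, if bar M = bar N then 1 else 0 := fun N => by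
    rw [Finset.sum_congr rfl fun M _ => (co_basisElt M N).symm, Tinf, co,
      MonoidAlgebra.coeff_sum, Finsupp.finsetSum_apply]
    rfl
  split_ifs with hc
  · subst hc
    obtain ⟨M, ⟨hMs, g, hg⟩, huniq⟩ := hs.2 _ hN
    have hu : ∀ M' ∈ s, ∀ h : SL(2, ℤ), bar M' = bar ((h : Mat) * !![a, b; 0, d]) → M' = M := by
      intro M' hM' h e
      rcases bar_eq_iff.1 e with e | e
      · exact huniq M' ⟨hM', h, e⟩
      · exact huniq M' ⟨hM', -h, by rw [e, Matrix.SpecialLinearGroup.coe_neg, neg_mul]⟩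
    rw [Matrix.det_fin_two_of] at hN
    have hn' : (0 : ℤ) < n := by exact_mod_cast hn
    have ha : a ≠ 0 := by rintro rfl; simp at hN; omega
    have hd : d ≠ 0 := by rintro rfl; simp at hN; omega
    obtain ⟨j, hj⟩ : ∃ j : ℤ, bar M = bar (((ModularGroup.T ^ j : SL(2, ℤ)) : Mat) *
        !![a, b; 0, d]) := by
      have hM0 := (hs.1 M hMs).2
      have hdet := g.det_coe
      obtain ⟨p, q, r, u, e⟩ := exists_entries (g : Mat)
      rw [hg, e, Matrix.mul_fin_two] at hM0
      have hr : r = 0 := by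
        have : r * a + u * 0 = 0 := hM0
        rw [mul_zero, add_zero, mul_eq_zero] at this
        exact this.resolve_right ha
      subst hr
      rw [e, Matrix.det_fin_two_of, mul_zero, sub_zero] at hdet
      rcases Int.eq_one_or_neg_one_of_mul_eq_one' hdet with ⟨rfl, rfl⟩ | ⟨rfl, rfl⟩
      · refine ⟨q, ?_⟩
        rw [hg, e, coe_T_zpow]
      · refine ⟨-q, ?_⟩
        rw [hg, e, coe_T_zpow, ← bar_neg, ← neg_mul, neg_fin_two]
        norm_num
    have key : ∀ k : ℤ, co (Tinf s) (((ModularGroup.T ^ k : SL(2, ℤ)) : Mat) * !![a, b; 0, d]) =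
        if k = j then 1 else 0 := by
      intro k
      rw [hco, Finset.sum_eq_single_of_mem M hMs fun M' hM' hne => if_neg fun e =>
        hne (hu M' hM' _ e)]
      congr 1
      rw [hj]
      apply propext
      constructor
      · intro e
        simp only [coe_T_zpow, Matrix.mul_fin_two] at e
        rcases bar_eq_iff.1 e with e | e
        · rw [mk_eq_mk_iff] at e
          have : (k - j) * d = 0 := by linarith [e.2.1]
          rcases mul_eq_zero.1 this with h | h
          · linarith
          · exact absurd h hd
        · rw [neg_fin_two, mk_eq_mk_iff] at e
          exact absurd (by linarith [e.2.2.2]) hd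
      · rintro rfl; rfl
    constructor
    · refine (Set.finite_singleton j).subset fun k hk => ?_
      by_contra h
      exact hk ((key k).trans (if_neg h))
    · rw [finsum_congr key, finsum_eq_single _ j fun k hk => if_neg hk, if_pos rfl]
  · have key : ∀ k : ℤ, co (Tinf s) (((ModularGroup.T ^ k : SL(2, ℤ)) : Mat) * !![a, b; c, d]) =
        0 := by
      intro k
      rw [hco]
      refine Finset.sum_eq_zero fun M hM => if_neg fun e => hc ?_
      have hM0 := (hs.1 M hM).2
      rw [coe_T_zpow, Matrix.mul_fin_two] at e
      rcases bar_eq_iff.1 e with e | e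
      · rw [e] at hM0
        have : 0 * a + 1 * c = 0 := hM0
        linarith
      · rw [e] at hM0
        have : -(0 * a + 1 * c) = 0 := hM0
        linarith
    constructor
    · convert Set.finite_empty
      ext k
      simp [key k]
    · rw [finsum_congr key, finsum_zero]

theorem Tinf_mem_R {n : ℕ} {s : Finset Mat} (hs : IsCuspReps n s) : Tinf s ∈ R n :=
  (R n).sum_mem fun M hM => basisElt_mem_R (hs.1 M hM).1

/-- It suffices to compare sums along `T`-orbits. Both `(1 - S) * theta` and `Tinf s * (1 - S)` give
the indicator of `c = 0` minus that of `d = 0`, the first by telescoping `qv`. -/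
theorem propertyA_theta {n : ℕ} (hn : 0 < n) {s : Finset Mat} (hs : IsCuspReps n s) :
    PropertyA n s (theta hn) := by
  have hTR := Tinf_mem_R hs
  set st := basisElt (ModularGroup.S : SL(2, ℤ)) with hst
  have hR : (1 - st) * theta hn - Tinf s * (1 - st) ∈ R n := by
    rw [sub_mul, mul_sub, one_mul, mul_one]
    exact (R n).sub_mem ((R n).sub_mem (theta_mem_R hn) (basisElt_mul_mem_R _ (theta_mem_R hn)))
      ((R n).sub_mem hTR (mul_basisElt_mem_R _ hTR))
  refine exists_one_sub_T_mul hn hR fun N hN => ?_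
  have hco : ∀ A : Mat, A.det = n → co ((1 - st) * theta hn - Tinf s * (1 - st)) A =
      (qv A - qv ((ModularGroup.T : SL(2, ℤ)) * A)) -
        (co (Tinf s) A - co (Tinf s) (A * (ModularGroup.S : SL(2, ℤ)))) := fun A hA => by
    rw [sub_mul, mul_sub, one_mul, mul_one, co_sub, co_sub, co_sub, hst, co_S_mul, co_mul_S,
      co_theta hn hA, co_theta hn ((det_SL_mul _ _).trans hA), wt_sub_wt_S_mul]
  rw [finsum_congr fun k => hco _ ((det_SL_mul (ModularGroup.T ^ k) N).trans hN)]
  obtain ⟨a, b, c, d, rfl⟩ := exists_entries N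
  have hNS : !![a, b; c, d] * ((ModularGroup.S : SL(2, ℤ)) : Mat) = !![b, -a; d, -c] := by
    rw [coe_S, Matrix.mul_fin_two]; norm_num
  obtain ⟨f1, s1⟩ := sum_co_Tinf hn hs hN
  obtain ⟨f2, s2⟩ := sum_co_Tinf hn hs (hNS ▸ (det_mul_SL _ ModularGroup.S).trans hN)
  simp only [mul_assoc, hNS]
  have hdet : 0 < a * d - b * c := by
    rw [← Matrix.det_fin_two_of, hN]; exact_mod_cast hn
  obtain ⟨l₀, l₁, h₀, h₁, hl⟩ := qv_limits hdet
  obtain ⟨f3, s3⟩ := telescope h₀ h₁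
  have e : ∀ k : ℤ, qv (((ModularGroup.T ^ k : SL(2, ℤ)) : Mat) * !![a, b; c, d]) -
      qv (((ModularGroup.T : SL(2, ℤ)) : Mat) * (((ModularGroup.T ^ k : SL(2, ℤ)) : Mat) *
        !![a, b; c, d])) = qv !![a + k * c, b + k * d; c, d] -
          qv !![a + (k + 1) * c, b + (k + 1) * d; c, d] := fun k => by
    rw [← mul_assoc, ← Matrix.SpecialLinearGroup.coe_mul, ← zpow_one_add, add_comm 1 k, coe_T_zpow,
      coe_T_zpow, Matrix.mul_fin_two, Matrix.mul_fin_two]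
    simp only [one_mul, zero_mul, zero_add]
  simp only [e]
  rw [finsum_sub_distrib f3 ((f1.union f2).subset (Function.support_sub _ _)),
    finsum_sub_distrib f1 f2, s1, s2, s3, hl]
  ring

/-! ### Traces of operators exchanging two subspaces -/

section Swap

variable {K V : Type*} [Field K] [AddCommGroup V] [Module K V]

/-- Project along `B` onto a complement of `A ⊓ B` inside `A`. -/
theorem exists_partial_projection {A B : Submodule K V} (h : A ⊔ B = ⊤) :
    ∃ P : V →ₗ[K] V, (∀ x, P x ∈ A) ∧ (∀ b ∈ B, P b = 0) ∧ (∀ x, P (P x) = P x) ∧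
      ∀ x, x - P x ∈ B := by
  obtain ⟨W', hW'⟩ := exists_isCompl (A ⊓ B)
  have h1 : A ⊓ B ⊔ W' ⊓ A = A := by
    rw [← sup_inf_assoc_of_le W' inf_le_left, hW'.sup_eq_top, top_inf_eq]
  have hC : IsCompl (W' ⊓ A) B := by
    constructor
    · rw [disjoint_iff, inf_assoc, inf_comm, hW'.inf_eq_bot]
    · rw [codisjoint_iff, ← h]
      apply le_antisymm
      · exact sup_le_sup_right inf_le_right B
      · refine sup_le ?_ le_sup_right
        conv_lhs => rw [← h1]
        exact sup_le (inf_le_right.trans le_sup_right) le_sup_left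
  refine ⟨(W' ⊓ A).projection B hC, fun x => (Submodule.projection_apply_mem hC x).2,
    fun b hb => Submodule.projection_apply_right hC ⟨b, hb⟩, fun x => ?_,
    fun x => Submodule.sub_projection_mem hC x⟩
  exact Submodule.projection_apply_left hC ⟨_, Submodule.projection_apply_mem hC x⟩

/-- The operator `1 - P - Q` maps `V` into `A ⊓ B` and is the identity there, so the trace on the
intersection is that of `(1 - P - Q) * f`. Since `f` sends `A` into `B` and `P` kills `B`, `P * f *
P = 0`, and idempotence of `P` gives `P * f` trace zero; likewise for `Q`. -/
theorem trace_restrict_of_swap [FiniteDimensional K V] {A B : Submodule K V} (h : A ⊔ B = ⊤)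
    {f : V →ₗ[K] V} (hA : ∀ a ∈ A, f a ∈ B) (hB : ∀ b ∈ B, f b ∈ A)
    (hW : ∀ w ∈ A ⊓ B, f w ∈ A ⊓ B) :
    LinearMap.trace K (A ⊓ B : Submodule K V) (f.restrict hW) = LinearMap.trace K V f := by
  obtain ⟨P, hP1, hP2, hP3, hP4⟩ := exists_partial_projection h
  obtain ⟨Q, hQ1, hQ2, hQ3, hQ4⟩ := exists_partial_projection (sup_comm A B ▸ h)
  have key : ∀ x, x - P x - Q x ∈ A ⊓ B := by
    intro x
    refine ⟨?_, ?_⟩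
    · have := A.sub_mem (hQ4 x) (hP1 x)
      rwa [sub_right_comm] at this
    · exact B.sub_mem (hP4 x) (hQ1 x)
  let π : V →ₗ[K] (A ⊓ B : Submodule K V) :=
    LinearMap.codRestrict (A ⊓ B) (LinearMap.id - P - Q) key
  have tP : LinearMap.trace K V (P * f) = 0 := by
    have e1 : P * f = P * (P * f) := LinearMap.ext fun x => (hP3 (f x)).symm
    have e2 : P * f * P = 0 := LinearMap.ext fun x => hP2 _ (hA _ (hP1 x))
    rw [e1, LinearMap.trace_mul_comm, e2, map_zero]
  have tQ : LinearMap.trace K V (Q * f) = 0 := by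
    have e1 : Q * f = Q * (Q * f) := LinearMap.ext fun x => (hQ3 (f x)).symm
    have e2 : Q * f * Q = 0 := LinearMap.ext fun x => hQ2 _ (hB _ (hQ1 x))
    rw [e1, LinearMap.trace_mul_comm, e2, map_zero]
  have e3 : f.restrict hW = (π ∘ₗ f) ∘ₗ (A ⊓ B).subtype := by
    ext ⟨w, hw⟩
    change f w = f w - P (f w) - Q (f w)
    rw [hP2 _ (hW w hw).2, hQ2 _ (hW w hw).1, sub_zero, sub_zero]
  have e4 : (A ⊓ B).subtype ∘ₗ (π ∘ₗ f) = f - P * f - Q * f := by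
    ext x; rfl
  rw [e3, LinearMap.trace_comp_comm', e4, map_sub, map_sub, tP, tQ, sub_zero, sub_zero]

end Swap

/-! ### The action on `V` -/

section Action

variable {V : Type*} [AddCommGroup V] [Module ℂ V] {ρ : Representation ℂ (SL(2, ℤ))ᵐᵒᵖ V}
  {Sig : Set Mat} {act : Mat → (V →ₗ[ℂ] V)}

theorem mem_sig_SL_mul_iff (hS : IsDoubleCoset Sig) (g : SL(2, ℤ)) (N : Mat) :
    (g : Mat) * N ∈ Sig ↔ N ∈ Sig := by
  constructor
  · intro h
    have := hS g⁻¹ 1 _ h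
    rwa [← mul_assoc, coe_inv_mul, one_mul, Matrix.SpecialLinearGroup.coe_one, mul_one] at this
  · intro h
    have := hS g 1 _ h
    rwa [Matrix.SpecialLinearGroup.coe_one, mul_one] at this

theorem mem_sig_mul_SL_iff (hS : IsDoubleCoset Sig) (g : SL(2, ℤ)) (N : Mat) :
    N * (g : Mat) ∈ Sig ↔ N ∈ Sig := by
  constructor
  · intro h
    have := hS 1 g⁻¹ _ h
    rwa [mul_assoc, mul_assoc, coe_mul_inv, mul_one, Matrix.SpecialLinearGroup.coe_one,
      one_mul] at this
  · intro h
    have := hS 1 g _ h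
    rwa [Matrix.SpecialLinearGroup.coe_one, one_mul] at this

theorem extAct_SL_mul (hS : IsDoubleCoset Sig) (hc : IsCompatible ρ Sig act) (g : SL(2, ℤ))
    (N : Mat) (P : V) :
    extAct Sig act ((g : Mat) * N) P = extAct Sig act N (slash ρ g P) := by
  by_cases hN : N ∈ Sig
  · rw [extAct, extAct, if_pos hN, if_pos ((mem_sig_SL_mul_iff hS g N).2 hN), (hc g N hN P).1]
  · rw [extAct, extAct, if_neg hN, if_neg ((mem_sig_SL_mul_iff hS g N).not.2 hN)]; rfl

theorem extAct_mul_SL (hS : IsDoubleCoset Sig) (hc : IsCompatible ρ Sig act) (g : SL(2, ℤ))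
    (N : Mat) (P : V) :
    extAct Sig act (N * (g : Mat)) P = slash ρ g (extAct Sig act N P) := by
  by_cases hN : N ∈ Sig
  · rw [extAct, extAct, if_pos hN, if_pos ((mem_sig_mul_SL_iff hS g N).2 hN), (hc g N hN P).2]
  · rw [extAct, extAct, if_neg hN, if_neg ((mem_sig_mul_SL_iff hS g N).not.2 hN)]
    exact (map_zero _).symm

theorem slash_mul (g h : SL(2, ℤ)) (P : V) : slash ρ (g * h) P = slash ρ h (slash ρ g P) := by
  rw [slash, MulOpposite.op_mul, map_mul]; rfl

theorem slash_one (P : V) : slash ρ 1 P = P := by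
  rw [slash, MulOpposite.op_one, map_one]; rfl

theorem trace_extAct_cj [FiniteDimensional ℂ V] (hS : IsDoubleCoset Sig)
    (hc : IsCompatible ρ Sig act) (g : SL(2, ℤ)) (N : Mat) :
    LinearMap.trace ℂ V (extAct Sig act (cj g N)) = LinearMap.trace ℂ V (extAct Sig act N) := by
  have h1 : extAct Sig act (cj g N) = slash ρ g⁻¹ * (extAct Sig act N * slash ρ g) := by
    ext P
    rw [cj, extAct_mul_SL hS hc, extAct_SL_mul hS hc]; rfl
  have h2 : slash ρ g * slash ρ g⁻¹ = 1 := by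
    ext P
    change slash ρ g (slash ρ g⁻¹ P) = P
    rw [← slash_mul, inv_mul_cancel, slash_one]
  rw [h1, LinearMap.trace_mul_comm, mul_assoc, h2, mul_one]

theorem algAct_add (x y : BarAlg) :
    algAct Sig act (x + y) = algAct Sig act x + algAct Sig act y := by
  rw [algAct, MonoidAlgebra.coeff_add, Finsupp.sum_add_index']
  · rfl
  · intro X; simp
  · intro X a b; push_cast; rw [add_smul]

theorem algAct_smul (q : ℚ) (x : BarAlg) :
    algAct Sig act (q • x) = (q : ℂ) • algAct Sig act x := by
  rw [algAct, MonoidAlgebra.coeff_smul, Finsupp.sum_smul_index' fun X => by simp, algAct,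
    Finsupp.smul_sum]
  refine Finsupp.sum_congr fun X _ => ?_
  rw [smul_smul, smul_eq_mul]
  push_cast
  rfl

theorem algAct_zero : algAct Sig act 0 = 0 := by
  rw [algAct]; simp

theorem algAct_single (X : BarMat) (q : ℚ) :
    algAct Sig act (MonoidAlgebra.single X q) = (q : ℂ) • barAct Sig act X := by
  rw [algAct, MonoidAlgebra.coeff_single, Finsupp.sum_single_index (by simp)]

theorem algAct_basisElt_mul (hρ : slash ρ (-1) = 1) (hS : IsDoubleCoset Sig)
    (hc : IsCompatible ρ Sig act) (g : SL(2, ℤ)) (x : BarAlg) (P : V) :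
    algAct Sig act (basisElt (g : Mat) * x) P = algAct Sig act x (slash ρ g P) := by
  induction x using MonoidAlgebra.induction_linear with
  | zero => rw [mul_zero, algAct_zero]; rfl
  | add x y hx hy => rw [mul_add, algAct_add, algAct_add, LinearMap.add_apply, hx, hy]; rfl
  | single X q =>
    obtain ⟨N, rfl⟩ := bar_surjective X
    rw [basisElt, MonoidAlgebra.single_mul_single, one_mul, algAct_single, algAct_single,
      ← bar_mul, barAct_bar hρ hS hc, barAct_bar hρ hS hc, LinearMap.smul_apply,
      extAct_SL_mul hS hc]
    rfl

theorem algAct_mul_basisElt (hρ : slash ρ (-1) = 1) (hS : IsDoubleCoset Sig)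
    (hc : IsCompatible ρ Sig act) (g : SL(2, ℤ)) (x : BarAlg) (P : V) :
    algAct Sig act (x * basisElt (g : Mat)) P = slash ρ g (algAct Sig act x P) := by
  induction x using MonoidAlgebra.induction_linear with
  | zero => rw [zero_mul, algAct_zero]; exact (map_zero _).symm
  | add x y hx hy =>
    rw [add_mul, algAct_add, algAct_add, LinearMap.add_apply, hx, hy, LinearMap.add_apply, map_add]
  | single X q =>
    obtain ⟨N, rfl⟩ := bar_surjective X
    rw [basisElt, MonoidAlgebra.single_mul_single, mul_one, algAct_single, algAct_single,
      ← bar_mul, barAct_bar hρ hS hc, barAct_bar hρ hS hc, LinearMap.smul_apply,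
      extAct_mul_SL hS hc, LinearMap.smul_apply, map_smul]

theorem mem_kerS_iff {P : V} : P ∈ kerS ρ ↔ P + slash ρ ModularGroup.S P = 0 := Iff.rfl

theorem mem_kerU_iff {P : V} : P ∈ kerU ρ ↔ P + slash ρ U P + slash ρ U (slash ρ U P) = 0 := by
  rw [← slash_mul, ← pow_two]; rfl

theorem algAct_add_S_mul (hρ : slash ρ (-1) = 1) (hS : IsDoubleCoset Sig)
    (hc : IsCompatible ρ Sig act) (x : BarAlg) {P : V} (hP : P ∈ kerS ρ) :
    algAct Sig act (x + basisElt (ModularGroup.S : SL(2, ℤ)) * x) P = 0 := by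
  rw [algAct_add, LinearMap.add_apply, algAct_basisElt_mul hρ hS hc, ← map_add,
    mem_kerS_iff.1 hP, map_zero]

theorem algAct_add_U_mul (hρ : slash ρ (-1) = 1) (hS : IsDoubleCoset Sig)
    (hc : IsCompatible ρ Sig act) (x : BarAlg) {P : V} (hP : P ∈ kerU ρ) :
    algAct Sig act (x + basisElt (U : Mat) * x + basisElt (U : Mat) * (basisElt (U : Mat) * x)) P
      = 0 := by
  rw [algAct_add, algAct_add, LinearMap.add_apply, LinearMap.add_apply,
    algAct_basisElt_mul hρ hS hc, algAct_basisElt_mul hρ hS hc, algAct_basisElt_mul hρ hS hc,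
    ← map_add, ← map_add, mem_kerU_iff.1 hP, map_zero]

/-- The element `x = theta * (1 + S)` satisfies `U * x = x`, so on `Ker(1 + U + U²)` three times its
action is that of `(1 + U + U²) * x`, which is zero. -/
theorem algAct_theta_mem_kerS (hρ : slash ρ (-1) = 1) (hS : IsDoubleCoset Sig)
    (hc : IsCompatible ρ Sig act) {n : ℕ} (hn : 0 < n) {P : V} (hP : P ∈ kerU ρ) :
    algAct Sig act (theta hn) P ∈ kerS ρ := by
  rw [mem_kerS_iff, ← algAct_mul_basisElt hρ hS hc, ← LinearMap.add_apply, ← algAct_add]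
  set x := theta hn + theta hn * basisElt (ModularGroup.S : SL(2, ℤ)) with hx
  have hu : basisElt (U : Mat) * x = x := U_mul_theta_add hn
  have h := algAct_add_U_mul hρ hS hc x hP
  rw [hu, hu, show x + x + x = (3 : ℚ) • x by module, algAct_smul] at h
  exact (smul_eq_zero.1 h).resolve_left (by norm_num)

theorem algAct_theta_mem_kerU (hρ : slash ρ (-1) = 1) (hS : IsDoubleCoset Sig)
    (hc : IsCompatible ρ Sig act) {n : ℕ} (hn : 0 < n) {P : V} (hP : P ∈ kerS ρ) :
    algAct Sig act (theta hn) P ∈ kerU ρ := by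
  rw [mem_kerU_iff, ← algAct_mul_basisElt hρ hS hc, ← algAct_mul_basisElt hρ hS hc,
    ← LinearMap.add_apply, ← LinearMap.add_apply, ← algAct_add, ← algAct_add]
  set x := theta hn + theta hn * basisElt (U : Mat) +
    theta hn * basisElt (U : Mat) * basisElt (U : Mat) with hx
  have hs : basisElt (ModularGroup.S : SL(2, ℤ)) * x = x := S_mul_theta_add hn
  have h := algAct_add_S_mul hρ hS hc x hP
  rw [hs, show x + x = (2 : ℚ) • x by module, algAct_smul] at h
  exact (smul_eq_zero.1 h).resolve_left (by norm_num)

/-- Elements with property (A) act on the period subspace like `theta`. -/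
theorem algAct_eq_theta (hρ : slash ρ (-1) = 1) (hS : IsDoubleCoset Sig)
    (hc : IsCompatible ρ Sig act) {n : ℕ} (hn : 0 < n) {s : Finset Mat} (hs : IsCuspReps n s)
    {x : BarAlg} (hA : PropertyA n s x) {P : V} (hP : P ∈ periodSubspace ρ) :
    algAct Sig act x P = algAct Sig act (theta hn) P := by
  obtain ⟨y, hy, hxy⟩ := hA
  obtain ⟨z, hz, hxz⟩ := propertyA_theta hn hs
  obtain ⟨α, β, hαβ⟩ := exists_decomposition hn (x := x - theta hn) ((R n).sub_mem hy hz) (by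
    rw [mul_sub, mul_sub, ← hxy, ← hxz]; abel)
  rw [show x = theta hn + ((α + basisElt (ModularGroup.S : SL(2, ℤ)) * α) +
      (β + basisElt (U : Mat) * β + basisElt (U : Mat) * (basisElt (U : Mat) * β))) by
    rw [← hαβ]; abel, algAct_add, algAct_add, LinearMap.add_apply, LinearMap.add_apply,
    algAct_add_S_mul hρ hS hc α hP.1, algAct_add_U_mul hρ hS hc β hP.2, add_zero, add_zero]

/-! ### The sum over conjugacy classes -/

/-- The sum over a class of the coefficients of the Hecke element. -/
theorem sum_thetaCoeff_class {n : ℕ} (hn : 0 < n) {M : Mat} (hM : M.det = n) :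
    ((∑ᶠ X ∈ {X : BarMat | Quotient.mk conjSetoid X = conjClass M}, thetaCoeff n X : ℚ) : ℝ) =
      eps M := by
  classical
  have hfin := finite_classSet_inter_wt hn hM
  have hn' : (0 : ℤ) < n := by exact_mod_cast hn
  have h1 : ∑ᶠ N ∈ classSet M, wt N = ∑ N ∈ hfin.toFinset, wt N := by
    rw [← finsum_mem_inter_support, finsum_mem_eq_finite_toFinset_sum _ hfin]
  have hco : ∀ N ∈ classSet M, thetaCoeff n (bar N) = wt N := fun N hN => by
    rw [thetaCoeff, if_pos (bar_mem_barSet_iff.2 ((det_of_mem_classSet hN).trans hM)), wt_out]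
  have h2 : ∑ N ∈ hfin.toFinset, wt N = ∑ X ∈ hfin.toFinset.image bar, 2 * thetaCoeff n X := by
    rw [← Finset.sum_fiberwise_of_maps_to (g := bar) (t := hfin.toFinset.image bar)
      fun N hN => Finset.mem_image_of_mem bar hN]
    refine Finset.sum_congr rfl fun X hX => ?_
    obtain ⟨N, hN, rfl⟩ := Finset.mem_image.1 hX
    rw [Set.Finite.mem_toFinset] at hN
    have hne : N ≠ -N := fun e => by
      have h0 : ∀ i j, N i j = 0 := fun i j => by
        have : N i j = -N i j := congrFun (congrFun e i) j
        omega
      have hd := (det_of_mem_classSet hN.1).trans hM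
      rw [Matrix.det_fin_two, h0 0 0, h0 0 1] at hd
      simp at hd
      omega
    have : (hfin.toFinset.filter fun A => bar A = bar N) = {N, -N} := by
      ext A
      simp only [Finset.mem_filter, Set.Finite.mem_toFinset, Finset.mem_insert,
        Finset.mem_singleton, bar_eq_iff]
      refine ⟨fun h => h.2, fun h => ⟨?_, h⟩⟩
      rcases h with rfl | rfl
      · exact hN
      · exact ⟨neg_mem_classSet hN.1, by rw [Function.mem_support, wt_neg]; exact hN.2⟩
    rw [this, Finset.sum_pair hne, wt_neg, hco N hN.1]
    ring
  have h3 : ∑ᶠ X ∈ {X : BarMat | Quotient.mk conjSetoid X = conjClass M}, thetaCoeff n X =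
      ∑ X ∈ hfin.toFinset.image bar, thetaCoeff n X := by
    apply finsum_mem_eq_sum_of_inter_support_eq
    ext X
    obtain ⟨N, rfl⟩ := bar_surjective X
    constructor
    · rintro ⟨hX, hsupp⟩
      have hN : N ∈ classSet M := hX
      refine ⟨Finset.mem_coe.2 (Finset.mem_image_of_mem bar (hfin.mem_toFinset.2 ⟨hN, ?_⟩)), hsupp⟩
      rw [Function.mem_support, ← hco N hN]; exact hsupp
    · rintro ⟨hX, hsupp⟩
      obtain ⟨A, hA, hAN⟩ := Finset.mem_image.1 (Finset.mem_coe.1 hX)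
      refine ⟨?_, hsupp⟩
      rw [← hAN]
      exact (hfin.mem_toFinset.1 hA).1
  have h4 := two_mul_eps hn hM
  rw [h1, h2, ← Finset.mul_sum, ← h3] at h4
  push_cast at h4
  linarith

theorem trace_barAct_eq [FiniteDimensional ℂ V] (hρ : slash ρ (-1) = 1) (hS : IsDoubleCoset Sig)
    (hc : IsCompatible ρ Sig act) {X : BarMat} {M : Mat}
    (h : Quotient.mk conjSetoid X = conjClass M) :
    LinearMap.trace ℂ V (barAct Sig act X) = LinearMap.trace ℂ V (extAct Sig act M) := by
  obtain ⟨N, rfl⟩ := bar_surjective X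
  rw [barAct_bar hρ hS hc]
  obtain ⟨g, rfl | rfl⟩ := conjClass_eq_iff.1 (show conjClass N = conjClass M from h)
  · exact trace_extAct_cj hS hc g M
  · rw [extAct_neg hρ hS hc, trace_extAct_cj hS hc]

/-- The classes met by the support of the Hecke element. -/
theorem finite_eps_ne_zero {n : ℕ} (hn : 0 < n) :
    {X : ConjClass | ∃ M : Mat, M.det = n ∧ conjClass M = X ∧ eps M ≠ 0}.Finite := by
  refine ((finite_support_thetaCoeff hn).image (Quotient.mk conjSetoid)).subset ?_
  rintro _ ⟨M, hM, rfl, h⟩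
  rw [← sum_thetaCoeff_class hn hM, ne_eq, Rat.cast_eq_zero] at h
  obtain ⟨X, hX⟩ := exists_ne_zero_of_finsum_mem_ne_zero h
  exact ⟨X, hX.2, hX.1⟩

/-- Group the support of `theta` by conjugacy class. The trace is constant on a class and can be
factored out; the coefficients of the class add up to `eps`. -/
theorem trace_algAct_theta [FiniteDimensional ℂ V] (hρ : slash ρ (-1) = 1)
    (hS : IsDoubleCoset Sig) (hc : IsCompatible ρ Sig act) {n : ℕ} (hn : 0 < n)
    (hSn : Sig ⊆ detSet n) (rep : ConjClass → Mat)
    (hrep : ∀ X ∈ classesIn Sig, rep X ∈ Sig ∧ conjClass (rep X) = X) :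
    LinearMap.trace ℂ V (algAct Sig act (theta hn)) =
      ∑ᶠ X ∈ classesIn Sig, LinearMap.trace ℂ V (act (rep X)) * (eps (rep X) : ℂ) := by
  classical
  set F := (finite_support_thetaCoeff hn).toFinset with hF
  set κ : BarMat → ConjClass := Quotient.mk conjSetoid with hκ
  have h1 : LinearMap.trace ℂ V (algAct Sig act (theta hn)) =
      ∑ X ∈ F, (thetaCoeff n X : ℂ) * LinearMap.trace ℂ V (barAct Sig act X) := by
    rw [algAct, Finsupp.sum, map_sum]
    refine Finset.sum_congr (Finset.ext fun X => ?_) fun X _ => ?_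
    · rw [Finsupp.mem_support_iff, hF, Set.Finite.mem_toFinset]; rfl
    · rw [map_smul]; rfl
  have h2 : ∀ Y ∈ F.image κ, ∑ X ∈ F with κ X = Y,
      (thetaCoeff n X : ℂ) * LinearMap.trace ℂ V (barAct Sig act X) =
      if Y ∈ classesIn Sig then LinearMap.trace ℂ V (act (rep Y)) * (eps (rep Y) : ℂ) else 0 := by
    intro Y _
    split_ifs with hY
    · obtain ⟨r1, r2⟩ := hrep Y hY
      have e : ∀ X ∈ F.filter fun X => κ X = Y,
          (thetaCoeff n X : ℂ) * LinearMap.trace ℂ V (barAct Sig act X) =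
          LinearMap.trace ℂ V (act (rep Y)) * (thetaCoeff n X : ℂ) := fun X hX => by
        rw [trace_barAct_eq hρ hS hc ((Finset.mem_filter.1 hX).2.trans r2.symm), extAct, if_pos r1,
          mul_comm]
      rw [Finset.sum_congr rfl e, ← Finset.mul_sum, ← sum_thetaCoeff_class hn (hSn r1), r2]
      congr 1
      have : ∑ᶠ X ∈ {X : BarMat | Quotient.mk conjSetoid X = Y}, thetaCoeff n X =
          ∑ X ∈ F with κ X = Y, thetaCoeff n X := by
        apply finsum_mem_eq_sum_of_inter_support_eq
        ext X
        simp only [Set.mem_inter_iff, Set.mem_ofPred_eq, Function.mem_support, Finset.coe_filter, hF,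
          Set.Finite.mem_toFinset, hκ]
        tauto
      rw [this]
      push_cast
      rfl
    · refine Finset.sum_eq_zero fun X hX => ?_
      obtain ⟨N, rfl⟩ := bar_surjective X
      have hN : N ∉ Sig := fun h => hY ⟨N, h, (Finset.mem_filter.1 hX).2⟩
      rw [barAct_bar hρ hS hc, extAct, if_neg hN, map_zero, mul_zero]
  rw [h1, ← Finset.sum_fiberwise_of_maps_to (g := κ) (t := F.image κ)
    fun X hX => Finset.mem_image_of_mem κ hX, Finset.sum_congr rfl h2, ← Finset.sum_filter]
  symm
  apply finsum_mem_eq_sum_of_inter_support_eq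
  ext Y
  simp only [Set.mem_inter_iff, Function.mem_support, Finset.coe_filter, Set.mem_ofPred_eq]
  constructor
  · rintro ⟨hY, hne⟩
    refine ⟨⟨?_, hY⟩, hne⟩
    obtain ⟨r1, r2⟩ := hrep Y hY
    have h := (mul_ne_zero_iff.1 hne).2
    rw [Complex.ofReal_ne_zero, ← sum_thetaCoeff_class hn (hSn r1), ne_eq, Rat.cast_eq_zero] at h
    obtain ⟨X, hX⟩ := exists_ne_zero_of_finsum_mem_ne_zero h
    refine Finset.mem_image.2 ⟨X, (Set.Finite.mem_toFinset _).2 hX.2, hX.1.trans r2⟩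
  · rintro ⟨⟨-, hY⟩, hne⟩
    exact ⟨hY, hne⟩

end Action

end PeriodTrace

end

/-! ### The trace formula -/

theorem mainTheorem5 {V : Type*} [AddCommGroup V] [Module ℂ V] [FiniteDimensional ℂ V]
    (ρ : Representation ℂ (SL(2, ℤ))ᵐᵒᵖ V)
    (hρ : PeriodTrace.slash ρ (-1) = 1)
    (hV : PeriodTrace.kerS ρ ⊔ PeriodTrace.kerU ρ = ⊤)
    (n : ℕ) (hn : 0 < n)
    (Sig : Set PeriodTrace.Mat) (hSig : PeriodTrace.IsDoubleCoset Sig)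
    (hSign : Sig ⊆ PeriodTrace.detSet n)
    (act : PeriodTrace.Mat → (V →ₗ[ℂ] V)) (hact : PeriodTrace.IsCompatible ρ Sig act)
    (s : Finset PeriodTrace.Mat) (hs : PeriodTrace.IsCuspReps n s)
    (Tn : PeriodTrace.BarAlg) (hTn : Tn ∈ PeriodTrace.R n) (hA : PeriodTrace.PropertyA n s Tn)
    (rep : PeriodTrace.ConjClass → PeriodTrace.Mat)
    (hrep : ∀ X ∈ PeriodTrace.classesIn Sig, rep X ∈ Sig ∧ PeriodTrace.conjClass (rep X) = X) :
    {X | X ∈ PeriodTrace.classesIn Sig ∧ PeriodTrace.eps (rep X) ≠ 0}.Finite ∧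
    ∃ hW : ∀ P ∈ PeriodTrace.periodSubspace ρ,
        PeriodTrace.algAct Sig act Tn P ∈ PeriodTrace.periodSubspace ρ,
      LinearMap.trace ℂ (PeriodTrace.periodSubspace ρ)
          ((PeriodTrace.algAct Sig act Tn).restrict hW) =
        ∑ᶠ X ∈ PeriodTrace.classesIn Sig,
          LinearMap.trace ℂ V (act (rep X)) * (PeriodTrace.eps (rep X) : ℂ) := by
  classical
  refine ⟨(PeriodTrace.finite_eps_ne_zero hn).subset ?_, ?_⟩
  · rintro X ⟨hX, h⟩
    obtain ⟨r1, r2⟩ := hrep X hX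
    exact ⟨rep X, hSign r1, r2, h⟩
  · have hθ := fun P hP => PeriodTrace.algAct_eq_theta hρ hSig hact hn hs hA (P := P) hP
    have hWθ : ∀ P ∈ PeriodTrace.periodSubspace ρ,
        PeriodTrace.algAct Sig act (PeriodTrace.theta hn) P ∈ PeriodTrace.periodSubspace ρ :=
      fun P hP => ⟨PeriodTrace.algAct_theta_mem_kerS hρ hSig hact hn hP.2,
        PeriodTrace.algAct_theta_mem_kerU hρ hSig hact hn hP.1⟩
    have hW : ∀ P ∈ PeriodTrace.periodSubspace ρ,
        PeriodTrace.algAct Sig act Tn P ∈ PeriodTrace.periodSubspace ρ :=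
      fun P hP => by rw [hθ P hP]; exact hWθ P hP
    refine ⟨hW, ?_⟩
    have e : (PeriodTrace.algAct Sig act Tn).restrict hW =
        (PeriodTrace.algAct Sig act (PeriodTrace.theta hn)).restrict hWθ := by
      ext ⟨P, hP⟩
      exact hθ P hP
    rw [e, ← PeriodTrace.trace_algAct_theta hρ hSig hact hn hSign rep hrep]
    exact PeriodTrace.trace_restrict_of_swap hV
      (fun _ h => PeriodTrace.algAct_theta_mem_kerU hρ hSig hact hn h)
      (fun _ h => PeriodTrace.algAct_theta_mem_kerS hρ hSig hact hn h) hWθ
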